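/- Let $d\ge 1$, let $N_1=h,N_2,\dots,N_d$ be layer widths, and let $\sigma_1,\dots,\sigma_{d-1}:\mathbb{R}\to\mathbb{R}$ be activation functions such that each $\sigma_i$ is continuous, non-decreasing and $L_i$-Lipschitz with $L_i>0$, satisfies $\sigma_i(0)\ge 0$, and admits constants $q(i),Q_\sigma(i)>0$ with $\sigma_i(x_2)-\sigma_i(x_1)\ge Q_\sigma(i)(x_2-x_1)$ whenever $0\le x_1\le x_2\le q(i)$. Consider the depth-$d$ networks $$f(\mathbf{x})=\mathbf{w}_d^T\sigma_{d-1}\big(\mathbf{W}_{d-1}\sigma_{d-2}(\cdots\sigma_1(\mathbf{W}_1\mathbf{x}))\big),\qquad \mathbf{x}\in\mathbb{R}^h,$$ with $\mathbf{W}_i\in\mathbb{R}^{N_{i+1}\times N_i}$, $\mathbf{w}_d\in\mathbb{R}^{N_d}$ and activations acting entrywise. For a set $\mathcal{F}$ of such networks put $$d_{\mathcal{F}}(\mu,\nu)=\sup_{f\in\mathcal{F}}|\mathbb{E}_\mu f-\mathbb{E}_\nu f|.$$ Let $\Gamma>0$ and let $\mu,\nu$ be Borel probability measures on $\mathbb{R}^h$,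 each of which, call it $\rho$, has a mean $\mathbf{u}_\rho$ with $\|\mathbf{u}_\rho\|\le\Gamma$ and a variance parameter $0<\tau_\rho\le\Gamma$ with $\mathbb{E}_{\mathbf{x}\sim\rho}\,e^{\mathbf{a}^T(\mathbf{x}-\mathbf{u}_\rho)}\le e^{\|\mathbf{a}\|^2\tau_\rho^2/2}$ for all $\mathbf{a}\in\mathbb{R}^h$ (the support may be unbounded). Let $n,m\ge1$, let $\hat\mu_n$ and $\hat\nu_m$ be the empirical measures of independent i.i.d. samples of size $n$ from $\mu$ and of size $m$ from $\nu$, and let $\delta>0$ satisfy $\sqrt{6h}\,\min\{n,m\}\sqrt{m^{-1}+n^{-1}}\ge 4\sqrt{\log(1/\delta)}$ (for $\delta\ge1$ both assertions below are trivial). **(I)** Let $M_F(1),\dots,M_F(d)\ge0$ and let $\mathcal{F}$ be the set of networks with $\|\mathbf{W}_i\|_F\le M_F(i)$ (Frobenius norm) for $i<d$ and $\|\mathbf{w}_d\|_2\le M_F(d)$. If $\sigma_i(\alpha x)=\alpha\sigma_i(x)$ for all $i$, all $\alpha>0$ and all $x$, then with probability at least $1-\delta$ $$|d_{\mathcal{F}}(\mu,\nu)-d_{\mathcal{F}}(\hat\mu_n,\hat\nu_m)|\le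 2\Gamma\prod_{i=1}^dM_F(i)\prod_{i=1}^{d-1}L_i\Big(\sqrt{6d\log2+5h/4}+\sqrt{2h\log(1/\delta)}\Big)\big(n^{-1/2}+m^{-1/2}\big).$$ **(II)** Let $M_{1,\infty}(1),\dots,M_{1,\infty}(d)\ge0$ and let $\mathcal{F}$ be the set of networks with $\|\mathbf{W}_i\|_{1,\infty}\le M_{1,\infty}(i)$ (largest $\ell_1$ norm of a row) for $i<d$ and $\|\mathbf{w}_d\|_1\le M_{1,\infty}(d)$. If $\sigma_i(0)=0$ for all $i$, then with probability at least $1-\delta$ $$|d_{\mathcal{F}}(\mu,\nu)-d_{\mathcal{F}}(\hat\mu_n,\hat\nu_m)|\le 2\Gamma\prod_{i=1}^dM_{1,\infty}(i)\prod_{i=1}^{d-1}L_i\Big(\sqrt{2d\log2+2\log h}+\sqrt{2h\log(1/\delta)}\Big)\big(n^{-1/2}+m^{-1/2}\big).$$ -/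

import Mathlib

open MeasureTheory
open scoped ENNReal

noncomputable section

/-- `ℝ^k` with the Euclidean norm. -/
abbrev Euc (k : ℕ) : Type := EuclideanSpace ℝ (Fin k)

/-- Frobenius norm of a real matrix. -/
def frobNorm {p q : ℕ} (A : Matrix (Fin p) (Fin q) ℝ) : ℝ :=
  Real.sqrt (∑ r, ∑ c, A r c ^ 2)

/-- `‖A‖_{1,∞}`: the largest `ℓ¹` norm of a row of `A` (and `0` if there are no rows). -/
def rowNorm {p q : ℕ} (A : Matrix (Fin p) (Fin q) ℝ) : ℝ :=
  ⨆ r, ∑ c, |A r c|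

/-- `ℓ²` norm of a vector. -/
def l2Norm {p : ℕ} (w : Fin p → ℝ) : ℝ := Real.sqrt (∑ r, w r ^ 2)

/-- `ℓ¹` norm of a vector. -/
def l1Norm {p : ℕ} (w : Fin p → ℝ) : ℝ := ∑ r, |w r|

/-- Weight matrices of layers with widths `N 1, N 2, …`; layer `i` maps `ℝ^(N i)` to
`ℝ^(N (i + 1))`. -/
abbrev Weights (N : ℕ → ℕ) : Type :=
  ∀ i : ℕ, Matrix (Fin (N (i + 1))) (Fin (N i)) ℝ

/-- Output of the first `t` hidden layers: `σ_t (W_t σ_{t-1} (⋯ σ_1 (W_1 x)))`, the activations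
acting entrywise. -/
def hiddenOut (N : ℕ → ℕ) (σ : ℕ → ℝ → ℝ) (W : Weights N) (x : Euc (N 1)) :
    ∀ t : ℕ, Fin (N (t + 1)) → ℝ
  | 0 => fun j => x j
  | t + 1 => fun j => σ (t + 1) ((W (t + 1)).mulVec (hiddenOut N σ W x t) j)

/-- The depth-`d` network `x ↦ w_dᵀ σ_{d-1} (W_{d-1} σ_{d-2} (⋯ σ_1 (W_1 x)))`. -/
def network (N : ℕ → ℕ) (σ : ℕ → ℝ → ℝ) (d : ℕ) (W : Weights N)
    (w : Fin (N (d - 1 + 1)) → ℝ) (x : Euc (N 1)) : ℝ :=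
  ∑ j, w j * hiddenOut N σ W x (d - 1) j

/-- Depth-`d` networks with parameters in
`∏_{i<d} {‖W_i‖_F ≤ M i} × {‖w_d‖₂ ≤ M d}`. -/
def netClassF (N : ℕ → ℕ) (σ : ℕ → ℝ → ℝ) (d : ℕ) (M : ℕ → ℝ) : Set (Euc (N 1) → ℝ) :=
  {f | ∃ (W : Weights N) (w : Fin (N (d - 1 + 1)) → ℝ),
    (∀ i ∈ Finset.Icc 1 (d - 1), frobNorm (W i) ≤ M i) ∧ l2Norm w ≤ M d ∧
      f = network N σ d W w}

/-- Depth-`d` networks with parameters in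
`∏_{i<d} {‖W_i‖_{1,∞} ≤ M i} × {‖w_d‖₁ ≤ M d}`. -/
def netClassOneInf (N : ℕ → ℕ) (σ : ℕ → ℝ → ℝ) (d : ℕ) (M : ℕ → ℝ) :
    Set (Euc (N 1) → ℝ) :=
  {f | ∃ (W : Weights N) (w : Fin (N (d - 1 + 1)) → ℝ),
    (∀ i ∈ Finset.Icc 1 (d - 1), rowNorm (W i) ≤ M i) ∧ l1Norm w ≤ M d ∧
      f = network N σ d W w}

/-- The standing assumptions on an activation function with Lipschitz constant `L`. -/
structure IsActivation (σ : ℝ → ℝ) (L : ℝ) : Prop where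
  continuous : Continuous σ
  monotone : Monotone σ
  zero_nonneg : 0 ≤ σ 0
  pos : 0 < L
  lipschitz : ∀ x y : ℝ, |σ x - σ y| ≤ L * |x - y|
  slope : ∃ q Q : ℝ, 0 < q ∧ 0 < Q ∧
    ∀ x y : ℝ, 0 ≤ x → x ≤ y → y ≤ q → Q * (y - x) ≤ σ y - σ x

/-- The sub-Gaussian probability measures on `ℝ^k` whose mean has norm at most `Γ` and whose
variance parameter `τ` satisfies `0 < τ ≤ Γ`. The support is not restricted. -/
structure IsSubGaussianClass {k : ℕ} (Γ : ℝ) (μ : Measure (Euc k)) : Prop where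
  prob : IsProbabilityMeasure μ
  integrable : Integrable (fun x : Euc k => x) μ
  mean_le : ‖∫ x, x ∂μ‖ ≤ Γ
  subGaussian : ∃ τ : ℝ, 0 < τ ∧ τ ≤ Γ ∧ ∀ a : Euc k,
    Integrable (fun x => Real.exp (inner ℝ a (x - ∫ y, y ∂μ))) μ ∧
      ∫ x, Real.exp (inner ℝ a (x - ∫ y, y ∂μ)) ∂μ ≤ Real.exp (‖a‖ ^ 2 * τ ^ 2 / 2)

/-- `d_F(μ, ν) = sup_{f ∈ F} |E_μ f - E_ν f|`. -/
def netDist {k : ℕ} (F : Set (Euc k → ℝ)) (μ ν : Measure (Euc k)) : ℝ :=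
  sSup {r : ℝ | ∃ f ∈ F, r = |∫ x, f x ∂μ - ∫ x, f x ∂ν|}

/-- Empirical measure of a sample: mass `1/n` on each of the `n` points. -/
def empMeasure {k n : ℕ} (x : Fin n → Euc k) : Measure (Euc k) :=
  (n : ℝ≥0∞)⁻¹ • ∑ i, Measure.dirac (x i)

/-- Law `μ^n × ν^m` of two independent i.i.d. samples. -/
def sampleLaw {k : ℕ} (μ ν : Measure (Euc k)) (n m : ℕ) :
    Measure ((Fin n → Euc k) × (Fin m → Euc k)) :=
  (Measure.pi fun _ : Fin n => μ).prod (Measure.pi fun _ : Fin m => ν)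

end

/-! ### Rademacher sums and the contraction principle -/

/-! Reduction to hulls. Rescale each activation to a contraction fixing 0. Every network is then `K`
times a function built from a unit ball of linear functionals by alternately applying these
contractions and taking absolutely convex combinations (`hullClass`), where `K` is the product of
the norm bounds and Lipschitz constants. For row norms this is normalisation
(`exists_mem_hullClass_l1Ball`). For Frobenius norms, homogeneity carries the norm of each row
through the activation, and Cauchy–Schwarz turns two ℓ² vectors of weights into ℓ¹ coefficients
(`exists_mem_hullClass_l2Ball`). The two network distances then differ by at most `K * twoDev`.

Concentration. `twoDev` is Lipschitz with constant `1/n` or `1/m` in each sample point, but the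
points are unbounded, so bounded differences are not available. Instead each point is compared with
an independent copy: the exponential moment of a Lipschitz function is controlled by that of the
squared distance between the copies, which Gaussian integration computes
(`SubG.lintegral_exp_lip_le`). The one-point bounds multiply, and Markov's inequality yields the
`log (1/δ)` term (`sampleLaw_twoDev_le`).

Expectation. The contraction principle for exponential moments peels off a layer at the cost of a
factor 2, so after taking logarithms the depth enters only as a multiple of `log 2`. For the
Euclidean ball, symmetrization, peeling and Gaussian integration give the bound
(`SubG.meanDev_hullClass_l2Ball_le`).

The ℓ¹ bound has smaller constants and uses monotonicity: `φ = (id + ψ) / 2` where `ψ = 2 φ - id` is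
again a contraction. By Cauchy–Schwarz a layer then costs only √2. The same identity bounds the mean
deviation of a hull by half that of the preceding hull plus half that of its image under `ψ`.
Following the first half down the layers ends at linear functionals, whose centred deviation needs
no symmetrization. The second half is symmetrized with `2n + 2` signs, whose near balance avoids the
usual factor 2 (`LipClass.meanDev_le_meanRad`). What remains is a choice of two parameters
(`exists_hull_params`), possible once `n` is large compared with the depth; for smaller `n` a bound
that ignores averaging is enough. -/

theorem exp_sub_exp_le {x y x' y' : ℝ} (h₁ : y ≤ y') (h₂ : x - y ≤ x' - y') (h₃ : y ≤ x) :
    Real.exp x - Real.exp y ≤ Real.exp x' - Real.exp y' := by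
  have e₁ : Real.exp x - Real.exp y = Real.exp y * (Real.exp (x - y) - 1) := by
    rw [mul_sub, ← Real.exp_add]; ring_nf
  have e₂ : Real.exp x' - Real.exp y' = Real.exp y' * (Real.exp (x' - y') - 1) := by
    rw [mul_sub, ← Real.exp_add]; ring_nf
  rw [e₁, e₂]
  have h₄ : Real.exp y ≤ Real.exp y' := Real.exp_le_exp.2 h₁
  have h₅ : Real.exp (x - y) ≤ Real.exp (x' - y') := Real.exp_le_exp.2 h₂
  have h₆ : 1 ≤ Real.exp (x - y) := Real.one_le_exp (by linarith)
  exact mul_le_mul h₄ (by linarith) (by linarith) (Real.exp_pos _).le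

theorem exp_add_exp_neg_le {a p b : ℝ} (h : |p| ≤ |b|) :
    Real.exp (a + p) + Real.exp (a - p) ≤ Real.exp (a + b) + Real.exp (a - b) := by
  have h₁ := Real.cosh_le_cosh.2 h
  rw [Real.cosh_eq, Real.cosh_eq] at h₁
  simp only [sub_eq_add_neg, Real.exp_add]
  nlinarith [Real.exp_pos a]

/-- The two point comparison behind the contraction principle for exponentials. -/
theorem exp_add_exp_le_of_contraction {a a' b b' p p' R : ℝ} (hp : |p| ≤ |b|) (hp' : |p'| ≤ |b'|)
    (hpp : |p - p'| ≤ |b - b'|)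
    (h₁ : Real.exp (a + b) + Real.exp (a' - b') ≤ R)
    (h₂ : Real.exp (a' + b') + Real.exp (a - b) ≤ R)
    (h₃ : Real.exp (a + b) + Real.exp (a - b) ≤ R)
    (h₄ : Real.exp (a' + b') + Real.exp (a' - b') ≤ R) :
    Real.exp (a + p) + Real.exp (a' - p') ≤ R := by
  -- In this case both terms can be moved to the primed index, where `h₄` finishes; `c₂` is the
  -- mirror case with `h₃`. What is left satisfies `a' + p' ≤ a + p` and `a - p ≤ a' - p'`, the
  -- ordering that `exp_sub_exp_le` needs when `b` and `b'` have the same sign.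
  by_cases c₁ : a + p < a' + p'
  · have := exp_add_exp_neg_le (a := a') hp'
    have := Real.exp_le_exp.2 c₁.le
    linarith
  by_cases c₂ : a' - p' < a - p
  · have := exp_add_exp_neg_le (a := a) hp
    have := Real.exp_le_exp.2 c₂.le
    linarith
  push Not at c₁ c₂
  have k₁ := abs_le.1 hpp
  rcases le_total 0 b with hb | hb <;> rcases le_total 0 b' with hb' | hb'
  · rw [abs_of_nonneg hb] at hp
    rw [abs_of_nonneg hb'] at hp'
    have k₂ := abs_le.1 hp
    have k₃ := abs_le.1 hp'
    rcases le_total b' b with hbb | hbb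
    · rw [abs_of_nonneg (by linarith : 0 ≤ b - b')] at k₁
      have := exp_sub_exp_le (x := a' - p') (y := a' - b') (x' := a + b) (y' := a + p)
        (by linarith) (by linarith) (by linarith)
      linarith
    · rw [abs_of_nonpos (by linarith : b - b' ≤ 0)] at k₁
      have := exp_sub_exp_le (x := a + p) (y := a - b) (x' := a' + b') (y' := a' - p')
        (by linarith) (by linarith) (by linarith)
      linarith
  · rw [abs_of_nonneg hb] at hp
    rw [abs_of_nonpos hb'] at hp'
    have := Real.exp_le_exp.2 (by linarith [(abs_le.1 hp).2] : a + p ≤ a + b)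
    have := Real.exp_le_exp.2 (by linarith [(abs_le.1 hp').1] : a' - p' ≤ a' - b')
    linarith
  · rw [abs_of_nonpos hb] at hp
    rw [abs_of_nonneg hb'] at hp'
    have := Real.exp_le_exp.2 (by linarith [(abs_le.1 hp).2] : a + p ≤ a - b)
    have := Real.exp_le_exp.2 (by linarith [(abs_le.1 hp').1] : a' - p' ≤ a' + b')
    linarith
  · rw [abs_of_nonpos hb] at hp
    rw [abs_of_nonpos hb'] at hp'
    have k₂ := abs_le.1 hp
    have k₃ := abs_le.1 hp'
    rcases le_total b' b with hbb | hbb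
    · rw [abs_of_nonneg (by linarith : 0 ≤ b - b')] at k₁
      have := exp_sub_exp_le (x := a + p) (y := a + b) (x' := a' - b') (y' := a' - p')
        (by linarith) (by linarith) (by linarith)
      linarith
    · rw [abs_of_nonpos (by linarith : b - b' ≤ 0)] at k₁
      have := exp_sub_exp_le (x := a' - p') (y := a' + b') (x' := a - b) (y' := a + p)
        (by linarith) (by linarith) (by linarith)
      linarith

/-- The hypothesis ranges over independent indices, so one supremum can be taken while the other
index is held fixed. -/
theorem exp_iSup_add_exp_iSup_le {T : Type*} [Nonempty T] {f g : T → ℝ} {R : ℝ}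
    (h : ∀ t s, Real.exp (f t) + Real.exp (g s) ≤ R) :
    Real.exp (⨆ t, f t) + Real.exp (⨆ t, g t) ≤ R := by
  have key : ∀ (u : T → ℝ) (r : ℝ), (∀ t, Real.exp (u t) ≤ r) → Real.exp (⨆ t, u t) ≤ r := by
    intro u r hu
    obtain ⟨t₀⟩ := ‹Nonempty T›
    have hr : 0 < r := (Real.exp_pos _).trans_le (hu t₀)
    have : Nonempty T := ⟨t₀⟩
    rw [← Real.le_log_iff_exp_le hr]
    exact ciSup_le fun t => (Real.le_log_iff_exp_le hr).2 (hu t)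
  have h₁ : ∀ s, Real.exp (⨆ t, f t) ≤ R - Real.exp (g s) := fun s =>
    key f _ fun t => by linarith [h t s]
  have h₂ := key g (R - Real.exp (⨆ t, f t)) fun s => by linarith [h₁ s]
  linarith

/-- `∑ i, ε i * v i` for a vector `ε` of signs. -/
def signSum {ι : Type*} [Fintype ι] (ε : ι → ℤˣ) (v : ι → ℝ) : ℝ :=
  ∑ i, ((ε i : ℤ) : ℝ) * v i

theorem abs_sign (e : ℤˣ) : |((e : ℤ) : ℝ)| = 1 := by
  rcases Int.units_eq_one_or e with h | h <;> simp [h]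

theorem abs_signSum_le {ι : Type*} [Fintype ι] (ε : ι → ℤˣ) (v : ι → ℝ) :
    |signSum ε v| ≤ ∑ i, |v i| := by
  refine (Finset.abs_sum_le_sum_abs _ _).trans (le_of_eq ?_)
  simp [abs_mul, abs_sign]

theorem sum_units {M : Type*} [AddCommMonoid M] (f : ℤˣ → M) : ∑ e, f e = f 1 + f (-1) := by
  rw [show (Finset.univ : Finset ℤˣ) = {1, -1} from rfl]
  exact Finset.sum_pair (by decide)

theorem sum_signs_succ {M : Type*} [AddCommMonoid M] {n : ℕ} (F : (Fin (n + 1) → ℤˣ) → M) :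
    ∑ ε, F ε = ∑ ε : Fin n → ℤˣ, (F (Fin.cons 1 ε) + F (Fin.cons (-1) ε)) := by
  rw [← (Fin.consEquiv fun _ => ℤˣ).sum_comp, Fintype.sum_prod_type, sum_units,
    ← Finset.sum_add_distrib]
  rfl

theorem signSum_cons {n : ℕ} (e : ℤˣ) (ε : Fin n → ℤˣ) (v : Fin (n + 1) → ℝ) :
    signSum (Fin.cons e ε) v = ((e : ℤ) : ℝ) * v 0 + signSum ε (fun i => v i.succ) := by
  simp [signSum, Fin.sum_univ_succ]

theorem iSup_contraction_one {T : Type*} [Nonempty T] (a b p : T → ℝ)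
    (ha : ∃ C, ∀ t, |a t| ≤ C) (hb : ∃ C, ∀ t, |b t| ≤ C)
    (hp : ∀ t, |p t| ≤ |b t|) (hpp : ∀ t s, |p t - p s| ≤ |b t - b s|) :
    Real.exp (⨆ t, (a t + p t)) + Real.exp (⨆ t, (a t - p t)) ≤
      Real.exp (⨆ t, (a t + b t)) + Real.exp (⨆ t, (a t - b t)) := by
  obtain ⟨A, hA⟩ := ha
  obtain ⟨B, hB⟩ := hb
  have b₁ : BddAbove (Set.range fun t => a t + b t) := ⟨A + B, by
    rintro _ ⟨t, rfl⟩; linarith [(abs_le.1 (hA t)).2, (abs_le.1 (hB t)).2]⟩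
  have b₂ : BddAbove (Set.range fun t => a t - b t) := ⟨A + B, by
    rintro _ ⟨t, rfl⟩; linarith [(abs_le.1 (hA t)).2, (abs_le.1 (hB t)).1]⟩
  have u₁ : ∀ t, Real.exp (a t + b t) ≤ Real.exp (⨆ t, (a t + b t)) := fun t =>
    Real.exp_le_exp.2 (le_ciSup b₁ t)
  have u₂ : ∀ t, Real.exp (a t - b t) ≤ Real.exp (⨆ t, (a t - b t)) := fun t =>
    Real.exp_le_exp.2 (le_ciSup b₂ t)
  refine exp_iSup_add_exp_iSup_le fun t s =>
    exp_add_exp_le_of_contraction (hp t) (hp s) (hpp t s) ?_ ?_ ?_ ?_ <;>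
  linarith [u₁ t, u₁ s, u₂ t, u₂ s]

/-- The contraction principle for exponential moments of suprema of Rademacher sums. -/
theorem sum_exp_iSup_contraction {T : Type*} [Nonempty T] {n : ℕ} (a : T → ℝ) (b p : Fin n → T → ℝ)
    (ha : ∃ C, ∀ t, |a t| ≤ C) (hb : ∀ i, ∃ C, ∀ t, |b i t| ≤ C)
    (hp : ∀ i t, |p i t| ≤ |b i t|) (hpp : ∀ i t s, |p i t - p i s| ≤ |b i t - b i s|) :
    ∑ ε : Fin n → ℤˣ, Real.exp (⨆ t, (a t + signSum ε fun i => p i t)) ≤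
      ∑ ε : Fin n → ℤˣ, Real.exp (⨆ t, (a t + signSum ε fun i => b i t)) := by
  induction n generalizing a with
  | zero => simp [signSum]
  | succ n ih =>
    rw [sum_signs_succ, sum_signs_succ, Finset.sum_add_distrib]
    simp only [signSum_cons, Units.val_one, Int.cast_one, one_mul, Units.val_neg, Int.cast_neg,
      neg_mul, ← add_assoc, ← sub_eq_add_neg]
    obtain ⟨A, hA⟩ := ha
    obtain ⟨B, hB⟩ := hb 0
    have hP : ∀ t, |p 0 t| ≤ B := fun t => (hp 0 t).trans (hB t)
    -- The term of the first sign is absorbed into the shift `a`, once with each sign; the induction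
    -- generalises `a` for this purpose.
    have h₁ := ih (fun t => a t + p 0 t) (fun i => b i.succ) (fun i => p i.succ)
      ⟨A + B, fun t => (abs_add_le _ _).trans (add_le_add (hA t) (hP t))⟩ (fun i => hb _)
      (fun i => hp _) (fun i => hpp _)
    have h₂ := ih (fun t => a t - p 0 t) (fun i => b i.succ) (fun i => p i.succ)
      ⟨A + B, fun t => (abs_sub _ _).trans (add_le_add (hA t) (hP t))⟩ (fun i => hb _)
      (fun i => hp _) (fun i => hpp _)
    refine (add_le_add h₁ h₂).trans ?_
    rw [← Finset.sum_add_distrib]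
    refine Finset.sum_le_sum fun ε _ => ?_
    choose D hD using hb
    have := iSup_contraction_one (fun t => a t + signSum ε fun i => b i.succ t) (b 0) (p 0)
      ⟨A + ∑ i : Fin n, D i.succ, fun t => (abs_add_le _ _).trans (add_le_add (hA t)
        ((abs_signSum_le _ _).trans (Finset.sum_le_sum fun i _ => hD _ _)))⟩ ⟨B, hB⟩ (hp 0) (hpp 0)
    refine le_of_eq_of_le ?_ (this.trans (le_of_eq ?_)) <;>
    · congr 2
      all_goals
        congr 1
        ext t
        ring

/-! ### Layered convex hulls and peeling -/

/-- `φ` is `1`-Lipschitz and vanishes at `0`. -/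
structure IsContr (φ : ℝ → ℝ) : Prop where
  lip : ∀ x y, |φ x - φ y| ≤ |x - y|
  zero : φ 0 = 0

theorem IsContr.abs_le {φ : ℝ → ℝ} (h : IsContr φ) (x : ℝ) : |φ x| ≤ |x| := by
  simpa [h.zero] using h.lip x 0

theorem isContr_id : IsContr id := ⟨fun _ _ => le_rfl, rfl⟩

/-- A monotone contraction has slopes in `[0, 1]`, so this map has slopes in `[-1, 1]`. Thus `φ` is
the average of the identity and a contraction. -/
theorem IsContr.two_mul_sub {φ : ℝ → ℝ} (h : IsContr φ) (hm : Monotone φ) :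
    IsContr fun x => 2 * φ x - x := by
  refine ⟨fun x y => ?_, by simp [h.zero]⟩
  have h₁ := _root_.abs_le.1 (h.lip x y)
  rcases le_total x y with hxy | hxy
  · have := hm hxy
    rw [abs_of_nonpos (by linarith : x - y ≤ 0)] at h₁ ⊢
    exact _root_.abs_le.2 ⟨by linarith, by linarith⟩
  · have := hm hxy
    rw [abs_of_nonneg (by linarith : 0 ≤ x - y)] at h₁ ⊢
    exact _root_.abs_le.2 ⟨by linarith, by linarith⟩

/-- Starting from `B`, alternately apply the maps `τ 1, τ 2, …` and form absolutely convex
combinations. -/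
def hullClass {E : Type*} (B : Set (E → ℝ)) (τ : ℕ → ℝ → ℝ) : ℕ → Set (E → ℝ)
  | 0 => B
  | t + 1 => {f | ∃ (p : ℕ) (c : Fin p → ℝ) (g : Fin p → E → ℝ), ∑ j, |c j| ≤ 1 ∧
      (∀ j, g j ∈ hullClass B τ t) ∧ f = fun x => ∑ j, c j * τ (t + 1) (g j x)}

theorem abs_sum_mul_le {p : ℕ} {c a : Fin p → ℝ} {C : ℝ} (hc : ∑ j, |c j| ≤ 1)
    (ha : ∀ j, |a j| ≤ C) (hC : 0 ≤ C) : |∑ j, c j * a j| ≤ C := by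
  calc |∑ j, c j * a j| ≤ ∑ j, |c j| * |a j| :=
        (Finset.abs_sum_le_sum_abs _ _).trans (le_of_eq (by simp [abs_mul]))
    _ ≤ ∑ j, |c j| * C :=
        Finset.sum_le_sum fun j _ => mul_le_mul_of_nonneg_left (ha j) (abs_nonneg _)
    _ ≤ C := by rw [← Finset.sum_mul]; exact mul_le_of_le_one_left hC hc

section hullClass

variable {E : Type*} {B : Set (E → ℝ)} {τ : ℕ → ℝ → ℝ}

theorem hullClass_abs_le (hτ : ∀ t, IsContr (τ t)) {x : E} {C : ℝ} (hC : 0 ≤ C)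
    (hB : ∀ f ∈ B, |f x| ≤ C) (t : ℕ) : ∀ f ∈ hullClass B τ t, |f x| ≤ C := by
  induction t with
  | zero => exact hB
  | succ t ih =>
    rintro _ ⟨p, c, g, hc, hg, rfl⟩
    exact abs_sum_mul_le hc (fun j => ((hτ _).abs_le _).trans (ih _ (hg j))) hC

theorem hullClass_abs_sub_le (hτ : ∀ t, IsContr (τ t)) {x y : E} {C : ℝ} (hC : 0 ≤ C)
    (hB : ∀ f ∈ B, |f x - f y| ≤ C) (t : ℕ) : ∀ f ∈ hullClass B τ t, |f x - f y| ≤ C := by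
  induction t with
  | zero => exact hB
  | succ t ih =>
    rintro _ ⟨p, c, g, hc, hg, rfl⟩
    rw [← Finset.sum_sub_distrib]
    simp_rw [← mul_sub]
    exact abs_sum_mul_le hc (fun j => ((hτ _).lip _ _).trans (ih _ (hg j))) hC

theorem hullClass_nonempty (hB : B.Nonempty) (t : ℕ) : (hullClass B τ t).Nonempty := by
  cases t with
  | zero => exact hB
  | succ t => exact ⟨_, 0, 0, fun _ => 0, by simp, fun j => j.elim0, rfl⟩

end hullClass

/-- `sup_{f ∈ T} |∑ i, ε i * φ (f (z i))|`. -/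
noncomputable def radSup {E : Type*} {ι : Type*} [Fintype ι] (T : Set (E → ℝ)) (φ : ℝ → ℝ)
    (z : ι → E) (ε : ι → ℤˣ) : ℝ :=
  ⨆ f : T, |signSum ε fun i => φ (f.1 (z i))|

/-- Pointwise bounded classes of functions. -/
def PtBdd {E : Type*} (T : Set (E → ℝ)) : Prop := ∀ x, ∃ C, ∀ f ∈ T, |f x| ≤ C

section radSup

variable {E : Type*} {ι : Type*} [Fintype ι] {T : Set (E → ℝ)} {φ : ℝ → ℝ}

theorem radSup_bddAbove (hT : PtBdd T) (hφ : IsContr φ) (z : ι → E) (ε : ι → ℤˣ) :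
    BddAbove (Set.range fun f : T => |signSum ε fun i => φ (f.1 (z i))|) := by
  choose C hC using hT
  refine ⟨∑ i, C (z i), ?_⟩
  rintro _ ⟨f, rfl⟩
  exact (abs_signSum_le _ _).trans
    (Finset.sum_le_sum fun i _ => (hφ.abs_le _).trans (hC _ _ f.2))

theorem le_radSup (hT : PtBdd T) (hφ : IsContr φ) (z : ι → E) (ε : ι → ℤˣ) {f : E → ℝ}
    (hf : f ∈ T) : |signSum ε fun i => φ (f (z i))| ≤ radSup T φ z ε :=
  le_ciSup (radSup_bddAbove hT hφ z ε) ⟨f, hf⟩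

theorem radSup_nonneg (z : ι → E) (ε : ι → ℤˣ) : 0 ≤ radSup T φ z ε :=
  Real.iSup_nonneg fun _ => abs_nonneg _

theorem radSup_le {z : ι → E} {ε : ι → ℤˣ} {C : ℝ} (hC : 0 ≤ C)
    (h : ∀ f ∈ T, |signSum ε fun i => φ (f (z i))| ≤ C) : radSup T φ z ε ≤ C :=
  Real.iSup_le (fun f => h _ f.2) hC

/-- Signed sums are linear in the function, and an absolutely convex combination cannot exceed the
largest absolute value among its terms: the outer weights of a layer cost nothing. -/
theorem radSup_hullClass_succ_le {B : Set (E → ℝ)} {τ : ℕ → ℝ → ℝ} {t : ℕ}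
    (hT : PtBdd (hullClass B τ t)) (hτ : IsContr (τ (t + 1))) (z : ι → E) (ε : ι → ℤˣ) :
    radSup (hullClass B τ (t + 1)) id z ε ≤ radSup (hullClass B τ t) (τ (t + 1)) z ε := by
  refine radSup_le (radSup_nonneg _ _) ?_
  rintro _ ⟨p, c, g, hc, hg, rfl⟩
  have : (signSum ε fun i => id (∑ j, c j * τ (t + 1) (g j (z i)))) =
      ∑ j, c j * signSum ε fun i => τ (t + 1) (g j (z i)) := by
    simp only [signSum, id, Finset.mul_sum]
    rw [Finset.sum_comm]
    exact Finset.sum_congr rfl fun j _ => Finset.sum_congr rfl fun i _ => by ring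
  rw [this]
  exact abs_sum_mul_le hc (fun j => le_radSup hT hτ z ε (hg j)) (radSup_nonneg _ _)

theorem radSup_le_half_add_half (hT : PtBdd T) (hφ : IsContr φ) (hm : Monotone φ)
    (z : ι → E) (ε : ι → ℤˣ) :
    radSup T φ z ε ≤ radSup T id z ε / 2 + radSup T (fun x => 2 * φ x - x) z ε / 2 := by
  have k₁ : 0 ≤ radSup T id z ε := radSup_nonneg z ε
  have k₂ : 0 ≤ radSup T (fun x => 2 * φ x - x) z ε := radSup_nonneg z ε
  refine radSup_le (by linarith) fun f hf => ?_
  have h₁ := le_radSup hT isContr_id z ε hf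
  have h₂ := le_radSup hT (hφ.two_mul_sub hm) z ε hf
  have : (signSum ε fun i => φ (f (z i))) = (signSum ε fun i => id (f (z i))) / 2 +
      (signSum ε fun i => 2 * φ (f (z i)) - f (z i)) / 2 := by
    simp only [signSum, id, Finset.sum_div, ← Finset.sum_add_distrib]
    exact Finset.sum_congr rfl fun i _ => by ring
  rw [this]
  refine (abs_add_le _ _).trans ?_
  rw [abs_div, abs_div, abs_two]
  linarith

end radSup

/-! ### Peeling off one layer in exponential moment. -/

section peeling

variable {E : Type*} {n : ℕ} {T : Set (E → ℝ)} {φ : ℝ → ℝ}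

/-- An absolute value is the larger of the one-sided sums at `ε` and `-ε`. Replacing the maximum by
the sum, and using that `ε ↦ -ε` permutes the sign patterns, produces the 2; the one-sided
contraction principle then removes `φ`. -/
theorem sum_exp_radSup_le_two_mul (hT : PtBdd T) (hne : T.Nonempty) (hφ : IsContr φ)
    (z : Fin n → E) {l : ℝ} (hl : 0 ≤ l) :
    ∑ ε, Real.exp (l * radSup T φ z ε) ≤ 2 * ∑ ε, Real.exp (l * radSup T id z ε) := by
  have : Nonempty T := hne.to_subtype
  have hbd : ∀ (ψ : ℝ → ℝ), IsContr ψ → ∀ ε : Fin n → ℤˣ,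
      BddAbove (Set.range fun f : T => 0 + signSum ε fun i => l * ψ (f.1 (z i))) := by
    intro ψ hψ ε
    refine ⟨l * radSup T ψ z ε, ?_⟩
    rintro _ ⟨f, rfl⟩
    have : (signSum ε fun i => l * ψ (f.1 (z i))) = l * signSum ε fun i => ψ (f.1 (z i)) := by
      simp only [signSum, Finset.mul_sum]
      exact Finset.sum_congr rfl fun i _ => by ring
    simp only [this, zero_add]
    exact mul_le_mul_of_nonneg_left ((le_abs_self _).trans (le_radSup hT hψ z ε f.2)) hl
  have hneg : ∀ (ε : Fin n → ℤˣ) (v : Fin n → ℝ), signSum (-ε) v = -signSum ε v := by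
    intro ε v
    simp [signSum]
  let G : (ℝ → ℝ) → (Fin n → ℤˣ) → ℝ := fun ψ ε =>
    Real.exp (⨆ f : T, (0 + signSum ε fun i => l * ψ (f.1 (z i))))
  have h₁ : ∀ ε, Real.exp (l * radSup T φ z ε) ≤ G φ ε + G φ (-ε) := by
    intro ε
    have : l * radSup T φ z ε ≤ max (⨆ f : T, (0 + signSum ε fun i => l * φ (f.1 (z i))))
        (⨆ f : T, (0 + signSum (-ε) fun i => l * φ (f.1 (z i)))) := by
      rw [radSup, Real.mul_iSup_of_nonneg hl]
      refine ciSup_le fun f => ?_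
      have e₁ : l * |signSum ε fun i => φ (f.1 (z i))| =
          |signSum ε fun i => l * φ (f.1 (z i))| := by
        rw [← abs_of_nonneg hl, ← abs_mul, abs_of_nonneg hl]
        simp only [signSum, Finset.mul_sum]
        exact congrArg _ (Finset.sum_congr rfl fun i _ => by ring)
      rw [e₁, abs_eq_max_neg, ← hneg]
      refine max_le_max ?_ ?_
      · exact (zero_add _).symm.le.trans (le_ciSup (hbd φ hφ ε) f)
      · exact (zero_add _).symm.le.trans (le_ciSup (hbd φ hφ (-ε)) f)
    rcases le_max_iff.1 this with h | h
    · exact (Real.exp_le_exp.2 h).trans (le_add_of_nonneg_right (Real.exp_pos _).le)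
    · exact (Real.exp_le_exp.2 h).trans (le_add_of_nonneg_left (Real.exp_pos _).le)
  have h₂ : ∑ ε, G φ (-ε) = ∑ ε, G φ ε := Equiv.sum_comp (Equiv.neg (Fin n → ℤˣ)) (G φ)
  have h₃ : ∑ ε, G φ ε ≤ ∑ ε, G id ε := by
    have k₁ : ∀ i : Fin n, ∃ C, ∀ f : T, |l * id (f.1 (z i))| ≤ C := fun i => by
      obtain ⟨C, hC⟩ := hT (z i)
      exact ⟨l * C, fun f => by
        rw [abs_mul, abs_of_nonneg hl]; exact mul_le_mul_of_nonneg_left (hC _ f.2) hl⟩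
    have k₂ : ∀ (i : Fin n) (f : T), |l * φ (f.1 (z i))| ≤ |l * id (f.1 (z i))| := fun i f => by
      rw [abs_mul, abs_mul]
      exact mul_le_mul_of_nonneg_left (hφ.abs_le _) (abs_nonneg _)
    have k₃ : ∀ (i : Fin n) (f g : T), |l * φ (f.1 (z i)) - l * φ (g.1 (z i))| ≤
        |l * id (f.1 (z i)) - l * id (g.1 (z i))| := fun i f g => by
      rw [← mul_sub, ← mul_sub, abs_mul, abs_mul]
      exact mul_le_mul_of_nonneg_left (hφ.lip _ _) (abs_nonneg _)
    have k₀ : ∃ C, ∀ _ : T, |(0 : ℝ)| ≤ C := ⟨0, fun _ => by simp⟩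
    exact sum_exp_iSup_contraction (fun _ : T => (0 : ℝ)) (fun i f => l * id (f.1 (z i)))
      (fun i f => l * φ (f.1 (z i))) k₀ k₁ k₂ k₃
  have h₄ : ∀ ε, G id ε ≤ Real.exp (l * radSup T id z ε) := by
    intro ε
    refine Real.exp_le_exp.2 (ciSup_le fun f => ?_)
    have : (signSum ε fun i => l * id (f.1 (z i))) = l * signSum ε fun i => id (f.1 (z i)) := by
      simp only [signSum, Finset.mul_sum]
      exact Finset.sum_congr rfl fun i _ => by ring
    rw [this, zero_add]
    exact mul_le_mul_of_nonneg_left ((le_abs_self _).trans (le_radSup hT isContr_id z ε f.2)) hl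
  calc ∑ ε, Real.exp (l * radSup T φ z ε) ≤ ∑ ε, (G φ ε + G φ (-ε)) :=
        Finset.sum_le_sum fun ε _ => h₁ ε
    _ = 2 * ∑ ε, G φ ε := by rw [Finset.sum_add_distrib, h₂, two_mul]
    _ ≤ 2 * ∑ ε, Real.exp (l * radSup T id z ε) := by
        linarith [Finset.sum_le_sum fun ε (_ : ε ∈ Finset.univ) => h₄ ε]

/-- Splitting `φ` as `(id + ψ) / 2` in the exponent and applying Cauchy–Schwarz over the sign
patterns leaves two square roots. Only the one with `ψ` needs the contraction principle, so the
factor 2 enters under a root. -/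
theorem sum_exp_radSup_le_sqrt_two_mul (hT : PtBdd T) (hne : T.Nonempty) (hφ : IsContr φ)
    (hm : Monotone φ) (z : Fin n → E) {l : ℝ} (hl : 0 ≤ l) :
    ∑ ε, Real.exp (l * radSup T φ z ε) ≤ Real.sqrt 2 * ∑ ε, Real.exp (l * radSup T id z ε) := by
  set ψ : ℝ → ℝ := fun x => 2 * φ x - x with hψ
  set W := ∑ ε, Real.exp (l * radSup T id z ε) with hW
  have hW0 : 0 ≤ W := Finset.sum_nonneg fun _ _ => (Real.exp_pos _).le
  have h₁ : ∀ ε, Real.exp (l * radSup T φ z ε) ≤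
      Real.sqrt (Real.exp (l * radSup T id z ε)) * Real.sqrt (Real.exp (l * radSup T ψ z ε)) := by
    intro ε
    rw [← Real.exp_half, ← Real.exp_half, ← Real.exp_add]
    refine Real.exp_le_exp.2 ?_
    have := mul_le_mul_of_nonneg_left (radSup_le_half_add_half hT hφ hm z ε) hl
    linarith
  have h₂ := Real.sum_sqrt_mul_sqrt_le (Finset.univ : Finset (Fin n → ℤˣ))
    (f := fun ε => Real.exp (l * radSup T id z ε)) (g := fun ε => Real.exp (l * radSup T ψ z ε))
    (fun _ => (Real.exp_pos _).le) (fun _ => (Real.exp_pos _).le)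
  have h₃ := sum_exp_radSup_le_two_mul hT hne (hφ.two_mul_sub hm) z hl
  calc ∑ ε, Real.exp (l * radSup T φ z ε) ≤ Real.sqrt W *
        Real.sqrt (∑ ε, Real.exp (l * radSup T ψ z ε)) :=
        (Finset.sum_le_sum fun ε _ => h₁ ε).trans h₂
    _ ≤ Real.sqrt W * Real.sqrt (2 * W) :=
        mul_le_mul_of_nonneg_left (Real.sqrt_le_sqrt h₃) (Real.sqrt_nonneg _)
    _ = Real.sqrt 2 * W := by
        rw [Real.sqrt_mul zero_le_two, mul_left_comm, Real.mul_self_sqrt hW0]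

variable {B : Set (E → ℝ)} {τ : ℕ → ℝ → ℝ}

theorem hullClass_ptBdd (hτ : ∀ t, IsContr (τ t)) (hB : PtBdd B) (t : ℕ) :
    PtBdd (hullClass B τ t) := fun x => by
  obtain ⟨C, hC⟩ := hB x
  exact ⟨|C|, hullClass_abs_le hτ (abs_nonneg _) (fun f hf => (hC f hf).trans (le_abs_self _)) t⟩

theorem sum_exp_radSup_hullClass_le (hτ : ∀ t, IsContr (τ t)) (hB : PtBdd B) (hne : B.Nonempty)
    (z : Fin n → E) {l : ℝ} (hl : 0 ≤ l) (t : ℕ) :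
    ∑ ε, Real.exp (l * radSup (hullClass B τ t) id z ε) ≤
      2 ^ t * ∑ ε, Real.exp (l * radSup B id z ε) := by
  induction t with
  | zero => simp [hullClass]
  | succ t ih =>
    have hT := hullClass_ptBdd hτ hB t
    calc _ ≤ ∑ ε, Real.exp (l * radSup (hullClass B τ t) (τ (t + 1)) z ε) :=
          Finset.sum_le_sum fun ε _ => Real.exp_le_exp.2
            (mul_le_mul_of_nonneg_left (radSup_hullClass_succ_le hT (hτ _) z ε) hl)
      _ ≤ 2 * ∑ ε, Real.exp (l * radSup (hullClass B τ t) id z ε) :=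
          sum_exp_radSup_le_two_mul hT (hullClass_nonempty hne t) (hτ _) z hl
      _ ≤ _ := by rw [pow_succ]; linarith

theorem sum_exp_radSup_hullClass_le_of_monotone (hτ : ∀ t, IsContr (τ t))
    (hm : ∀ t, Monotone (τ t)) (hB : PtBdd B) (hne : B.Nonempty) (z : Fin n → E) {l : ℝ}
    (hl : 0 ≤ l) (t : ℕ) :
    ∑ ε, Real.exp (l * radSup (hullClass B τ t) id z ε) ≤
      Real.sqrt 2 ^ t * ∑ ε, Real.exp (l * radSup B id z ε) := by
  induction t with
  | zero => simp [hullClass]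
  | succ t ih =>
    have hT := hullClass_ptBdd hτ hB t
    calc _ ≤ ∑ ε, Real.exp (l * radSup (hullClass B τ t) (τ (t + 1)) z ε) :=
          Finset.sum_le_sum fun ε _ => Real.exp_le_exp.2
            (mul_le_mul_of_nonneg_left (radSup_hullClass_succ_le hT (hτ _) z ε) hl)
      _ ≤ Real.sqrt 2 * ∑ ε, Real.exp (l * radSup (hullClass B τ t) id z ε) :=
          sum_exp_radSup_le_sqrt_two_mul hT (hullClass_nonempty hne t) (hτ _) (hm _) z hl
      _ ≤ _ := by
          rw [pow_succ, mul_comm (Real.sqrt 2 ^ t), mul_assoc]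
          exact mul_le_mul_of_nonneg_left ih (Real.sqrt_nonneg _)

end peeling

/-! ### Sub-Gaussian vectors and the Gaussian integration trick -/

section gaussian

variable {V : Type*} [NormedAddCommGroup V] [InnerProductSpace ℝ V] [FiniteDimensional ℝ V]
  [MeasurableSpace V] [BorelSpace V]

theorem lintegral_exp_neg_mul_sq_norm {b : ℝ} (hb : 0 < b) :
    ∫⁻ v : V, ENNReal.ofReal (Real.exp (-b * ‖v‖ ^ 2)) =
      ENNReal.ofReal ((Real.pi / b) ^ (Module.finrank ℝ V / 2 : ℝ)) := by
  have h₁ := GaussianFourier.integral_rexp_neg_mul_sq_norm (V := V) hb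
  have h₂ : 0 < (Real.pi / b) ^ (Module.finrank ℝ V / 2 : ℝ) :=
    Real.rpow_pos_of_pos (div_pos Real.pi_pos hb) _
  have h₃ : Integrable fun v : V => Real.exp (-b * ‖v‖ ^ 2) := by
    -- A non-integrable function has Bochner integral 0, whereas the value in `h₁` is positive.
    by_contra h
    rw [integral_undef h] at h₁
    exact h₂.ne h₁
  rw [← ofReal_integral_eq_lintegral_ofReal h₃ (.of_forall fun _ => (Real.exp_pos _).le), h₁]

theorem lintegral_exp_neg_mul_sq_norm_add_inner {b : ℝ} (hb : 0 < b) (w : V) :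
    ∫⁻ v : V, ENNReal.ofReal (Real.exp (-b * ‖v‖ ^ 2 + inner ℝ v w)) =
      ENNReal.ofReal ((Real.pi / b) ^ (Module.finrank ℝ V / 2 : ℝ) *
        Real.exp (‖w‖ ^ 2 / (4 * b))) := by
  have h₁ : ∀ v : V, ENNReal.ofReal (Real.exp (-b * ‖v‖ ^ 2 + inner ℝ v w)) =
      ENNReal.ofReal (Real.exp (-b * ‖v - (1 / (2 * b)) • w‖ ^ 2)) *
        ENNReal.ofReal (Real.exp (‖w‖ ^ 2 / (4 * b))) := by
    intro v
    rw [← ENNReal.ofReal_mul (Real.exp_pos _).le, ← Real.exp_add, norm_sub_sq_real, norm_smul,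
      inner_smul_right, mul_pow, Real.norm_eq_abs, sq_abs]
    congr 2
    field_simp
    ring
  simp_rw [h₁]
  rw [lintegral_mul_const' _ _ ENNReal.ofReal_ne_top,
    lintegral_sub_right_eq_self (fun v : V => ENNReal.ofReal (Real.exp (-b * ‖v‖ ^ 2))),
    lintegral_exp_neg_mul_sq_norm hb, ENNReal.ofReal_mul]
  exact Real.rpow_nonneg (div_pos Real.pi_pos hb).le _

/-- If the moment generating function of `S` is dominated by that of a Gaussian with mean `b` and
variance `v`, then so is its Gaussian exponential moment. -/
theorem lintegral_exp_norm_sq_le {Ω : Type*} [MeasurableSpace Ω] {P : Measure Ω} [SFinite P]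
    {S : Ω → V} (hS : Measurable S) {C : ℝ≥0∞} {b : V} {v θ : ℝ}
    (h : ∀ a : V, ∫⁻ ω, ENNReal.ofReal (Real.exp (inner ℝ a (S ω))) ∂P ≤
      C * ENNReal.ofReal (Real.exp (inner ℝ a b + ‖a‖ ^ 2 * v / 2)))
    (hθ : θ ^ 2 * v < 1) :
    ∫⁻ ω, ENNReal.ofReal (Real.exp (θ ^ 2 * ‖S ω‖ ^ 2 / 2)) ∂P ≤
      C * ENNReal.ofReal ((1 - θ ^ 2 * v)⁻¹ ^ (Module.finrank ℝ V / 2 : ℝ) *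
        Real.exp (θ ^ 2 * ‖b‖ ^ 2 / (2 * (1 - θ ^ 2 * v)))) := by
  set k : ℝ := Module.finrank ℝ V / 2 with hk
  set c := θ ^ 2 * v with hc
  have hπ : 0 < (Real.pi / (1 / 2)) ^ k :=
    Real.rpow_pos_of_pos (div_pos Real.pi_pos (by norm_num)) _
  have h1c : 0 < 1 - c := by linarith
  -- Up to normalisation, `exp (θ² ‖s‖² / 2)` is the average of `exp ⟨θ g, s⟩` over a standard
  -- Gaussian `g`. After exchanging the integrals the hypothesis applies with `a = θ g`, leaving a
  -- Gaussian integral with quadratic coefficient `(1 - c) / 2`.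
  have e₁ : ∀ s : V, ENNReal.ofReal ((Real.pi / (1 / 2)) ^ k) *
      ENNReal.ofReal (Real.exp (θ ^ 2 * ‖s‖ ^ 2 / 2)) =
      ∫⁻ g : V, ENNReal.ofReal (Real.exp (-(1 / 2) * ‖g‖ ^ 2)) *
        ENNReal.ofReal (Real.exp (inner ℝ (θ • g) s)) := by
    intro s
    have := lintegral_exp_neg_mul_sq_norm_add_inner (V := V) (b := 1 / 2) (by norm_num) (θ • s)
    rw [norm_smul, mul_pow, Real.norm_eq_abs, sq_abs,
      ENNReal.ofReal_mul hπ.le] at this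
    rw [show θ ^ 2 * ‖s‖ ^ 2 / 2 = θ ^ 2 * ‖s‖ ^ 2 / (4 * (1 / 2)) by ring, ← this]
    refine lintegral_congr fun g => ?_
    rw [← ENNReal.ofReal_mul (Real.exp_pos _).le, ← Real.exp_add, inner_smul_right,
      real_inner_smul_left]
  have hm : Measurable fun p : Ω × V => ENNReal.ofReal (Real.exp (-(1 / 2) * ‖p.2‖ ^ 2)) *
      ENNReal.ofReal (Real.exp (inner ℝ (θ • p.2) (S p.1))) := by
    fun_prop
  have h₂ : ENNReal.ofReal ((Real.pi / (1 / 2)) ^ k) *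
      ∫⁻ ω, ENNReal.ofReal (Real.exp (θ ^ 2 * ‖S ω‖ ^ 2 / 2)) ∂P ≤
      C * ENNReal.ofReal ((Real.pi / ((1 - c) / 2)) ^ k *
        Real.exp (‖θ • b‖ ^ 2 / (4 * ((1 - c) / 2)))) := by
    rw [← lintegral_const_mul' _ _ ENNReal.ofReal_ne_top]
    simp_rw [e₁]
    rw [lintegral_lintegral_swap hm.aemeasurable]
    rw [← lintegral_exp_neg_mul_sq_norm_add_inner (V := V) (by linarith) (θ • b)]
    rw [← lintegral_const_mul _ (by fun_prop)]
    refine lintegral_mono fun g => ?_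
    dsimp only
    rw [lintegral_const_mul' _ _ ENNReal.ofReal_ne_top]
    calc _ ≤ ENNReal.ofReal (Real.exp (-(1 / 2) * ‖g‖ ^ 2)) *
          (C * ENNReal.ofReal (Real.exp (inner ℝ (θ • g) b + ‖θ • g‖ ^ 2 * v / 2))) := by
          gcongr; exact h _
      _ = _ := by
          rw [mul_left_comm, ← ENNReal.ofReal_mul (Real.exp_pos _).le, ← Real.exp_add]
          congr 3
          rw [norm_smul, mul_pow, Real.norm_eq_abs, sq_abs, inner_smul_right,
            real_inner_smul_left, hc]
          ring
  have h₃ : C * ENNReal.ofReal ((Real.pi / ((1 - c) / 2)) ^ k *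
      Real.exp (‖θ • b‖ ^ 2 / (4 * ((1 - c) / 2)))) = ENNReal.ofReal ((Real.pi / (1 / 2)) ^ k) *
      (C * ENNReal.ofReal ((1 - c)⁻¹ ^ k * Real.exp (θ ^ 2 * ‖b‖ ^ 2 / (2 * (1 - c))))) := by
    rw [mul_left_comm, ← ENNReal.ofReal_mul hπ.le, ← mul_assoc,
      ← Real.mul_rpow (div_pos Real.pi_pos (by norm_num)).le (inv_pos.2 h1c).le, norm_smul,
      mul_pow, Real.norm_eq_abs, sq_abs]
    congr 4
    · field_simp
    · ring
  rw [h₃] at h₂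
  exact (ENNReal.mul_le_mul_iff_right (by simpa using hπ) ENNReal.ofReal_ne_top).1 h₂

end gaussian

/-- The form in which membership in the sub-Gaussian class is used. -/
structure SubG {k : ℕ} (Γ : ℝ) (u : Euc k) (μ : Measure (Euc k)) : Prop where
  prob : IsProbabilityMeasure μ
  pos : 0 < Γ
  integrable : Integrable (fun x : Euc k => x) μ
  mean : ∫ x, x ∂μ = u
  mean_le : ‖u‖ ≤ Γ
  mgf : ∀ a : Euc k, ∫⁻ x, ENNReal.ofReal (Real.exp (inner ℝ a x)) ∂μ ≤
    ENNReal.ofReal (Real.exp (inner ℝ a u + ‖a‖ ^ 2 * Γ ^ 2 / 2))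

/-- The variance parameter is relaxed to `Γ` and the mean moves to the right-hand side. Stating the
bound with a lower integral keeps integrability conditions out of the later products and exchanges.
-/
theorem IsSubGaussianClass.subG {k : ℕ} {Γ : ℝ} {μ : Measure (Euc k)}
    (h : IsSubGaussianClass Γ μ) : SubG Γ (∫ x, x ∂μ) μ := by
  obtain ⟨τ, h0, hΓ, hτ⟩ := h.subGaussian
  refine ⟨h.prob, h0.trans_le hΓ, h.integrable, rfl, h.mean_le, fun a => ?_⟩
  obtain ⟨h₁, h₂⟩ := hτ a
  have e : ∀ x : Euc k, ENNReal.ofReal (Real.exp (inner ℝ a x)) =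
      ENNReal.ofReal (Real.exp (inner ℝ a (∫ y, y ∂μ))) *
        ENNReal.ofReal (Real.exp (inner ℝ a (x - ∫ y, y ∂μ))) := by
    intro x
    rw [← ENNReal.ofReal_mul (Real.exp_pos _).le, ← Real.exp_add, inner_sub_right]
    congr 2
    ring
  rw [lintegral_congr e, lintegral_const_mul' _ _ ENNReal.ofReal_ne_top,
    ← ofReal_integral_eq_lintegral_ofReal h₁ (.of_forall fun _ => (Real.exp_pos _).le),
    ← ENNReal.ofReal_mul (Real.exp_pos _).le, Real.exp_add]
  refine ENNReal.ofReal_le_ofReal (mul_le_mul_of_nonneg_left (h₂.trans ?_) (Real.exp_pos _).le)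
  refine Real.exp_le_exp.2 ?_
  gcongr

/-! ### Signed sums of independent sub-Gaussian vectors. -/

section SubG

variable {k : ℕ} {Γ : ℝ} {u : Euc k} {μ : Measure (Euc k)}

theorem lintegral_pi_prod {ι E : Type*} [Fintype ι] [MeasurableSpace E] {μ : Measure E}
    [IsProbabilityMeasure μ] {f : ι → E → ℝ≥0∞} (hf : ∀ i, Measurable (f i)) :
    ∫⁻ x, ∏ i, f i (x i) ∂(Measure.pi fun _ : ι => μ) = ∏ i, ∫⁻ x, f i x ∂μ := by
  have h := ProbabilityTheory.iIndepFun_pi (μ := fun _ : ι => μ) (X := f)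
    fun i => (hf i).aemeasurable
  rw [ProbabilityTheory.lintegral_prod_eq_prod_lintegral_of_indepFun Finset.univ _ h
    fun i => (hf i).comp (measurable_pi_apply i)]
  exact Finset.prod_congr rfl fun i _ => (measurePreserving_eval (fun _ : ι => μ) i).lintegral_comp (hf i)

/-- The signs leave the variance term unchanged and multiply the mean term by `∑ i, ε i`. That mean
contribution has to be averaged over the signs later. -/
theorem SubG.mgf_sum (h : SubG Γ u μ) {ι : Type*} [Fintype ι] {ε : ι → ℝ} (hε : ∀ i, |ε i| = 1)
    (a : Euc k) :
    ∫⁻ x, ENNReal.ofReal (Real.exp (inner ℝ a (∑ i, ε i • x i))) ∂(Measure.pi fun _ : ι => μ) ≤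
      ENNReal.ofReal (Real.exp ((∑ i, ε i) * inner ℝ a u +
        Fintype.card ι * (‖a‖ ^ 2 * Γ ^ 2 / 2))) := by
  have := h.prob
  have e : ∀ x : ι → Euc k, ENNReal.ofReal (Real.exp (inner ℝ a (∑ i, ε i • x i))) =
      ∏ i, ENNReal.ofReal (Real.exp (inner ℝ (ε i • a) (x i))) := by
    intro x
    rw [← ENNReal.ofReal_prod_of_nonneg fun _ _ => (Real.exp_pos _).le, ← Real.exp_sum, inner_sum]
    simp_rw [inner_smul_right, real_inner_smul_left]
  simp_rw [e]
  rw [lintegral_pi_prod (f := fun i x => ENNReal.ofReal (Real.exp (inner ℝ (ε i • a) x)))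
    fun i => by fun_prop]
  refine (Finset.prod_le_prod' fun i _ => h.mgf (ε i • a)).trans (le_of_eq ?_)
  rw [← ENNReal.ofReal_prod_of_nonneg fun _ _ => (Real.exp_pos _).le, ← Real.exp_sum]
  simp_rw [norm_smul, real_inner_smul_left, Real.norm_eq_abs, hε, one_mul]
  rw [Finset.sum_add_distrib, ← Finset.sum_mul]
  simp

end SubG

/-! ### Suprema over classes of Lipschitz functions -/

/-- `sup_{f ∈ T} |A f|`. -/
noncomputable def supAbs {α : Type*} (T : Set α) (A : α → ℝ) : ℝ := ⨆ f : T, |A f.1|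

section supAbs

variable {α : Type*} {T : Set α} {A A' : α → ℝ}

theorem le_supAbs (h : ∃ C, ∀ f ∈ T, |A f| ≤ C) {f : α} (hf : f ∈ T) : |A f| ≤ supAbs T A := by
  obtain ⟨C, hC⟩ := h
  exact le_ciSup (f := fun f : T => |A f.1|) ⟨C, by rintro _ ⟨g, rfl⟩; exact hC _ g.2⟩ ⟨f, hf⟩

theorem supAbs_nonneg : 0 ≤ supAbs T A := Real.iSup_nonneg fun _ => abs_nonneg _

theorem supAbs_le {C : ℝ} (hC : 0 ≤ C) (h : ∀ f ∈ T, |A f| ≤ C) : supAbs T A ≤ C :=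
  Real.iSup_le (fun f => h _ f.2) hC

theorem supAbs_le_add {c : ℝ} (hc : 0 ≤ c) (h : ∃ C, ∀ f ∈ T, |A' f| ≤ C)
    (h' : ∀ f ∈ T, |A f - A' f| ≤ c) : supAbs T A ≤ supAbs T A' + c := by
  refine supAbs_le (add_nonneg supAbs_nonneg hc) fun f hf => ?_
  have h₁ := le_supAbs h hf
  have h₂ := h' f hf
  have h₃ := abs_sub_abs_le_abs_sub (A f) (A' f)
  linarith

theorem abs_supAbs_sub_le {c : ℝ} (hc : 0 ≤ c) (h : ∃ C, ∀ f ∈ T, |A f| ≤ C)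
    (h' : ∃ C, ∀ f ∈ T, |A' f| ≤ C) (h'' : ∀ f ∈ T, |A f - A' f| ≤ c) :
    |supAbs T A - supAbs T A'| ≤ c := by
  have h₁ := supAbs_le_add hc h' h''
  have h₂ := supAbs_le_add hc h (A := A') fun f hf => by rw [abs_sub_comm]; exact h'' f hf
  exact abs_le.2 ⟨by linarith, by linarith⟩

end supAbs

/-- `g` is Lipschitz with constant `C` for the `ℓ¹`-combination of the norms of the coordinates. -/
def SumLip {ι E : Type*} [Fintype ι] [NormedAddCommGroup E] (C : ℝ) (g : (ι → E) → ℝ) : Prop :=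
  ∀ z z' : ι → E, |g z - g z'| ≤ C * ∑ i, ‖z i - z' i‖

section SumLip

variable {ι E : Type*} [Fintype ι] [NormedAddCommGroup E] {C : ℝ} {g : (ι → E) → ℝ}

theorem SumLip.continuous (hg : SumLip C g) : Continuous g := by
  refine continuous_iff_continuousAt.2 fun z => tendsto_iff_dist_tendsto_zero.2 ?_
  have h₀ : Filter.Tendsto (fun z' : ι → E => C * ∑ i, ‖z' i - z i‖) (nhds z) (nhds 0) := by
    have : Continuous fun z' : ι → E => C * ∑ i, ‖z' i - z i‖ := by fun_prop
    simpa using this.tendsto z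
  exact squeeze_zero (fun _ => dist_nonneg) (fun z' => hg z' z) h₀

theorem SumLip.integrable [MeasurableSpace E] [BorelSpace E] [SecondCountableTopology E]
    {μ : Measure E} [IsProbabilityMeasure μ] (hμ : Integrable (fun x : E => x) μ)
    (hg : SumLip C g) : Integrable g (Measure.pi fun _ : ι => μ) := by
  have h₁ : Integrable (fun z : ι → E => |g 0| + C * ∑ i, ‖z i‖) (Measure.pi fun _ : ι => μ) := by
    refine (integrable_const _).add (Integrable.const_mul (integrable_finsetSum _ fun i _ => ?_) _)
    exact (measurePreserving_eval (fun _ : ι => μ) i).integrable_comp_of_integrable hμ.norm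
  refine h₁.mono' hg.continuous.measurable.aestronglyMeasurable (.of_forall fun z => ?_)
  have h₂ := hg z 0
  have h₃ := abs_sub_abs_le_abs_sub (g z) (g 0)
  simp only [Pi.zero_apply, sub_zero] at h₂
  rw [Real.norm_eq_abs]
  linarith

end SumLip

/-- An injective selection of coordinates of an i.i.d. sample is an i.i.d. sample. Ghost samples,
leave-one-out samples and permutations are all obtained this way. -/
theorem measurePreserving_comp_of_injective {ι κ E : Type*} [Fintype ι] [Fintype κ]
    [MeasurableSpace E] (μ : Measure E) [IsProbabilityMeasure μ] {p : κ → ι}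
    (hp : Function.Injective p) :
    MeasurePreserving (fun z : ι → E => fun k => z (p k)) (Measure.pi fun _ : ι => μ)
      (Measure.pi fun _ : κ => μ) := by
  refine ⟨by fun_prop, ?_⟩
  have h := (ProbabilityTheory.iIndepFun_pi (μ := fun _ : ι => μ) (X := fun _ x => x)
    fun i => aemeasurable_id).precomp hp
  have h' := (ProbabilityTheory.iIndepFun_iff_map_fun_eq_pi_map
    fun k => (measurable_pi_apply (p k)).aemeasurable).1 h
  rw [h']
  congr 1
  ext1 k
  exact (measurePreserving_eval (fun _ : ι => μ) (p k)).map_eq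

theorem measurePreserving_comp_prod {ι κ κ' E : Type*} [Fintype ι] [Fintype κ] [Fintype κ']
    [MeasurableSpace E] (μ : Measure E) [IsProbabilityMeasure μ] {p : κ → ι} {q : κ' → ι}
    (hpq : Function.Injective (Sum.elim p q)) :
    MeasurePreserving (fun z : ι → E => (fun k => z (p k), fun k => z (q k)))
      (Measure.pi fun _ : ι => μ)
      ((Measure.pi fun _ : κ => μ).prod (Measure.pi fun _ : κ' => μ)) :=
  (measurePreserving_sumPiEquivProdPi (fun _ : κ ⊕ κ' => μ)).comp
    (measurePreserving_comp_of_injective μ hpq)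

/-- Nonempty classes of `1`-Lipschitz functions vanishing at `0`. -/
structure LipClass {E : Type*} [NormedAddCommGroup E] (T : Set (E → ℝ)) : Prop where
  nonempty : T.Nonempty
  lip : ∀ f ∈ T, ∀ x y, |f x - f y| ≤ ‖x - y‖
  zero : ∀ f ∈ T, f 0 = 0

section LipClass

variable {E : Type*} [NormedAddCommGroup E] {T : Set (E → ℝ)}

theorem LipClass.abs_le (hT : LipClass T) {f : E → ℝ} (hf : f ∈ T) (x : E) : |f x| ≤ ‖x‖ := by
  simpa [hT.zero f hf] using hT.lip f hf x 0

theorem LipClass.ptBdd (hT : LipClass T) : PtBdd T := fun x => ⟨‖x‖, fun _ hf => hT.abs_le hf x⟩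

theorem LipClass.continuous (hT : LipClass T) {f : E → ℝ} (hf : f ∈ T) : Continuous f :=
  (LipschitzWith.of_dist_le_mul (K := 1) fun x y => by
    simpa [dist_eq_norm, Real.dist_eq] using hT.lip f hf x y).continuous

theorem LipClass.bdd_sum {ι : Type*} [Fintype ι] (hT : LipClass T) (c : ι → ℝ) (z : ι → E) :
    ∃ C, ∀ f ∈ T, |∑ i, c i * f (z i)| ≤ C :=
  ⟨∑ i, |c i| * ‖z i‖, fun f hf => (Finset.abs_sum_le_sum_abs _ _).trans
    (Finset.sum_le_sum fun i _ => by
      rw [abs_mul]; exact mul_le_mul_of_nonneg_left (hT.abs_le hf _) (abs_nonneg _))⟩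

variable [MeasurableSpace E] [BorelSpace E] {μ : Measure E}

theorem LipClass.integrable (hT : LipClass T) (hμ : Integrable (fun x : E => x) μ) {f : E → ℝ}
    (hf : f ∈ T) : Integrable f μ :=
  hμ.norm.mono' (hT.continuous hf).measurable.aestronglyMeasurable (.of_forall (hT.abs_le hf))

theorem LipClass.abs_integral_le (hT : LipClass T) (hμ : Integrable (fun x : E => x) μ)
    {f : E → ℝ} (hf : f ∈ T) : |∫ x, f x ∂μ| ≤ ∫ x, ‖x‖ ∂μ :=
  (Real.norm_eq_abs _).symm.le.trans
    (norm_integral_le_of_norm_le hμ.norm (.of_forall (hT.abs_le hf)))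

theorem LipClass.bdd_dev {ι : Type*} [Fintype ι] (hT : LipClass T)
    (hμ : Integrable (fun x : E => x) μ) (c : ι → ℝ) (s : ℝ) (z : ι → E) :
    ∃ C, ∀ f ∈ T, |∑ i, c i * f (z i) - s * ∫ x, f x ∂μ| ≤ C := by
  obtain ⟨C, hC⟩ := hT.bdd_sum c z
  refine ⟨C + |s| * ∫ x, ‖x‖ ∂μ, fun f hf => (abs_sub _ _).trans (add_le_add (hC f hf) ?_)⟩
  rw [abs_mul]
  exact mul_le_mul_of_nonneg_left (hT.abs_integral_le hμ hf) (abs_nonneg _)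

theorem LipClass.sumLip_dev {ι : Type*} [Fintype ι] (hT : LipClass T)
    (hμ : Integrable (fun x : E => x) μ) (c : ι → ℝ) (s : ℝ) {C : ℝ} (hC0 : 0 ≤ C)
    (hc : ∀ i, |c i| ≤ C) :
    SumLip C fun z : ι → E => supAbs T fun f => ∑ i, c i * f (z i) - s * ∫ x, f x ∂μ := by
  intro z z'
  refine abs_supAbs_sub_le (by positivity) (hT.bdd_dev hμ c s z) (hT.bdd_dev hμ c s z')
    fun f hf => ?_
  rw [sub_sub_sub_cancel_right, ← Finset.sum_sub_distrib, Finset.mul_sum]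
  refine (Finset.abs_sum_le_sum_abs _ _).trans (Finset.sum_le_sum fun i _ => ?_)
  rw [← mul_sub, abs_mul]
  exact mul_le_mul (hc i) (hT.lip f hf _ _) (abs_nonneg _) hC0

end LipClass

/-! ### Symmetrization -/

section comp

variable {ι κ E : Type*} [Fintype ι] [Fintype κ] [MeasurableSpace E] {μ : Measure E}
  [IsProbabilityMeasure μ] {p : κ → ι} {g : (κ → E) → ℝ}

theorem integrable_pi_comp_of_injective (hp : Function.Injective p)
    (hg : Integrable g (Measure.pi fun _ : κ => μ)) :
    Integrable (fun z : ι → E => g fun k => z (p k)) (Measure.pi fun _ : ι => μ) :=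
  (measurePreserving_comp_of_injective μ hp).integrable_comp_of_integrable hg

theorem integral_pi_comp_of_injective (hp : Function.Injective p)
    (hg : Integrable g (Measure.pi fun _ : κ => μ)) :
    ∫ z : ι → E, g (fun k => z (p k)) ∂(Measure.pi fun _ : ι => μ) =
      ∫ z, g z ∂(Measure.pi fun _ : κ => μ) := by
  have h := measurePreserving_comp_of_injective μ hp
  rw [← h.map_eq, integral_map h.measurable.aemeasurable]
  rw [h.map_eq]
  exact hg.aestronglyMeasurable

end comp

/-- `sup_{f ∈ T} |∑ i, f (x i) - r E_μ f|`. -/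
noncomputable def empDev {E : Type*} [MeasurableSpace E] (T : Set (E → ℝ)) (μ : Measure E) (r : ℕ)
    (x : Fin r → E) : ℝ :=
  supAbs T fun f => ∑ i, f (x i) - r * ∫ y, f y ∂μ

/-- `E sup_{f ∈ T} |∑ i, f (x i) - r E_μ f|` for an i.i.d. sample of size `r`. -/
noncomputable def meanDev {E : Type*} [MeasurableSpace E] (T : Set (E → ℝ)) (μ : Measure E)
    (r : ℕ) : ℝ :=
  ∫ x, empDev T μ r x ∂(Measure.pi fun _ : Fin r => μ)

/-- `sup_{f ∈ T} |∑ i, c i * f (z i)|`. -/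
noncomputable def coefSup {E ι : Type*} [Fintype ι] (T : Set (E → ℝ)) (c : ι → ℝ) (z : ι → E) : ℝ :=
  supAbs T fun f => ∑ i, c i * f (z i)

section symmetrization

variable {E : Type*} [NormedAddCommGroup E] {T : Set (E → ℝ)} [MeasurableSpace E] [BorelSpace E]
  {μ : Measure E}

theorem LipClass.sumLip_empDev (hT : LipClass T) (hμ : Integrable (fun x : E => x) μ) (r : ℕ) :
    SumLip 1 (empDev T μ r) := by
  simpa [empDev] using! hT.sumLip_dev hμ (fun _ : Fin r => (1 : ℝ)) (r : ℝ) zero_le_one (by simp)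

theorem LipClass.sumLip_coefSup {ι : Type*} [Fintype ι] (hT : LipClass T)
    (hμ : Integrable (fun x : E => x) μ) {c : ι → ℝ} (hc : ∀ i, |c i| ≤ 1) :
    SumLip 1 (coefSup T c) := by
  simpa [coefSup] using! hT.sumLip_dev hμ c 0 zero_le_one hc

theorem meanDev_nonneg (r : ℕ) : 0 ≤ meanDev T μ r := integral_nonneg fun _ => supAbs_nonneg

variable [SecondCountableTopology E] [IsProbabilityMeasure μ]

theorem LipClass.integrable_empDev (hT : LipClass T) (hμ : Integrable (fun x : E => x) μ) (r : ℕ) :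
    Integrable (empDev T μ r) (Measure.pi fun _ : Fin r => μ) :=
  (hT.sumLip_empDev hμ r).integrable hμ

theorem LipClass.integrable_coefSup {ι : Type*} [Fintype ι] (hT : LipClass T)
    (hμ : Integrable (fun x : E => x) μ) {c : ι → ℝ} (hc : ∀ i, |c i| ≤ 1) :
    Integrable (coefSup T c) (Measure.pi fun _ : ι => μ) :=
  (hT.sumLip_coefSup hμ hc).integrable hμ

/-- Ghost sample argument: write the expectation under `μ` as an average over an independent copy
and pull that average out of the supremum. The maps `p` and `q` place the two copies at disjoint
positions of a common, possibly larger sample. -/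
theorem LipClass.meanDev_le_integral_sup_sub {ι : Type*} [Fintype ι] (hT : LipClass T)
    (hμ : Integrable (fun x : E => x) μ) {r : ℕ} {p q : Fin r → ι}
    (hpq : Function.Injective (Sum.elim p q)) :
    meanDev T μ r ≤ ∫ z, supAbs T (fun f => ∑ k, (f (z (p k)) - f (z (q k))))
      ∂(Measure.pi fun _ : ι => μ) := by
  set G : (Fin r → E) × (Fin r → E) → ℝ := fun w =>
    supAbs T fun f => ∑ k, (f (w.1 k) - f (w.2 k)) with hG
  have hb : ∀ w : (Fin r → E) × (Fin r → E), ∃ C, ∀ f ∈ T, |∑ k, (f (w.1 k) - f (w.2 k))| ≤ C := by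
    intro w
    refine ⟨∑ k, ‖w.1 k - w.2 k‖, fun f hf => (Finset.abs_sum_le_sum_abs _ _).trans
      (Finset.sum_le_sum fun k _ => hT.lip f hf _ _)⟩
  have hGi : Integrable G ((Measure.pi fun _ : Fin r => μ).prod (Measure.pi fun _ : Fin r => μ)) := by
    have h₁ := measurePreserving_sumPiEquivProdPi (fun _ : Fin r ⊕ Fin r => μ)
    refine (h₁.integrable_comp_emb (MeasurableEquiv.measurableEmbedding _)).1 ?_
    have h₂ := hT.integrable_coefSup hμ (c := Sum.elim (fun _ : Fin r => (1 : ℝ))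
      (fun _ : Fin r => (-1 : ℝ))) (by rintro (i | i) <;> simp)
    refine h₂.congr (.of_forall fun z => ?_)
    simp only [coefSup, hG, Function.comp, Fintype.sum_sum_type, Sum.elim_inl, Sum.elim_inr,
      Finset.sum_sub_distrib, MeasurableEquiv.coe_sumPiEquivProdPi, Equiv.sumPiEquivProdPi_apply]
    simp [sub_eq_add_neg]
  have h₁ : ∀ᵐ x ∂(Measure.pi fun _ : Fin r => μ),
      empDev T μ r x ≤ ∫ y, G (x, y) ∂(Measure.pi fun _ : Fin r => μ) := by
    filter_upwards [hGi.prod_right_ae] with x hx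
    refine supAbs_le (integral_nonneg fun _ => supAbs_nonneg) fun f hf => ?_
    have hf' := hT.integrable hμ hf
    have hk : ∀ k : Fin r, Integrable (fun y : Fin r → E => f (y k))
        (Measure.pi fun _ : Fin r => μ) := fun k => integrable_comp_eval (i := k) hf'
    have hkk : ∀ k : Fin r, Integrable (fun y : Fin r → E => f (x k) - f (y k))
        (Measure.pi fun _ : Fin r => μ) := fun k => (integrable_const _).sub (hk k)
    have e : ∑ i, f (x i) - r * ∫ y, f y ∂μ =
        ∫ y, ∑ k, (f (x k) - f (y k)) ∂(Measure.pi fun _ : Fin r => μ) := by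
      rw [integral_finsetSum _ fun k _ => hkk k]
      have : ∀ k : Fin r, ∫ y : Fin r → E, (f (x k) - f (y k)) ∂(Measure.pi fun _ : Fin r => μ) =
          f (x k) - ∫ y, f y ∂μ := fun k => by
        rw [integral_sub (integrable_const _) (hk k),
          integral_comp_eval (μ := fun _ : Fin r => μ) (i := k) hf'.aestronglyMeasurable]
        simp
      simp_rw [this]
      simp
    rw [e]
    refine abs_integral_le_integral_abs.trans (integral_mono ?_ hx fun y => le_supAbs (hb (x, y)) hf)
    exact (integrable_finsetSum _ fun k _ => hkk k).abs
  have h₂ : ∫ w, G w ∂((Measure.pi fun _ : Fin r => μ).prod (Measure.pi fun _ : Fin r => μ)) =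
      ∫ z, G (fun k => z (p k), fun k => z (q k)) ∂(Measure.pi fun _ : ι => μ) := by
    have h := measurePreserving_comp_prod μ hpq
    rw [← h.map_eq, integral_map h.measurable.aemeasurable]
    rw [h.map_eq]
    exact hGi.aestronglyMeasurable
  rw [meanDev, ← h₂, integral_prod _ hGi]
  exact integral_mono_ae (hT.integrable_empDev hμ r) hGi.integral_prod_left h₁

/-- Leave-one-out averaging: each point is omitted by exactly one of the `k + 1` subsamples, so `k`
times the full deviation is the sum of theirs. Hence the mean deviation per point is non-increasing
in the sample size. -/
theorem LipClass.mul_meanDev_succ_le (hT : LipClass T) (hμ : Integrable (fun x : E => x) μ)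
    (k : ℕ) : k * meanDev T μ (k + 1) ≤ (k + 1) * meanDev T μ k := by
  have hi := hT.integrable_empDev hμ k
  have hji := fun j : Fin (k + 1) =>
    integrable_pi_comp_of_injective (Fin.succAbove_right_injective (p := j)) hi
  have h₁ : ∀ z : Fin (k + 1) → E, k * empDev T μ (k + 1) z ≤
      ∑ j : Fin (k + 1), empDev T μ k fun i => z (j.succAbove i) := by
    intro z
    rw [empDev, supAbs, Real.mul_iSup_of_nonneg k.cast_nonneg]
    refine Real.iSup_le (fun f => ?_) (Finset.sum_nonneg fun _ _ => supAbs_nonneg)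
    have e : (k : ℝ) * (∑ i, f.1 (z i) - ((k + 1 : ℕ) : ℝ) * ∫ y, f.1 y ∂μ) =
        ∑ j : Fin (k + 1), (∑ i, f.1 (z (j.succAbove i)) - k * ∫ y, f.1 y ∂μ) := by
      have : ∀ j : Fin (k + 1), ∑ i, f.1 (z (j.succAbove i)) = ∑ i, f.1 (z i) - f.1 (z j) :=
        fun j => by rw [Fin.sum_univ_succAbove (fun i => f.1 (z i)) j]; ring
      simp only [this, Finset.sum_sub_distrib, Finset.sum_const, Finset.card_univ,
        Fintype.card_fin, nsmul_eq_mul]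
      push_cast
      ring
    have e' : (k : ℝ) * |∑ i, f.1 (z i) - ((k + 1 : ℕ) : ℝ) * ∫ y, f.1 y ∂μ| =
        |(k : ℝ) * (∑ i, f.1 (z i) - ((k + 1 : ℕ) : ℝ) * ∫ y, f.1 y ∂μ)| := by
      rw [abs_mul, Nat.abs_cast]
    rw [e', e]
    refine (Finset.abs_sum_le_sum_abs _ _).trans (Finset.sum_le_sum fun j _ => ?_)
    refine le_supAbs (A := fun f : E → ℝ => ∑ i, f (z (j.succAbove i)) - k * ∫ y, f y ∂μ) ?_ f.2
    simpa using hT.bdd_dev hμ (fun _ : Fin k => (1 : ℝ)) (k : ℝ) fun i => z (j.succAbove i)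
  calc (k : ℝ) * meanDev T μ (k + 1)
      = ∫ z, k * empDev T μ (k + 1) z ∂(Measure.pi fun _ : Fin (k + 1) => μ) :=
        (integral_const_mul _ _).symm
    _ ≤ ∫ z, ∑ j : Fin (k + 1), empDev T μ k (fun i => z (j.succAbove i))
          ∂(Measure.pi fun _ : Fin (k + 1) => μ) :=
        integral_mono ((hT.integrable_empDev hμ _).const_mul _)
          (integrable_finsetSum _ fun j _ => hji j) h₁
    _ = ∑ j : Fin (k + 1), meanDev T μ k := by
        rw [integral_finsetSum _ fun j _ => hji j]
        refine Finset.sum_congr rfl fun j _ => ?_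
        exact integral_pi_comp_of_injective Fin.succAbove_right_injective hi
    _ = (k + 1) * meanDev T μ k := by simp

theorem LipClass.mul_meanDev_le (hT : LipClass T) (hμ : Integrable (fun x : E => x) μ)
    {r n : ℕ} (h : r ≤ n) : r * meanDev T μ n ≤ n * meanDev T μ r := by
  rcases Nat.eq_zero_or_pos r with rfl | hr
  · simpa using mul_nonneg n.cast_nonneg (meanDev_nonneg (T := T) (μ := μ) 0)
  induction n, h using Nat.le_induction with
  | base => exact le_rfl
  | succ k hk ih =>
    have h₁ := hT.mul_meanDev_succ_le hμ k
    have hk0 : (0 : ℝ) < k := by exact_mod_cast hr.trans_le hk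
    have hr0 : (0 : ℝ) < r := by exact_mod_cast hr
    refine le_of_mul_le_mul_left ?_ hk0
    push_cast
    nlinarith

/-- Rademacher averages dominate half of the mean deviation. -/
theorem LipClass.meanDev_le_two_mul (hT : LipClass T) (hμ : Integrable (fun x : E => x) μ)
    {n : ℕ} (ε : Fin n → ℤˣ) :
    meanDev T μ n ≤ 2 * ∫ z, radSup T id z ε ∂(Measure.pi fun _ : Fin n => μ) := by
  -- Where `ε i = -1` the two copies exchange roles, which turns plain differences into signed ones
  -- for this fixed sign pattern.
  set p : Fin n → Fin n ⊕ Fin n := fun i => if ε i = 1 then Sum.inl i else Sum.inr i with hp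
  set q : Fin n → Fin n ⊕ Fin n := fun i => if ε i = 1 then Sum.inr i else Sum.inl i with hq
  have hpq : Function.Injective (Sum.elim p q) := by
    rintro (i | i) (j | j) h <;> simp only [Sum.elim_inl, Sum.elim_inr, hp, hq] at h <;>
      split_ifs at h <;> simp_all
  refine (hT.meanDev_le_integral_sup_sub hμ hpq).trans ?_
  have hR : Integrable (fun z => radSup T id z ε) (Measure.pi fun _ : Fin n => μ) :=
    hT.integrable_coefSup hμ (c := fun i => ((ε i : ℤ) : ℝ)) fun i => (abs_sign _).le
  have i₁ := integrable_pi_comp_of_injective (Sum.inl_injective (α := Fin n) (β := Fin n)) hR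
  have i₂ := integrable_pi_comp_of_injective (Sum.inr_injective (α := Fin n) (β := Fin n)) hR
  have h₁ : ∀ z : Fin n ⊕ Fin n → E, supAbs T (fun f => ∑ k, (f (z (p k)) - f (z (q k)))) ≤
      radSup T id (fun k => z (Sum.inl k)) ε + radSup T id (fun k => z (Sum.inr k)) ε := by
    intro z
    refine supAbs_le (add_nonneg (radSup_nonneg _ _) (radSup_nonneg _ _)) fun f hf => ?_
    have h₁ := le_radSup hT.ptBdd isContr_id (fun k => z (Sum.inl k)) ε hf
    have h₂ := le_radSup hT.ptBdd isContr_id (fun k => z (Sum.inr k)) ε hf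
    have e : ∑ k, (f (z (p k)) - f (z (q k))) =
        (signSum ε fun i => id (f (z (Sum.inl i)))) - signSum ε fun i => id (f (z (Sum.inr i))) := by
      rw [signSum, signSum, ← Finset.sum_sub_distrib]
      refine Finset.sum_congr rfl fun i _ => ?_
      rcases Int.units_eq_one_or (ε i) with h | h
      · simp [hp, hq, h]
      · simp [hp, hq, h]
        ring
    rw [e]
    exact (abs_sub _ _).trans (add_le_add h₁ h₂)
  have hbi : Integrable (fun z : Fin n ⊕ Fin n → E => supAbs T
      fun f => ∑ k, (f (z (p k)) - f (z (q k)))) (Measure.pi fun _ => μ) := by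
    have hc : Continuous fun z : Fin n ⊕ Fin n → E => supAbs T
        fun f => ∑ k, (f (z (p k)) - f (z (q k))) := by
      have h₂ := hT.sumLip_coefSup (ι := Fin n ⊕ Fin n) hμ
        (c := Sum.elim (fun k : Fin n => ((ε k : ℤ) : ℝ)) (fun k : Fin n => -((ε k : ℤ) : ℝ)))
        (by rintro (i | i) <;> simp [abs_sign])
      convert h₂.continuous using 1
      ext z
      simp only [coefSup, Fintype.sum_sum_type, Sum.elim_inl, Sum.elim_inr]
      congr 1
      ext f
      rw [← Finset.sum_add_distrib]
      refine Finset.sum_congr rfl fun i _ => ?_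
      rcases Int.units_eq_one_or (ε i) with h | h
      · simp [hp, hq, h]; ring
      · simp [hp, hq, h]; ring
    refine (i₁.add i₂).mono' hc.measurable.aestronglyMeasurable (.of_forall fun z => ?_)
    rw [Real.norm_of_nonneg supAbs_nonneg]
    exact h₁ z
  calc _ ≤ ∫ z : Fin n ⊕ Fin n → E, (radSup T id (fun k => z (Sum.inl k)) ε +
        radSup T id (fun k => z (Sum.inr k)) ε) ∂(Measure.pi fun _ => μ) :=
        integral_mono hbi (i₁.add i₂) h₁
    _ = _ := by
      rw [integral_add i₁ i₂, integral_pi_comp_of_injective Sum.inl_injective hR,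
        integral_pi_comp_of_injective Sum.inr_injective hR, two_mul]

/-- Exchanging `p k` with `q k` preserves the measure. Subtracting the signed sum after the exchange
from the one before cancels all unpaired positions and doubles each paired difference; this 2
offsets the two suprema, so no factor is lost. -/
theorem LipClass.meanDev_le_integral_radSup {ι : Type*} [Fintype ι] (hT : LipClass T)
    (hμ : Integrable (fun x : E => x) μ) {r : ℕ} {p q : Fin r → ι}
    (hpq : Function.Injective (Sum.elim p q)) {ε : ι → ℤˣ} (hp : ∀ k, ε (p k) = 1)
    (hq : ∀ k, ε (q k) = -1) :
    meanDev T μ r ≤ ∫ z, radSup T id z ε ∂(Measure.pi fun _ : ι => μ) := by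
  classical
  refine (hT.meanDev_le_integral_sup_sub hμ hpq).trans ?_
  let e : (Fin r ⊕ Fin r) ⊕ ((Set.range (Sum.elim p q))ᶜ : Set ι) ≃ ι :=
    ((Equiv.ofInjective _ hpq).sumCongr (Equiv.refl _)).trans (Equiv.Set.sumCompl _)
  let s : (Fin r ⊕ Fin r) ⊕ ((Set.range (Sum.elim p q))ᶜ : Set ι) ≃
      (Fin r ⊕ Fin r) ⊕ ((Set.range (Sum.elim p q))ᶜ : Set ι) :=
    (Equiv.sumComm _ _).sumCongr (Equiv.refl _)
  let π : ι ≃ ι := e.symm.trans (s.trans e)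
  have he₁ : ∀ k, e (Sum.inl (Sum.inl k)) = p k := fun k => by simp [e]
  have he₂ : ∀ k, e (Sum.inl (Sum.inr k)) = q k := fun k => by simp [e]
  have hπ : ∀ a, π (e a) = e (s a) := fun a => by simp [π]
  have hR : Integrable (fun z => radSup T id z ε) (Measure.pi fun _ : ι => μ) :=
    hT.integrable_coefSup hμ (c := fun i => ((ε i : ℤ) : ℝ)) fun i => (abs_sign _).le
  have i₂ := integrable_pi_comp_of_injective π.injective hR
  have h₁ : ∀ z : ι → E, supAbs T (fun f => ∑ k, (f (z (p k)) - f (z (q k)))) ≤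
      (radSup T id z ε + radSup T id (fun k => z (π k)) ε) / 2 := by
    intro z
    refine supAbs_le (div_nonneg (add_nonneg (radSup_nonneg _ _) (radSup_nonneg _ _)) zero_le_two)
      fun f hf => ?_
    have h₁ := le_radSup hT.ptBdd isContr_id z ε hf
    have h₂ := le_radSup hT.ptBdd isContr_id (fun k => z (π k)) ε hf
    have e' : 2 * ∑ k, (f (z (p k)) - f (z (q k))) =
        (signSum ε fun i => id (f (z i))) - signSum ε fun i => id (f (z (π i))) := by
      rw [signSum, signSum, ← Finset.sum_sub_distrib, ← Equiv.sum_comp e]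
      simp only [hπ, Fintype.sum_sum_type, he₁, he₂, hp, hq, id]
      simp only [s, Equiv.sumCongr_apply, Sum.map_inl, Equiv.sumComm_apply, Sum.swap_inl,
        Sum.swap_inr, Sum.map_inr, Equiv.refl_apply, he₁, he₂, sub_self, Finset.sum_const_zero,
        add_zero, two_mul, ← Finset.sum_add_distrib]
      refine Finset.sum_congr rfl fun k _ => ?_
      simp
      ring
    have h₃ := (abs_sub (signSum ε fun i => id (f (z i)))
      (signSum ε fun i => id (f (z (π i))))).trans (add_le_add h₁ h₂)
    rw [← e', abs_mul, abs_two] at h₃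
    linarith
  have hbi : Integrable (fun z : ι → E => supAbs T
      fun f => ∑ k, (f (z (p k)) - f (z (q k)))) (Measure.pi fun _ => μ) := by
    have h₂ := hT.sumLip_coefSup (ι := Fin r ⊕ Fin r) hμ
      (c := Sum.elim (fun _ : Fin r => (1 : ℝ)) (fun _ : Fin r => -(1 : ℝ)))
      (by rintro (i | i) <;> simp)
    refine (integrable_pi_comp_of_injective hpq (h₂.integrable hμ)).congr (.of_forall fun z => ?_)
    simp [coefSup, sub_eq_add_neg, Finset.sum_add_distrib]
  calc _ ≤ ∫ z : ι → E, (radSup T id z ε + radSup T id (fun k => z (π k)) ε) / 2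
        ∂(Measure.pi fun _ => μ) := integral_mono hbi ((hR.add i₂).div_const 2) h₁
    _ = _ := by
      rw [integral_div, integral_add hR i₂, integral_pi_comp_of_injective π.injective hR]
      ring

end symmetrization

/-! ### Averages over signs -/

theorem sum_sign_sum_sq (n : ℕ) :
    ∑ ε : Fin n → ℤˣ, (∑ i, ((ε i : ℤ) : ℝ)) ^ 2 = 2 ^ n * n := by
  induction n with
  | zero => simp
  | succ n ih =>
    rw [sum_signs_succ, Finset.sum_add_distrib]
    simp only [Fin.sum_univ_succ, Fin.cons_zero, Fin.cons_succ]
    rw [← Finset.sum_add_distrib]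
    have : ∀ ε : Fin n → ℤˣ, ((((1 : ℤˣ) : ℤ) : ℝ) + ∑ i, ((ε i : ℤ) : ℝ)) ^ 2 +
        ((((-1 : ℤˣ) : ℤ) : ℝ) + ∑ i, ((ε i : ℤ) : ℝ)) ^ 2 =
        2 + 2 * (∑ i, ((ε i : ℤ) : ℝ)) ^ 2 := fun ε => by
      push_cast
      ring
    simp_rw [this]
    rw [Finset.sum_add_distrib, ← Finset.mul_sum, ih]
    simp
    ring

theorem sum_sign_exp_mul_sum (n : ℕ) (a : ℝ) :
    ∑ ε : Fin n → ℤˣ, Real.exp (a * ∑ i, ((ε i : ℤ) : ℝ)) = (2 * Real.cosh a) ^ n := by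
  induction n with
  | zero => simp
  | succ n ih =>
    rw [sum_signs_succ, Finset.sum_add_distrib]
    simp only [Fin.sum_univ_succ, Fin.cons_zero, Fin.cons_succ, mul_add, Real.exp_add,
      ← Finset.mul_sum, ih]
    rw [Real.cosh_eq, pow_succ]
    simp
    ring

theorem sum_sign_exp_mul_sum_le (n : ℕ) (a : ℝ) :
    ∑ ε : Fin n → ℤˣ, Real.exp (a * ∑ i, ((ε i : ℤ) : ℝ)) ≤ 2 ^ n * Real.exp (n * (a ^ 2 / 2)) := by
  rw [sum_sign_exp_mul_sum, mul_pow, Real.exp_nat_mul]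
  have := Real.cosh_le_exp_half_sq a
  have h0 := (Real.cosh_pos a).le
  gcongr

/-- One-dimensional Gaussian integration with counting measure on the sign patterns: `v = n` and `θ²
= 1 / (2n)` give `1 - θ² v = 1/2`, whence the factor √2. -/
theorem sum_sign_exp_sq_le {n : ℕ} (hn : 1 ≤ n) :
    ∑ ε : Fin n → ℤˣ, Real.exp ((∑ i, ((ε i : ℤ) : ℝ)) ^ 2 / (4 * n)) ≤ 2 ^ n * Real.sqrt 2 := by
  let _ : MeasurableSpace (Fin n → ℤˣ) := ⊤
  have : MeasurableSingletonClass (Fin n → ℤˣ) := ⟨fun _ => trivial⟩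
  have hn0 : (0 : ℝ) < n := by exact_mod_cast hn
  have hθ : Real.sqrt (1 / (2 * n)) ^ 2 = 1 / (2 * n) := Real.sq_sqrt (by positivity)
  have h := lintegral_exp_norm_sq_le (V := ℝ) (P := Measure.count)
    (S := fun ε : Fin n → ℤˣ => ∑ i, ((ε i : ℤ) : ℝ)) (measurable_of_finite _)
    (C := ENNReal.ofReal (2 ^ n)) (b := 0) (v := n) (θ := Real.sqrt (1 / (2 * n)))
    (fun a => by
      rw [lintegral_count, tsum_fintype,
        ← ENNReal.ofReal_sum_of_nonneg fun _ _ => (Real.exp_pos _).le,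
        ← ENNReal.ofReal_mul (by positivity)]
      refine ENNReal.ofReal_le_ofReal ?_
      have := sum_sign_exp_mul_sum_le n a
      simp only [inner_zero_right, zero_add, Real.norm_eq_abs, sq_abs]
      convert this using 3
      · simp [mul_comm]
      · ring_nf)
    (by rw [hθ]; field_simp; norm_num)
  rw [hθ, show (1 : ℝ) - 1 / (2 * n) * n = 1 / 2 by field_simp; norm_num] at h
  rw [lintegral_count, tsum_fintype,
    ← ENNReal.ofReal_sum_of_nonneg fun _ _ => (Real.exp_pos _).le,
    ← ENNReal.ofReal_mul (by positivity), ENNReal.ofReal_le_ofReal_iff (by positivity)] at h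
  have e : ((1 / 2 : ℝ)⁻¹ ^ ((Module.finrank ℝ ℝ : ℝ) / 2)) = Real.sqrt 2 := by
    rw [Real.sqrt_eq_rpow]; norm_num
  rw [e] at h
  convert h using 3 with ε
  · simp
    field_simp
    norm_num
  · simp

/-- `E sup_{f ∈ T} |∑ i, ε i * f (z i)|` for i.i.d. points and independent random signs. -/
noncomputable def meanRad {E : Type*} [MeasurableSpace E] (T : Set (E → ℝ)) (μ : Measure E)
    (n : ℕ) : ℝ :=
  (2 ^ n)⁻¹ * ∑ ε, ∫ z, radSup T id z ε ∂(Measure.pi fun _ : Fin n => μ)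

/-- Jensen's inequality, proved with the tangent of the exponential at `log Q`: `1 + x - log Q ≤ exp
x / Q`. -/
theorem mul_integral_le_log {Ω : Type*} [MeasurableSpace Ω] {P : Measure Ω} [IsProbabilityMeasure P]
    {R : Ω → ℝ} (hR : Integrable R P) {l Q : ℝ} (hQ : 0 < Q)
    (h : ∫⁻ ω, ENNReal.ofReal (Real.exp (l * R ω)) ∂P ≤ ENNReal.ofReal Q) :
    l * ∫ ω, R ω ∂P ≤ Real.log Q := by
  have hm : AEStronglyMeasurable (fun ω => Real.exp (l * R ω)) P :=
    Real.continuous_exp.comp_aestronglyMeasurable (hR.aestronglyMeasurable.const_mul l)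
  have hi : Integrable (fun ω => Real.exp (l * R ω)) P :=
    ⟨hm, (hasFiniteIntegral_iff_ofReal (.of_forall fun _ => (Real.exp_pos _).le)).2
      (h.trans_lt ENNReal.ofReal_lt_top)⟩
  rw [← ofReal_integral_eq_lintegral_ofReal hi (.of_forall fun _ => (Real.exp_pos _).le),
    ENNReal.ofReal_le_ofReal_iff hQ.le] at h
  have h₁ : ∀ ω, l * R ω ≤ (Real.log Q - 1) + Real.exp (l * R ω) / Q := by
    intro ω
    have := Real.add_one_le_exp (l * R ω - Real.log Q)
    rw [Real.exp_sub, Real.exp_log hQ] at this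
    linarith
  have h₂ := integral_mono (hR.const_mul l)
    ((integrable_const (Real.log Q - 1)).add (hi.div_const Q)) h₁
  rw [integral_const_mul] at h₂
  refine h₂.trans ?_
  rw [integral_add' (integrable_const _) (hi.div_const Q), integral_div]
  have : (∫ ω, Real.exp (l * R ω) ∂P) / Q ≤ 1 := (div_le_one hQ).2 h
  simp
  linarith

section LipClass

variable {E : Type*} [NormedAddCommGroup E] {T : Set (E → ℝ)} [MeasurableSpace E] [BorelSpace E]
  {μ : Measure E} [SecondCountableTopology E] [IsProbabilityMeasure μ]

theorem LipClass.integrable_radSup {ι : Type*} [Fintype ι] (hT : LipClass T)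
    (hμ : Integrable (fun x : E => x) μ) (ε : ι → ℤˣ) :
    Integrable (fun z => radSup T id z ε) (Measure.pi fun _ : ι => μ) :=
  hT.integrable_coefSup hμ (c := fun i => ((ε i : ℤ) : ℝ)) fun _ => (abs_sign _).le

theorem LipClass.meanDev_le_two_mul_meanRad (hT : LipClass T)
    (hμ : Integrable (fun x : E => x) μ) (n : ℕ) : meanDev T μ n ≤ 2 * meanRad T μ n := by
  have h := Finset.sum_le_sum fun ε (_ : ε ∈ (Finset.univ : Finset (Fin n → ℤˣ))) =>
    hT.meanDev_le_two_mul hμ ε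
  rw [← Finset.mul_sum, Finset.sum_const, Finset.card_univ, nsmul_eq_mul] at h
  simp only [Fintype.card_pi, Finset.prod_const, Fintype.card_units_int, Finset.card_univ,
    Fintype.card_fin] at h
  push_cast at h
  rw [meanRad, mul_left_comm, inv_mul_eq_div, le_div_iff₀ (by positivity)]
  linarith

/-- Desymmetrization: nearly balanced sign patterns control the mean deviation without loss of
the factor two. -/
theorem LipClass.meanDev_le_meanRad (hT : LipClass T)
    (hμ : Integrable (fun x : E => x) μ) {n : ℕ} (hn : 1 ≤ n) :
    (7 * n - 1) / (8 * n) * meanDev T μ n ≤ meanRad T μ (2 * n + 2) := by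
  have hn0 : (0 : ℝ) < n := by exact_mod_cast hn
  have key : ∀ ε : Fin (2 * n + 2) → ℤˣ,
      (n - (∑ i, ((ε i : ℤ) : ℝ)) ^ 2 / 16) * meanDev T μ n ≤
        n * ∫ z, radSup T id z ε ∂(Measure.pi fun _ : Fin (2 * n + 2) => μ) := by
    intro ε
    set P := Finset.univ.filter fun i => ε i = 1 with hP
    set Q := Finset.univ.filter fun i => ¬ε i = 1 with hQ
    have hc : P.card + Q.card = 2 * n + 2 := by
      rw [hP, hQ, Finset.card_filter_add_card_filter_not]; simp
    have hE : ∑ i, ((ε i : ℤ) : ℝ) = P.card - Q.card := by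
      rw [← Finset.sum_filter_add_sum_filter_not Finset.univ fun i => ε i = 1]
      have e₁ : ∑ i ∈ P, ((ε i : ℤ) : ℝ) = P.card := by
        rw [Finset.card_eq_sum_ones, Nat.cast_sum]
        refine Finset.sum_congr rfl fun i hi => ?_
        simp [(Finset.mem_filter.1 hi).2]
      have e₂ : ∑ i ∈ Q, ((ε i : ℤ) : ℝ) = -Q.card := by
        rw [Finset.card_eq_sum_ones, Nat.cast_sum, ← Finset.sum_neg_distrib]
        refine Finset.sum_congr rfl fun i hi => ?_
        simp [(Int.units_eq_one_or (ε i)).resolve_left (Finset.mem_filter.1 hi).2]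
      rw [← hP, ← hQ, e₁, e₂, sub_eq_add_neg]
    set r := min (min P.card Q.card) n with hr
    have hrP : r ≤ P.card := (min_le_left _ _).trans (min_le_left _ _)
    have hrQ : r ≤ Q.card := (min_le_left _ _).trans (min_le_right _ _)
    let p : Fin r → Fin (2 * n + 2) := fun k => (P.equivFin.symm (Fin.castLE hrP k)).1
    let q : Fin r → Fin (2 * n + 2) := fun k => (Q.equivFin.symm (Fin.castLE hrQ k)).1
    have hp : ∀ k, ε (p k) = 1 := fun k =>
      (Finset.mem_filter.1 (P.equivFin.symm (Fin.castLE hrP k)).2).2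
    have hq' : ∀ k, ¬ ε (q k) = 1 := fun k =>
      (Finset.mem_filter.1 (Q.equivFin.symm (Fin.castLE hrQ k)).2).2
    have hq : ∀ k, ε (q k) = -1 := fun k => (Int.units_eq_one_or _).resolve_left (hq' k)
    have hpi : Function.Injective p :=
      Subtype.val_injective.comp (P.equivFin.symm.injective.comp (Fin.castLE_injective hrP))
    have hqi : Function.Injective q :=
      Subtype.val_injective.comp (Q.equivFin.symm.injective.comp (Fin.castLE_injective hrQ))
    have hpq : Function.Injective (Sum.elim p q) :=
      hpi.sumElim hqi fun a b hab => hq' b (hab ▸ hp a)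
    have h₁ := hT.meanDev_le_integral_radSup hμ hpq hp hq
    have h₂ := hT.mul_meanDev_le hμ (min_le_right _ _ : r ≤ n)
    -- Put `S = |P| - |Q|`. Since `|P| + |Q| = 2n + 2`, the smaller class has `n + 1 - |S| / 2`
    -- elements, and `(1 - |S| / 4)² ≥ 0` makes this at least `n - S² / 16`. The two points beyond
    -- `2n` supply the `+ 1` that absorbs the square.
    have h₃ : (n : ℝ) - (∑ i, ((ε i : ℤ) : ℝ)) ^ 2 / 16 ≤ r := by
      have hc' : (P.card : ℝ) + Q.card = 2 * n + 2 := by exact_mod_cast hc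
      rw [hE]
      rcases min_choice (min P.card Q.card) n with h | h
      · rcases min_choice P.card Q.card with h' | h'
        · rw [hr, h, h']
          nlinarith [sq_nonneg (1 + ((P.card : ℝ) - Q.card) / 4)]
        · rw [hr, h, h']
          nlinarith [sq_nonneg (1 - ((P.card : ℝ) - Q.card) / 4)]
      · rw [hr, h]
        nlinarith [sq_nonneg ((P.card : ℝ) - Q.card)]
    calc _ ≤ (r : ℝ) * meanDev T μ n := mul_le_mul_of_nonneg_right h₃ (meanDev_nonneg _)
      _ ≤ n * meanDev T μ r := h₂
      _ ≤ _ := mul_le_mul_of_nonneg_left h₁ hn0.le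
  have h := Finset.sum_le_sum fun ε (_ : ε ∈ (Finset.univ : Finset (Fin (2 * n + 2) → ℤˣ))) => key ε
  rw [← Finset.sum_mul, ← Finset.mul_sum, Finset.sum_sub_distrib, ← Finset.sum_div,
    sum_sign_sum_sq, Finset.sum_const, Finset.card_univ, nsmul_eq_mul] at h
  simp only [Fintype.card_pi, Finset.prod_const, Fintype.card_units_int, Finset.card_univ,
    Fintype.card_fin] at h
  push_cast at h
  rw [meanRad, inv_mul_eq_div, le_div_iff₀ (by positivity)]
  -- The mean of `S²` is `2n + 2`, so `n - S² / 16` averages to `(7n - 1) / 8`.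
  have e : (2 : ℝ) ^ (2 * n + 2) * n - 2 ^ (2 * n + 2) * (2 * n + 2) / 16 =
      2 ^ (2 * n + 2) * ((7 * n - 1) / 8) := by ring
  rw [e] at h
  refine le_of_mul_le_mul_left ?_ hn0
  calc _ = 2 ^ (2 * n + 2) * ((7 * n - 1) / 8) * meanDev T μ n := by field_simp
    _ ≤ _ := h

/-- Jensen over signs and sample together. `K` collects the peeling factors and `Q` the averaged
exponential moment of the base class, represented by the majorant `b`. -/
theorem LipClass.mul_meanRad_le (hT : LipClass T) (hμ : Integrable (fun x : E => x) μ) {n : ℕ}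
    {l K Q : ℝ} (hK : 0 < K) (hQ : 0 < Q) {b : (Fin n → ℤˣ) → (Fin n → E) → ℝ}
    (hb : ∀ ε z, 0 ≤ b ε z) (hbm : ∀ ε, Measurable (b ε))
    (h : ∀ z, ∑ ε, Real.exp (l * radSup T id z ε) ≤ K * ∑ ε, b ε z)
    (hi : ∑ ε, ∫⁻ z, ENNReal.ofReal (b ε z) ∂(Measure.pi fun _ : Fin n => μ) ≤
      ENNReal.ofReal (2 ^ n * Q)) :
    l * meanRad T μ n ≤ Real.log (K * Q) := by
  have e : meanRad T μ n = ∫ z, ∑ ε, (2 ^ n)⁻¹ * radSup T id z ε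
      ∂(Measure.pi fun _ : Fin n => μ) := by
    rw [meanRad, integral_finsetSum _ fun ε _ => (hT.integrable_radSup hμ ε).const_mul _,
      Finset.mul_sum]
    simp_rw [integral_const_mul]
  rw [e]
  refine mul_integral_le_log (integrable_finsetSum _ fun ε _ =>
    (hT.integrable_radSup hμ ε).const_mul _) (mul_pos hK hQ) ?_
  have h₁ : ∀ z : Fin n → E, ENNReal.ofReal (Real.exp (l * ∑ ε, (2 ^ n)⁻¹ * radSup T id z ε)) ≤
      ENNReal.ofReal ((2 ^ n)⁻¹ * K) * ∑ ε, ENNReal.ofReal (b ε z) := by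
    intro z
    rw [← ENNReal.ofReal_sum_of_nonneg fun ε _ => hb ε z, ← ENNReal.ofReal_mul (by positivity)]
    refine ENNReal.ofReal_le_ofReal ?_
    have h₂ := convexOn_exp.map_sum_le (t := (Finset.univ : Finset (Fin n → ℤˣ)))
      (w := fun _ => (2 ^ n)⁻¹) (p := fun ε => l * radSup T id z ε)
      (fun _ _ => by positivity) (by simp) (fun _ _ => Set.mem_univ _)
    simp only [smul_eq_mul, ← Finset.mul_sum] at h₂
    calc _ = Real.exp ((2 ^ n)⁻¹ * (l * ∑ ε, radSup T id z ε)) := by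
          rw [← Finset.mul_sum]; ring_nf
      _ ≤ (2 ^ n)⁻¹ * ∑ ε, Real.exp (l * radSup T id z ε) := h₂
      _ ≤ (2 ^ n)⁻¹ * (K * ∑ ε, b ε z) := by gcongr; exact h z
      _ = _ := by ring
  refine (lintegral_mono h₁).trans ?_
  rw [lintegral_const_mul' _ _ ENNReal.ofReal_ne_top,
    lintegral_finsetSum _ fun ε _ => (hbm ε).ennreal_ofReal]
  refine (mul_le_mul_right hi _).trans (le_of_eq ?_)
  rw [← ENNReal.ofReal_mul (by positivity)]
  congr 1
  field_simp

end LipClass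

/-! ### Expected suprema over hulls of linear functionals -/

theorem LipClass.hullClass {E : Type*} [NormedAddCommGroup E] {B : Set (E → ℝ)} (hB : LipClass B)
    {τ : ℕ → ℝ → ℝ} (hτ : ∀ t, IsContr (τ t)) (t : ℕ) : LipClass (hullClass B τ t) where
  nonempty := hullClass_nonempty hB.nonempty t
  lip f hf x y :=
    hullClass_abs_sub_le hτ (norm_nonneg _) (fun f hf => hB.lip f hf x y) t f hf
  zero f hf := abs_nonpos_iff.1
    (hullClass_abs_le hτ le_rfl (fun f hf => by simp [hB.zero f hf]) t f hf)

/-- For positive `y` the best choice is `l = y / B`. -/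
theorem le_sqrt_of_forall_mul_le {y A B : ℝ} (hA : 0 < A) (hB : 0 < B)
    (h : ∀ l, 0 < l → l * y ≤ A + B * l ^ 2 / 2) : y ≤ Real.sqrt (2 * A * B) := by
  rcases le_or_gt y 0 with hy | hy
  · exact hy.trans (Real.sqrt_nonneg _)
  · have h₁ := h (y / B) (by positivity)
    have e₁ : y / B * y = y ^ 2 / B := by ring
    have e₂ : A + B * (y / B) ^ 2 / 2 = A + y ^ 2 / B / 2 := by field_simp
    rw [e₁, e₂] at h₁
    have h₂ : y ^ 2 / B ≤ 2 * A := by linarith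
    rw [div_le_iff₀ hB] at h₂
    exact Real.le_sqrt_of_sq_le h₂

/-- The linear functionals with coefficient vector in the Euclidean unit ball. -/
def l2Ball (k : ℕ) : Set (Euc k → ℝ) := {f | ∃ v : Euc k, ‖v‖ ≤ 1 ∧ f = fun x => inner ℝ v x}

/-- The linear functionals with coefficient vector in the `ℓ¹` unit ball. -/
def l1Ball (k : ℕ) : Set (Euc k → ℝ) :=
  {f | ∃ v : Fin k → ℝ, ∑ j, |v j| ≤ 1 ∧ f = fun x => ∑ j, v j * x j}

theorem lipClass_l2Ball (k : ℕ) : LipClass (l2Ball k) where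
  nonempty := ⟨_, 0, by simp, rfl⟩
  lip := by
    rintro _ ⟨v, hv, rfl⟩ x y
    rw [← inner_sub_right]
    exact (abs_real_inner_le_norm _ _).trans (mul_le_of_le_one_left (norm_nonneg _) hv)
  zero := by
    rintro _ ⟨v, hv, rfl⟩
    simp

theorem lipClass_l1Ball (k : ℕ) : LipClass (l1Ball k) where
  nonempty := ⟨_, 0, by simp, rfl⟩
  lip := by
    rintro _ ⟨v, hv, rfl⟩ x y
    rw [← Finset.sum_sub_distrib]
    simp_rw [← mul_sub]
    exact abs_sum_mul_le hv (fun j => by simpa using PiLp.norm_apply_le (x - y) j) (norm_nonneg _)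
  zero := by
    rintro _ ⟨v, hv, rfl⟩
    simp

theorem radSup_l2Ball_le {k : ℕ} {ι : Type*} [Fintype ι] (z : ι → Euc k) (ε : ι → ℤˣ) :
    radSup (l2Ball k) id z ε ≤ ‖∑ i, ((ε i : ℤ) : ℝ) • z i‖ := by
  refine radSup_le (norm_nonneg _) ?_
  rintro _ ⟨v, hv, rfl⟩
  have : (signSum ε fun i => id (inner ℝ v (z i))) = inner ℝ v (∑ i, ((ε i : ℤ) : ℝ) • z i) := by
    simp [signSum, inner_sum, inner_smul_right]
  rw [this]
  exact (abs_real_inner_le_norm _ _).trans (mul_le_of_le_one_left (norm_nonneg _) hv)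

section l2

variable {k : ℕ} {Γ : ℝ} {u : Euc k} {μ : Measure (Euc k)}

/-- Young's inequality with `θ² = 1 / (3 n Γ²)` trades the norm for its square. With `v = n Γ²` one
has `θ² v = 1/3`, which gives `(3/2) ^ (k/2)`. As `‖u‖ ≤ Γ`, the mean contributes at most `exp (S² /
(4n))` with `S` the sum of the signs, precisely the moment bounded in `sum_sign_exp_sq_le`. -/
theorem SubG.sum_lintegral_exp_norm_le (h : SubG Γ u μ) {n : ℕ} (hn : 1 ≤ n) (l : ℝ) :
    ∑ ε : Fin n → ℤˣ, ∫⁻ z, ENNReal.ofReal (Real.exp (l * ‖∑ i, ((ε i : ℤ) : ℝ) • z i‖))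
        ∂(Measure.pi fun _ : Fin n => μ) ≤
      ENNReal.ofReal (2 ^ n * (Real.exp (3 * n * Γ ^ 2 * l ^ 2 / 2) *
        (3 / 2 : ℝ) ^ (k / 2 : ℝ) * Real.sqrt 2)) := by
  have := h.prob
  have hΓ := h.pos
  have hn0 : (0 : ℝ) < n := by exact_mod_cast hn
  set θ := Real.sqrt (1 / (3 * n * Γ ^ 2)) with hθd
  have hθ : θ ^ 2 = 1 / (3 * n * Γ ^ 2) := Real.sq_sqrt (by positivity)
  have hc : θ ^ 2 * (n * Γ ^ 2) = 1 / 3 := by rw [hθ]; field_simp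
  have hu : θ ^ 2 * ‖u‖ ^ 2 ≤ 1 / (3 * n) := by
    calc θ ^ 2 * ‖u‖ ^ 2 ≤ θ ^ 2 * Γ ^ 2 := by gcongr; exact h.mean_le
      _ = _ := by rw [hθ]; field_simp
  have key : ∀ ε : Fin n → ℤˣ,
      ∫⁻ z, ENNReal.ofReal (Real.exp (l * ‖∑ i, ((ε i : ℤ) : ℝ) • z i‖))
        ∂(Measure.pi fun _ : Fin n => μ) ≤
      ENNReal.ofReal (Real.exp (3 * n * Γ ^ 2 * l ^ 2 / 2) * (3 / 2 : ℝ) ^ (k / 2 : ℝ)) *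
        ENNReal.ofReal (Real.exp ((∑ i, ((ε i : ℤ) : ℝ)) ^ 2 / (4 * n))) := by
    intro ε
    set s : ℝ := ∑ i, ((ε i : ℤ) : ℝ) with hs
    have h₁ := lintegral_exp_norm_sq_le (P := Measure.pi fun _ : Fin n => μ)
      (S := fun z : Fin n → Euc k => ∑ i, ((ε i : ℤ) : ℝ) • z i) (by fun_prop) (C := 1)
      (b := s • u) (v := n * Γ ^ 2) (θ := θ) (fun a => by
        rw [one_mul]
        refine (h.mgf_sum (fun i => abs_sign (ε i)) a).trans (ENNReal.ofReal_le_ofReal ?_)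
        refine Real.exp_le_exp.2 (le_of_eq ?_)
        rw [inner_smul_right, Fintype.card_fin]
        ring) (by rw [hc]; norm_num)
    rw [hc, one_mul, finrank_euclideanSpace_fin] at h₁
    have h₂ : ∀ z : Fin n → Euc k,
        ENNReal.ofReal (Real.exp (l * ‖∑ i, ((ε i : ℤ) : ℝ) • z i‖)) ≤
        ENNReal.ofReal (Real.exp (3 * n * Γ ^ 2 * l ^ 2 / 2)) *
        ENNReal.ofReal (Real.exp (θ ^ 2 * ‖∑ i, ((ε i : ℤ) : ℝ) • z i‖ ^ 2 / 2)) := by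
      intro z
      rw [← ENNReal.ofReal_mul (Real.exp_pos _).le, ← Real.exp_add]
      refine ENNReal.ofReal_le_ofReal (Real.exp_le_exp.2 ?_)
      set y := ‖∑ i, ((ε i : ℤ) : ℝ) • z i‖
      have e : 3 * n * Γ ^ 2 * θ ^ 2 = 1 := by rw [hθ]; field_simp
      have := mul_nonneg (by positivity : 0 ≤ 3 * n * Γ ^ 2) (sq_nonneg (θ ^ 2 * y - l))
      have e₂ : 3 * n * Γ ^ 2 * (θ ^ 2 * y - l) ^ 2 = (3 * n * Γ ^ 2 * θ ^ 2) * (θ ^ 2 * y ^ 2) -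
        2 * (3 * n * Γ ^ 2 * θ ^ 2) * (y * l) + 3 * n * Γ ^ 2 * l ^ 2 := by ring
      rw [e₂, e] at this
      linarith
    refine (lintegral_mono h₂).trans ?_
    rw [lintegral_const_mul' _ _ ENNReal.ofReal_ne_top, ENNReal.ofReal_mul (Real.exp_pos _).le,
      mul_assoc (ENNReal.ofReal _)]
    refine mul_le_mul_right (h₁.trans ?_) _
    rw [← ENNReal.ofReal_mul (by positivity)]
    refine ENNReal.ofReal_le_ofReal ?_
    have e₁ : ((1 : ℝ) - 1 / 3)⁻¹ = 3 / 2 := by norm_num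
    rw [e₁]
    refine mul_le_mul_of_nonneg_left (Real.exp_le_exp.2 ?_) (by positivity)
    rw [norm_smul, mul_pow, Real.norm_eq_abs, sq_abs]
    calc θ ^ 2 * (s ^ 2 * ‖u‖ ^ 2) / (2 * (1 - 1 / 3)) = (θ ^ 2 * ‖u‖ ^ 2) * (3 / 4 * s ^ 2) := by
          ring
      _ ≤ 1 / (3 * n) * (3 / 4 * s ^ 2) := by gcongr
      _ = _ := by field_simp
  refine (Finset.sum_le_sum fun ε _ => key ε).trans ?_
  rw [← Finset.mul_sum, ← ENNReal.ofReal_sum_of_nonneg fun _ _ => (Real.exp_pos _).le,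
    ← ENNReal.ofReal_mul (by positivity)]
  refine ENNReal.ofReal_le_ofReal ?_
  calc _ ≤ Real.exp (3 * n * Γ ^ 2 * l ^ 2 / 2) * (3 / 2 : ℝ) ^ (k / 2 : ℝ) *
        (2 ^ n * Real.sqrt 2) := by gcongr; exact sum_sign_exp_sq_le hn
    _ = _ := by ring

/-- Three times this constant is the `5/4` in front of the dimension. -/
theorem log_three_halves_le : Real.log (3 / 2) ≤ 5 / 12 := by
  rw [Real.log_le_iff_le_exp (by norm_num)]
  have := Real.quadratic_le_exp_of_nonneg (x := 5 / 12) (by norm_num)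
  linarith

/-- Expected deviation over the layered hull of the Euclidean unit ball. -/
theorem SubG.meanDev_hullClass_l2Ball_le (h : SubG Γ u μ) {n : ℕ} (hn : 1 ≤ n) {τ : ℕ → ℝ → ℝ}
    (hτ : ∀ t, IsContr (τ t)) (t : ℕ) :
    meanDev (_root_.hullClass (l2Ball k) τ t) μ n ≤
      2 * Γ * Real.sqrt (6 * (t + 1 : ℕ) * Real.log 2 + 5 * k / 4) * Real.sqrt n := by
  have := h.prob
  have hΓ := h.pos
  have hn0 : (0 : ℝ) < n := by exact_mod_cast hn
  have hB := lipClass_l2Ball k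
  have hT := hB.hullClass hτ t
  have hl2 : 0 < Real.log 2 := Real.log_pos one_lt_two
  have hl3 : 0 ≤ Real.log (3 / 2) := Real.log_nonneg (by norm_num)
  -- The logarithms of the peeling factor `2 ^ t`, of `(3/2) ^ (k/2)` and of the √2 from averaging
  -- over signs.
  set A := t * Real.log 2 + k / 2 * Real.log (3 / 2) + Real.log 2 / 2 with hA
  have hA0 : 0 < A := by positivity
  have h₁ : meanRad (_root_.hullClass (l2Ball k) τ t) μ n ≤
      Real.sqrt (2 * A * (3 * n * Γ ^ 2)) := by
    refine le_sqrt_of_forall_mul_le hA0 (by positivity) fun l hl => ?_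
    refine (hT.mul_meanRad_le h.integrable (K := 2 ^ t) (by positivity) ?_
      (b := fun ε z => Real.exp (l * ‖∑ i, ((ε i : ℤ) : ℝ) • z i‖)) (fun _ _ => (Real.exp_pos _).le)
      (fun ε => by fun_prop) (fun z => ?_) (h.sum_lintegral_exp_norm_le hn l)).trans (le_of_eq ?_)
    · positivity
    · refine (sum_exp_radSup_hullClass_le hτ hB.ptBdd hB.nonempty z hl.le t).trans ?_
      refine mul_le_mul_of_nonneg_left (Finset.sum_le_sum fun ε _ => Real.exp_le_exp.2 ?_)
        (by positivity)
      exact mul_le_mul_of_nonneg_left (radSup_l2Ball_le z ε) hl.le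
    · rw [Real.log_mul (by positivity) (by positivity), Real.log_mul (by positivity) (by positivity),
        Real.log_mul (by positivity) (by positivity), Real.log_exp, Real.log_pow,
        Real.log_rpow (by norm_num), Real.log_sqrt (by norm_num), hA]
      ring
  refine (hT.meanDev_le_two_mul_meanRad h.integrable n).trans ?_
  calc 2 * meanRad (_root_.hullClass (l2Ball k) τ t) μ n ≤
        2 * Real.sqrt (2 * A * (3 * n * Γ ^ 2)) := by gcongr
    _ ≤ 2 * Real.sqrt ((6 * (t + 1 : ℕ) * Real.log 2 + 5 * k / 4) * n * Γ ^ 2) := by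
        gcongr 2 * Real.sqrt ?_
        have : 6 * A ≤ 6 * (t + 1 : ℕ) * Real.log 2 + 5 * k / 4 := by
          rw [hA]; push_cast
          have := mul_le_mul_of_nonneg_left log_three_halves_le (k.cast_nonneg : (0 : ℝ) ≤ k)
          linarith
        calc 2 * A * (3 * n * Γ ^ 2) = 6 * A * (n * Γ ^ 2) := by ring
          _ ≤ (6 * (t + 1 : ℕ) * Real.log 2 + 5 * k / 4) * (n * Γ ^ 2) := by gcongr
          _ = _ := by ring
    _ = _ := by
        rw [Real.sqrt_mul (by positivity), Real.sqrt_mul (by positivity), Real.sqrt_sq hΓ.le]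
        ring

end l2

/-! ### Hulls of the `ℓ¹` ball -/

section coordinates

/-- `R` stands for anything at most `max |S j|`; at a maximising index the exponential is dominated
by one of the summands. -/
theorem exp_mul_le_sum_of_le_abs {k : ℕ} {S : Fin k → ℝ} {R l : ℝ} (hl : 0 ≤ l) (hk : 1 ≤ k)
    (hR : ∀ C, (∀ j, |S j| ≤ C) → R ≤ C) :
    Real.exp (l * R) ≤ ∑ j, (Real.exp (l * S j) + Real.exp (-l * S j)) := by
  have : Nonempty (Fin k) := ⟨⟨0, hk⟩⟩
  obtain ⟨j, hj⟩ := Finite.exists_max fun j => |S j|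
  have h₁ : Real.exp (l * R) ≤ Real.exp (l * S j) + Real.exp (-l * S j) := by
    have h₂ := mul_le_mul_of_nonneg_left (hR _ hj) hl
    rcases abs_cases (S j) with ⟨h, _⟩ | ⟨h, _⟩
    · rw [h] at h₂
      exact (Real.exp_le_exp.2 h₂).trans (le_add_of_nonneg_right (Real.exp_pos _).le)
    · rw [h, mul_neg, ← neg_mul] at h₂
      exact (Real.exp_le_exp.2 h₂).trans (le_add_of_nonneg_left (Real.exp_pos _).le)
  exact h₁.trans (Finset.single_le_sum
    (f := fun j => Real.exp (l * S j) + Real.exp (-l * S j))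
    (fun j _ => (add_pos (Real.exp_pos _) (Real.exp_pos _)).le) (Finset.mem_univ j))

/-- Maximal inequality over the `2k` signed coordinates. The parameter `l` stays free so that the
bound can be combined with others before optimising. -/
theorem integral_le_sqrt_of_coord {Ω : Type*} [MeasurableSpace Ω] {P : Measure Ω}
    [IsProbabilityMeasure P] {k : ℕ} (hk : 1 ≤ k) {S : Ω → Fin k → ℝ}
    (hS : ∀ j, Measurable fun ω => S ω j) {R : Ω → ℝ} (hR : Integrable R P)
    (h : ∀ ω C, 0 ≤ C → (∀ j, |S ω j| ≤ C) → R ω ≤ C) {v : ℝ}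
    (hm : ∀ (l : ℝ) (j : Fin k),
      ∫⁻ ω, ENNReal.ofReal (Real.exp (l * S ω j)) ∂P ≤ ENNReal.ofReal (Real.exp (v * l ^ 2 / 2)))
    {l : ℝ} (hl : 0 < l) : l * ∫ ω, R ω ∂P ≤ Real.log (2 * k) + v * l ^ 2 / 2 := by
  have hk0 : (0 : ℝ) < k := by exact_mod_cast hk
  have h₁ : ∫⁻ ω, ENNReal.ofReal (Real.exp (l * R ω)) ∂P ≤
      ENNReal.ofReal (2 * k * Real.exp (v * l ^ 2 / 2)) := by
    have h₂ : ∀ ω, ENNReal.ofReal (Real.exp (l * R ω)) ≤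
        ∑ j, (ENNReal.ofReal (Real.exp (l * S ω j)) + ENNReal.ofReal (Real.exp (-l * S ω j))) := by
      intro ω
      simp_rw [← ENNReal.ofReal_add (Real.exp_pos _).le (Real.exp_pos _).le]
      rw [← ENNReal.ofReal_sum_of_nonneg
        fun _ _ => (add_pos (Real.exp_pos _) (Real.exp_pos _)).le]
      refine ENNReal.ofReal_le_ofReal (exp_mul_le_sum_of_le_abs hl.le hk fun C hC => h ω C ?_ hC)
      exact (abs_nonneg _).trans (hC ⟨0, hk⟩)
    refine (lintegral_mono h₂).trans ?_
    rw [lintegral_finsetSum _ fun j _ => by have := hS j; fun_prop]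
    calc _ ≤ ∑ j : Fin k, (ENNReal.ofReal (Real.exp (v * l ^ 2 / 2)) +
          ENNReal.ofReal (Real.exp (v * l ^ 2 / 2))) := by
          refine Finset.sum_le_sum fun j _ => ?_
          rw [lintegral_add_left (by have := hS j; fun_prop)]
          have := hm (-l) j
          rw [neg_sq] at this
          exact add_le_add (hm l j) this
      _ = _ := by
          rw [← ENNReal.ofReal_add (Real.exp_pos _).le (Real.exp_pos _).le,
            ← ENNReal.ofReal_sum_of_nonneg fun _ _ => (add_pos (Real.exp_pos _) (Real.exp_pos _)).le]
          congr 1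
          simp
          ring
  refine (mul_integral_le_log hR (by positivity) h₁).trans (le_of_eq ?_)
  rw [Real.log_mul (by positivity) (by positivity), Real.log_exp]

end coordinates

theorem abs_sub_le_of_mem_l1Ball {k : ℕ} {f : Euc k → ℝ} (hf : f ∈ l1Ball k) {x y : Euc k} {C : ℝ}
    (hC : 0 ≤ C) (h : ∀ j, |x j - y j| ≤ C) : |f x - f y| ≤ C := by
  obtain ⟨v, hv, rfl⟩ := hf
  rw [← Finset.sum_sub_distrib]
  simp_rw [← mul_sub]
  exact abs_sum_mul_le hv h hC

theorem radSup_l1Ball_le {k : ℕ} {ι : Type*} [Fintype ι] (z : ι → Euc k) (ε : ι → ℤˣ) {C : ℝ}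
    (hC : 0 ≤ C) (h : ∀ j, |∑ i, ((ε i : ℤ) : ℝ) * z i j| ≤ C) :
    radSup (l1Ball k) id z ε ≤ C := by
  refine radSup_le hC ?_
  rintro _ ⟨v, hv, rfl⟩
  have : (signSum ε fun i => id (∑ j, v j * z i j)) =
      ∑ j, v j * ∑ i, ((ε i : ℤ) : ℝ) * z i j := by
    simp only [signSum, id, Finset.mul_sum]
    rw [Finset.sum_comm]
    exact Finset.sum_congr rfl fun j _ => Finset.sum_congr rfl fun i _ => by ring
  rw [this]
  exact abs_sum_mul_le hv h hC

section l1

variable {k : ℕ} {Γ : ℝ} {u : Euc k} {μ : Measure (Euc k)}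

theorem SubG.mgf_coord_sum (h : SubG Γ u μ) {ι : Type*} [Fintype ι] {ε : ι → ℝ}
    (hε : ∀ i, |ε i| = 1) (l : ℝ) (j : Fin k) :
    ∫⁻ x, ENNReal.ofReal (Real.exp (l * ∑ i, ε i * x i j)) ∂(Measure.pi fun _ : ι => μ) ≤
      ENNReal.ofReal (Real.exp (l * u j * (∑ i, ε i) + Fintype.card ι * Γ ^ 2 * l ^ 2 / 2)) := by
  have := h.mgf_sum hε (EuclideanSpace.single j l)
  simp only [EuclideanSpace.inner_single_left, PiLp.norm_single, Real.norm_eq_abs,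
    sq_abs, conj_trivial] at this
  convert this using 4 with x
  · simp
  · ring
  · ring

theorem integral_euc_apply (hμ : Integrable (fun x : Euc k => x) μ) (j : Fin k) :
    ∫ x : Euc k, x j ∂μ = (∫ x, x ∂μ) j :=
  (EuclideanSpace.proj j : Euc k →L[ℝ] ℝ).integral_comp_comm hμ

theorem integrable_euc_apply (hμ : Integrable (fun x : Euc k => x) μ) (j : Fin k) :
    Integrable (fun x : Euc k => x j) μ :=
  (EuclideanSpace.proj j : Euc k →L[ℝ] ℝ).integrable_comp hμ

/-- For linear functionals the deviation is governed by the largest coordinate of the centred sum,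
so the mean drops out and no symmetrization is needed. -/
theorem SubG.mul_meanDev_l1Ball_le (h : SubG Γ u μ) (hk : 1 ≤ k) (n : ℕ) {l : ℝ} (hl : 0 < l) :
    l * meanDev (l1Ball k) μ n ≤ Real.log (2 * k) + n * Γ ^ 2 * l ^ 2 / 2 := by
  have := h.prob
  refine integral_le_sqrt_of_coord hk (S := fun z j => ∑ i, z i j - n * u j) (fun j => by fun_prop)
    ((lipClass_l1Ball k).integrable_empDev h.integrable n) (fun z C hC0 hC => ?_)
    (fun l j => ?_) hl
  · refine supAbs_le hC0 ?_
    rintro _ ⟨v, hv, rfl⟩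
    have e : ∑ i, ∑ j, v j * z i j - n * ∫ y : Euc k, ∑ j, v j * y j ∂μ =
        ∑ j, v j * (∑ i, z i j - n * u j) := by
      rw [integral_finsetSum _ fun j _ => (integrable_euc_apply h.integrable j).const_mul _]
      simp_rw [integral_const_mul, integral_euc_apply h.integrable, h.mean, mul_sub,
        Finset.sum_sub_distrib, Finset.mul_sum]
      rw [Finset.sum_comm]
      congr 1
      exact Finset.sum_congr rfl fun j _ => by ring
    dsimp only
    rw [e]
    exact abs_sum_mul_le hv hC hC0
  · have h₁ := h.mgf_coord_sum (ι := Fin n) (ε := fun _ => 1) (by simp) l j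
    have e : ∀ z : Fin n → Euc k, ENNReal.ofReal (Real.exp (l * (∑ i, z i j - n * u j))) =
        ENNReal.ofReal (Real.exp (-(l * u j * n))) *
          ENNReal.ofReal (Real.exp (l * ∑ i, (1 : ℝ) * z i j)) := by
      intro z
      rw [← ENNReal.ofReal_mul (Real.exp_pos _).le, ← Real.exp_add]
      simp only [one_mul]
      ring_nf
    rw [lintegral_congr e, lintegral_const_mul' _ _ ENNReal.ofReal_ne_top]
    refine (mul_le_mul_right h₁ _).trans (le_of_eq ?_)
    rw [← ENNReal.ofReal_mul (Real.exp_pos _).le, ← Real.exp_add]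
    simp

theorem SubG.meanDev_l1Ball_le (h : SubG Γ u μ) (hk : 1 ≤ k) {n : ℕ} (hn : 1 ≤ n) :
    meanDev (l1Ball k) μ n ≤ 2 * Γ * Real.sqrt (2 * Real.log 2 + 2 * Real.log k) * Real.sqrt n := by
  have hΓ := h.pos
  have hn0 : (0 : ℝ) < n := by exact_mod_cast hn
  have hk1 : (1 : ℝ) ≤ k := by exact_mod_cast hk
  have h1 := le_sqrt_of_forall_mul_le (Real.log_pos (by linarith : (1 : ℝ) < 2 * k)) (by positivity)
    fun l hl => h.mul_meanDev_l1Ball_le hk n hl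
  have e : Real.log (2 * k) = Real.log 2 + Real.log k := Real.log_mul two_ne_zero (by positivity)
  have e₂ : 2 * Real.log (2 * k) * (n * Γ ^ 2) = (2 * Real.log 2 + 2 * Real.log k) * n * Γ ^ 2 := by
    rw [e]; ring
  have h0 : 0 ≤ 2 * Real.log 2 + 2 * Real.log k := by
    have := Real.log_nonneg hk1
    have := Real.log_pos one_lt_two
    linarith
  rw [e₂, Real.sqrt_mul (by positivity), Real.sqrt_mul h0, Real.sqrt_sq hΓ.le] at h1
  have : 0 ≤ Real.sqrt (2 * Real.log 2 + 2 * Real.log k) * Real.sqrt n * Γ := by positivity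
  linarith

/-- The bound that ignores averaging. -/
theorem SubG.meanDev_hullClass_l1Ball_le_mul (h : SubG Γ u μ) (hk : 1 ≤ k) {n : ℕ} (hn : 1 ≤ n)
    {τ : ℕ → ℝ → ℝ} (hτ : ∀ t, IsContr (τ t)) (t : ℕ) :
    meanDev (_root_.hullClass (l1Ball k) τ t) μ n ≤ n * (2 * Γ * Real.sqrt (Real.log (2 * k))) := by
  have := h.prob
  have hΓ := h.pos
  have hk1 : (1 : ℝ) ≤ k := by exact_mod_cast hk
  have hT := (lipClass_l1Ball k).hullClass hτ t
  -- Reduce to one sample point, compared with one independent copy. Hull functions are 1-Lipschitz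
  -- for the sup norm, and each coordinate difference has variance proxy `2 Γ²`.
  have h₁ := hT.mul_meanDev_le h.integrable hn
  rw [Nat.cast_one, one_mul] at h₁
  refine h₁.trans (mul_le_mul_of_nonneg_left ?_ n.cast_nonneg)
  have hpq : Function.Injective (Sum.elim (fun _ : Fin 1 => (0 : Fin 2)) (fun _ : Fin 1 => 1)) := by
    decide
  refine (hT.meanDev_le_integral_sup_sub h.integrable hpq).trans ?_
  have h₂ := le_sqrt_of_forall_mul_le (Real.log_pos (by linarith : (1 : ℝ) < 2 * k))
    (B := 2 * Γ ^ 2) (by positivity) fun l hl =>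
    integral_le_sqrt_of_coord (P := Measure.pi fun _ : Fin 2 => μ) hk
      (S := fun z j => ∑ i, (![1, -1] : Fin 2 → ℝ) i * z i j) (fun j => by fun_prop)
      (R := fun z => supAbs (_root_.hullClass (l1Ball k) τ t)
        fun f => ∑ k : Fin 1, (f (z 0) - f (z 1))) ?_ (fun z C hC0 hC => ?_) (fun l j => ?_) hl
  · refine h₂.trans (le_of_eq ?_)
    rw [show 2 * Real.log (2 * k) * (2 * Γ ^ 2) = (2 * Γ) ^ 2 * Real.log (2 * k) by ring,
      Real.sqrt_mul (by positivity), Real.sqrt_sq (by positivity)]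
  · have h₃ := hT.integrable_coefSup h.integrable (c := (![1, -1] : Fin 2 → ℝ)) fun i => by
      fin_cases i <;> simp
    refine h₃.congr (.of_forall fun z => ?_)
    simp [coefSup, sub_eq_add_neg]
  · refine supAbs_le hC0 fun f hf => ?_
    have : |f (z 0) - f (z 1)| ≤ C := by
      refine hullClass_abs_sub_le hτ hC0 (fun g hg => abs_sub_le_of_mem_l1Ball hg hC0 fun j => ?_) t
        f hf
      simpa [sub_eq_add_neg] using hC j
    simpa using this
  · have h₃ := h.mgf_coord_sum (ι := Fin 2) (ε := ![1, -1]) (by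
      intro i; fin_cases i <;> simp) l j
    simpa using h₃

theorem exp_mul_one_add_le {x a : ℝ} (ha : 0 ≤ a) (ha' : a ≤ 1) :
    Real.exp (x / 2) * Real.exp (x * a / 2) ≤ Real.exp (x / 2) + a * (Real.exp x - Real.exp (x / 2)) := by
  have h := convexOn_exp.2 (Set.mem_univ (x / 2)) (Set.mem_univ x) (sub_nonneg.2 ha') ha (by ring)
  simp only [smul_eq_mul] at h
  rw [← Real.exp_add]
  calc _ = Real.exp ((1 - a) * (x / 2) + a * x) := by ring_nf
    _ ≤ _ := h
    _ = _ := by ring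

/-- Averaging over signs turns the mean into extra variance: coordinate `j` gets the exponent `x (1
+ a j) / 2` with `a j = u j ^ 2 / Γ ^ 2`. Since the `a j` sum to at most 1, convexity makes it worst
to put the whole mean in one coordinate, hence a single `exp x` and `k - 1` copies of `exp (x / 2)`.
-/
theorem SubG.sum_lintegral_coord_le (h : SubG Γ u μ) (n : ℕ) (l : ℝ) :
    ∑ ε : Fin n → ℤˣ, ∫⁻ z, ENNReal.ofReal (∑ j, (Real.exp (l * ∑ i, ((ε i : ℤ) : ℝ) * z i j) +
        Real.exp (-l * ∑ i, ((ε i : ℤ) : ℝ) * z i j))) ∂(Measure.pi fun _ : Fin n => μ) ≤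
      ENNReal.ofReal (2 ^ n * (2 * ((k - 1) * Real.exp (l ^ 2 * n * Γ ^ 2 / 2) +
        Real.exp (l ^ 2 * n * Γ ^ 2)))) := by
  have := h.prob
  have hΓ := h.pos
  set x := l ^ 2 * n * Γ ^ 2 with hx
  have key : ∀ ε : Fin n → ℤˣ,
      ∫⁻ z, ENNReal.ofReal (∑ j, (Real.exp (l * ∑ i, ((ε i : ℤ) : ℝ) * z i j) +
        Real.exp (-l * ∑ i, ((ε i : ℤ) : ℝ) * z i j))) ∂(Measure.pi fun _ : Fin n => μ) ≤
      ENNReal.ofReal (∑ j, (Real.exp (l * u j * ∑ i, ((ε i : ℤ) : ℝ)) +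
        Real.exp (-l * u j * ∑ i, ((ε i : ℤ) : ℝ))) * Real.exp (x / 2)) := by
    intro ε
    simp_rw [ENNReal.ofReal_sum_of_nonneg
      fun _ _ => (add_pos (Real.exp_pos _) (Real.exp_pos _)).le]
    rw [lintegral_finsetSum _ fun j _ => by fun_prop, ENNReal.ofReal_sum_of_nonneg
      fun _ _ => by positivity]
    refine Finset.sum_le_sum fun j _ => ?_
    simp_rw [ENNReal.ofReal_add (Real.exp_pos _).le (Real.exp_pos _).le]
    rw [lintegral_add_left (by fun_prop), add_mul,
      ENNReal.ofReal_add (by positivity) (by positivity)]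
    have h₁ := h.mgf_coord_sum (fun i => abs_sign (ε i)) l j
    have h₂ := h.mgf_coord_sum (fun i => abs_sign (ε i)) (-l) j
    rw [Fintype.card_fin, Real.exp_add] at h₁ h₂
    refine add_le_add (h₁.trans (le_of_eq ?_)) (h₂.trans (le_of_eq ?_)) <;>
      · rw [hx]
        congr 3
        ring
  refine (Finset.sum_le_sum fun ε _ => key ε).trans ?_
  rw [← ENNReal.ofReal_sum_of_nonneg
    fun _ _ => Finset.sum_nonneg fun _ _ => by positivity]
  refine ENNReal.ofReal_le_ofReal ?_
  rw [Finset.sum_comm]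
  have hΓ2 : 0 < Γ ^ 2 := by positivity
  have hu : ∑ j, u j ^ 2 ≤ Γ ^ 2 := by
    have : ‖u‖ ^ 2 ≤ Γ ^ 2 := by gcongr; exact h.mean_le
    rwa [EuclideanSpace.real_norm_sq_eq] at this
  have h₁ : ∀ j, ∑ ε : Fin n → ℤˣ, (Real.exp (l * u j * ∑ i, ((ε i : ℤ) : ℝ)) +
        Real.exp (-l * u j * ∑ i, ((ε i : ℤ) : ℝ))) * Real.exp (x / 2) ≤
      2 ^ n * 2 * (Real.exp (x / 2) + u j ^ 2 / Γ ^ 2 * (Real.exp x - Real.exp (x / 2))) := by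
    intro j
    rw [← Finset.sum_mul, Finset.sum_add_distrib]
    have h₂ := sum_sign_exp_mul_sum_le n (l * u j)
    have h₃ := sum_sign_exp_mul_sum_le n (-l * u j)
    have hle : u j ^ 2 / Γ ^ 2 ≤ 1 := (div_le_one hΓ2).2
      ((Finset.single_le_sum (f := fun j => u j ^ 2) (fun _ _ => sq_nonneg _)
        (Finset.mem_univ j)).trans hu)
    have h₄ := exp_mul_one_add_le (x := x) (a := u j ^ 2 / Γ ^ 2) (by positivity) hle
    have e : x * (u j ^ 2 / Γ ^ 2) / 2 = n * ((l * u j) ^ 2 / 2) := by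
      rw [hx]; field_simp
    have e' : ((-l * u j) ^ 2 : ℝ) = (l * u j) ^ 2 := by ring
    rw [e] at h₄
    rw [e'] at h₃
    calc _ ≤ (2 ^ n * Real.exp (n * ((l * u j) ^ 2 / 2)) +
          2 ^ n * Real.exp (n * ((l * u j) ^ 2 / 2))) * Real.exp (x / 2) := by gcongr
      _ = 2 ^ n * 2 * (Real.exp (x / 2) * Real.exp (n * ((l * u j) ^ 2 / 2))) := by ring
      _ ≤ _ := by gcongr
  refine (Finset.sum_le_sum fun j _ => h₁ j).trans ?_
  rw [← Finset.mul_sum, Finset.sum_add_distrib, ← Finset.sum_mul, ← Finset.sum_div, mul_assoc]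
  have h₂ : (∑ j, u j ^ 2) / Γ ^ 2 ≤ 1 := (div_le_one hΓ2).2 hu
  have h₃ : 0 ≤ Real.exp x - Real.exp (x / 2) := sub_nonneg.2 (Real.exp_le_exp.2 (by
    have : 0 ≤ x := by positivity
    linarith))
  have h₄ := mul_le_mul_of_nonneg_right h₂ h₃
  simp only [Finset.sum_const, Finset.card_univ, Fintype.card_fin, nsmul_eq_mul]
  refine mul_le_mul_of_nonneg_left (mul_le_mul_of_nonneg_left ?_ zero_le_two) (by positivity)
  linarith

end l1

/-! ### Layer recursion for monotone activations -/

/-- The class `{φ ∘ f : f ∈ T}`. -/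
def compClass {E : Type*} (φ : ℝ → ℝ) (T : Set (E → ℝ)) : Set (E → ℝ) :=
  {g | ∃ f ∈ T, g = fun x => φ (f x)}

section compClass

variable {E : Type*} {T : Set (E → ℝ)} {φ : ℝ → ℝ}

theorem radSup_compClass_le {ι : Type*} [Fintype ι] (hT : PtBdd T) (hφ : IsContr φ) (z : ι → E)
    (ε : ι → ℤˣ) : radSup (compClass φ T) id z ε ≤ radSup T φ z ε := by
  refine radSup_le (radSup_nonneg _ _) ?_
  rintro _ ⟨f, hf, rfl⟩
  exact le_radSup hT hφ z ε hf

theorem LipClass.compClass [NormedAddCommGroup E] (hT : LipClass T) (hφ : IsContr φ) :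
    LipClass (compClass φ T) where
  nonempty := hT.nonempty.elim fun f hf => ⟨_, f, hf, rfl⟩
  lip := by
    rintro _ ⟨f, hf, rfl⟩ x y
    exact (hφ.lip _ _).trans (hT.lip f hf x y)
  zero := by
    rintro _ ⟨f, hf, rfl⟩
    simp [hT.zero f hf, hφ.zero]

end compClass

section recursion

variable {E : Type*} [NormedAddCommGroup E] [MeasurableSpace E] [BorelSpace E] {μ : Measure E}

theorem LipClass.abs_dev_le_empDev {T : Set (E → ℝ)} (hT : LipClass T)
    (hμ : Integrable (fun x : E => x) μ) {r : ℕ} (x : Fin r → E) {f : E → ℝ} (hf : f ∈ T) :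
    |∑ i, f (x i) - r * ∫ y, f y ∂μ| ≤ empDev T μ r x := by
  refine le_supAbs (A := fun f : E → ℝ => ∑ i, f (x i) - r * ∫ y, f y ∂μ) ?_ hf
  simpa using hT.bdd_dev hμ (fun _ : Fin r => (1 : ℝ)) (r : ℝ) x

/-- Write each `τ ∘ g` as `(g + ψ ∘ g) / 2` and use linearity of the deviation. Only the `ψ` half
will be symmetrized; the other half stays centred. -/
theorem LipClass.empDev_hullClass_succ_le {B : Set (E → ℝ)} (hB : LipClass B)
    (hμ : Integrable (fun x : E => x) μ) {τ : ℕ → ℝ → ℝ} (hτ : ∀ t, IsContr (τ t))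
    (hm : ∀ t, Monotone (τ t)) (t r : ℕ) (x : Fin r → E) :
    empDev (_root_.hullClass B τ (t + 1)) μ r x ≤ empDev (_root_.hullClass B τ t) μ r x / 2 +
      empDev (_root_.compClass (fun y => 2 * τ (t + 1) y - y) (_root_.hullClass B τ t)) μ r x / 2 := by
  have hT := hB.hullClass hτ t
  have hψ := (hτ (t + 1)).two_mul_sub (hm (t + 1))
  have hC := hT.compClass hψ
  have h0 : 0 ≤ empDev (_root_.hullClass B τ t) μ r x := supAbs_nonneg
  have h0' : 0 ≤ empDev (_root_.compClass (fun y => 2 * τ (t + 1) y - y)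
    (_root_.hullClass B τ t)) μ r x := supAbs_nonneg
  refine supAbs_le (by positivity) ?_
  rintro _ ⟨p, c, g, hc, hg, rfl⟩
  have hi : ∀ j, Integrable (fun y => τ (t + 1) (g j y)) μ := fun j =>
    (hT.compClass (hτ (t + 1))).integrable hμ ⟨g j, hg j, rfl⟩
  have e : ∑ i, ∑ j, c j * τ (t + 1) (g j (x i)) - r * ∫ y, ∑ j, c j * τ (t + 1) (g j y) ∂μ =
      ∑ j, c j * (∑ i, τ (t + 1) (g j (x i)) - r * ∫ y, τ (t + 1) (g j y) ∂μ) := by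
    rw [integral_finsetSum _ fun j _ => (hi j).const_mul _]
    simp_rw [integral_const_mul, mul_sub, Finset.sum_sub_distrib, Finset.mul_sum]
    rw [Finset.sum_comm]
    congr 1
    exact Finset.sum_congr rfl fun j _ => by ring
  dsimp only
  rw [e]
  refine abs_sum_mul_le hc (fun j => ?_) (by positivity)
  have h₁ := hT.abs_dev_le_empDev hμ x (hg j)
  have h₂ := hC.abs_dev_le_empDev hμ x ⟨g j, hg j, rfl⟩
  have e₂ : ∑ i, τ (t + 1) (g j (x i)) - r * ∫ y, τ (t + 1) (g j y) ∂μ =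
      (∑ i, g j (x i) - r * ∫ y, g j y ∂μ) / 2 +
      (∑ i, (2 * τ (t + 1) (g j (x i)) - g j (x i)) -
        r * ∫ y, (2 * τ (t + 1) (g j y) - g j y) ∂μ) / 2 := by
    rw [integral_sub ((hi j).const_mul 2) (hT.integrable hμ (hg j)), integral_const_mul,
      Finset.sum_sub_distrib, ← Finset.mul_sum]
    ring
  rw [e₂]
  refine (abs_add_le _ _).trans ?_
  rw [abs_div, abs_div, abs_two]
  linarith

theorem LipClass.meanDev_hullClass_succ_le [SecondCountableTopology E] [IsProbabilityMeasure μ]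
    {B : Set (E → ℝ)} (hB : LipClass B)
    (hμ : Integrable (fun x : E => x) μ) {τ : ℕ → ℝ → ℝ} (hτ : ∀ t, IsContr (τ t))
    (hm : ∀ t, Monotone (τ t)) (t r : ℕ) :
    meanDev (_root_.hullClass B τ (t + 1)) μ r ≤ meanDev (_root_.hullClass B τ t) μ r / 2 +
      meanDev (_root_.compClass (fun y => 2 * τ (t + 1) y - y) (_root_.hullClass B τ t)) μ r / 2 := by
  have i₁ := ((hB.hullClass hτ t).integrable_empDev hμ r).div_const 2
  have i₂ := (((hB.hullClass hτ t).compClass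
    ((hτ (t + 1)).two_mul_sub (hm (t + 1)))).integrable_empDev hμ r).div_const 2
  rw [meanDev, meanDev, meanDev, ← integral_div, ← integral_div, ← integral_add i₁ i₂]
  exact integral_mono ((hB.hullClass hτ (t + 1)).integrable_empDev hμ r) (i₁.add i₂)
    fun x => hB.empDev_hullClass_succ_le hμ hτ hm t r x

end recursion

section l1

variable {k : ℕ} {Γ : ℝ} {u : Euc k} {μ : Measure (Euc k)} {τ : ℕ → ℝ → ℝ}

/-- The exponential moment of the Rademacher complexity of the `ℓ¹` ball, up to a factor `2`. -/
noncomputable def coordMgf (k : ℕ) (x : ℝ) : ℝ := (k - 1) * Real.exp (x / 2) + Real.exp x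

theorem coordMgf_pos {k : ℕ} (hk : 1 ≤ k) (x : ℝ) : 0 < coordMgf k x := by
  have : (1 : ℝ) ≤ k := by exact_mod_cast hk
  exact add_pos_of_nonneg_of_pos (mul_nonneg (by linarith) (Real.exp_pos _).le) (Real.exp_pos _)

/-- The factors are 2 for contracting through `2 τ - id`, √2 for each of the `t` monotone layers,
and 2 for the two signs of a coordinate. -/
theorem SubG.mul_meanRad_compClass_le (h : SubG Γ u μ) (hk : 1 ≤ k) (hτ : ∀ t, IsContr (τ t))
    (hm : ∀ t, Monotone (τ t)) (t n : ℕ) {l : ℝ} (hl : 0 < l) :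
    l * meanRad (compClass (fun y => 2 * τ (t + 1) y - y) (hullClass (l1Ball k) τ t)) μ n ≤
      (2 + t / 2) * Real.log 2 + Real.log (coordMgf k (l ^ 2 * n * Γ ^ 2)) := by
  have := h.prob
  have hB := lipClass_l1Ball k
  have hT := hB.hullClass hτ t
  have hψ := (hτ (t + 1)).two_mul_sub (hm (t + 1))
  have hC := hT.compClass hψ
  have hQ := coordMgf_pos hk (l ^ 2 * n * Γ ^ 2)
  refine (hC.mul_meanRad_le h.integrable (K := 2 * Real.sqrt 2 ^ t)
    (Q := 2 * coordMgf k (l ^ 2 * n * Γ ^ 2)) (by positivity) (by positivity)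
    (b := fun ε z => ∑ j, (Real.exp (l * ∑ i, ((ε i : ℤ) : ℝ) * z i j) +
        Real.exp (-l * ∑ i, ((ε i : ℤ) : ℝ) * z i j)))
    (fun _ _ => Finset.sum_nonneg fun _ _ => by positivity)
    (fun ε => by fun_prop) (fun z => ?_) (h.sum_lintegral_coord_le n l)).trans (le_of_eq ?_)
  · calc _ ≤ ∑ ε, Real.exp (l * radSup (hullClass (l1Ball k) τ t)
          (fun y => 2 * τ (t + 1) y - y) z ε) := by
          gcongr with ε
          exact radSup_compClass_le hT.ptBdd hψ z ε
      _ ≤ 2 * ∑ ε, Real.exp (l * radSup (hullClass (l1Ball k) τ t) id z ε) :=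
          sum_exp_radSup_le_two_mul hT.ptBdd hT.nonempty hψ z hl.le
      _ ≤ 2 * (Real.sqrt 2 ^ t * ∑ ε, Real.exp (l * radSup (l1Ball k) id z ε)) := by
          gcongr
          exact sum_exp_radSup_hullClass_le_of_monotone hτ hm hB.ptBdd hB.nonempty z hl.le t
      _ = 2 * Real.sqrt 2 ^ t * ∑ ε, Real.exp (l * radSup (l1Ball k) id z ε) := by ring
      _ ≤ _ := by
          gcongr with ε
          exact exp_mul_le_sum_of_le_abs hl.le hk fun C hC =>
            radSup_l1Ball_le z ε ((abs_nonneg _).trans (hC ⟨0, hk⟩)) hC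
  · rw [Real.log_mul (by positivity) (by positivity), Real.log_mul (by positivity) (by positivity),
      Real.log_mul (by positivity) (by positivity), Real.log_pow, Real.log_sqrt (by norm_num)]
    ring

/-- Unrolling the halving recursion leaves weight `(1/2) ^ t` on the centred linear class and the
rest on Rademacher terms. The factor `c` accounts for the loss in `LipClass.meanDev_le_meanRad`. -/
theorem SubG.mul_meanDev_hullClass_l1Ball_le (h : SubG Γ u μ) (hk : 1 ≤ k)
    (hτ : ∀ t, IsContr (τ t)) (hm : ∀ t, Monotone (τ t)) {n : ℕ} (hn : 1 ≤ n) {l c : ℝ}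
    (hl : 0 < l) (hc : 0 < c) (hc' : c ≤ (7 * n - 1) / (8 * n)) (t : ℕ) :
    l * (c * meanDev (hullClass (l1Ball k) τ t) μ n) ≤
      (t / 2 + 1 - (1 / 2) ^ t) * Real.log 2 +
      (1 - (1 / 2) ^ t) * Real.log (coordMgf k (l ^ 2 * (2 * n + 2 : ℕ) * Γ ^ 2)) +
      (1 / 2) ^ t * (Real.log (2 * k) + n * Γ ^ 2 * (l * c) ^ 2 / 2) := by
  have := h.prob
  induction t with
  | zero =>
    have := h.mul_meanDev_l1Ball_le hk n (mul_pos hl hc)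
    simpa [hullClass, mul_assoc] using this
  | succ t ih =>
    have hC := ((lipClass_l1Ball k).hullClass hτ t).compClass
      ((hτ (t + 1)).two_mul_sub (hm (t + 1)))
    have h₁ := (lipClass_l1Ball k).meanDev_hullClass_succ_le h.integrable hτ hm t n
    have h₂ := hC.meanDev_le_meanRad h.integrable hn
    have h₃ := h.mul_meanRad_compClass_le hk hτ hm t (2 * n + 2) hl
    have h₄ := mul_le_mul_of_nonneg_left ((mul_le_mul_of_nonneg_right hc'
      (meanDev_nonneg (T := compClass (fun y => 2 * τ (t + 1) y - y) (hullClass (l1Ball k) τ t))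
        (μ := μ) n)).trans h₂) hl.le
    have h₅ := mul_le_mul_of_nonneg_left h₁ (mul_pos hl hc).le
    rw [pow_succ]
    push_cast at *
    linarith

/-- Expected deviation over the layered hull of the `ℓ¹` ball, given the numerical inequality
between the parameters. -/
theorem SubG.meanDev_hullClass_l1Ball_le (h : SubG Γ u μ) (hk : 1 ≤ k)
    (hτ : ∀ t, IsContr (τ t)) (hm : ∀ t, Monotone (τ t)) {n : ℕ} (hn : 1 ≤ n) (t : ℕ) {κ x D : ℝ}
    (hκ : 0 < κ) (hκn : 32 * n * (n + 1) * κ ^ 2 ≤ (7 * n - 1) ^ 2) (hx : 0 < x)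
    (hD : (t / 2 + 1) * Real.log 2 + (1 - (1 / 2) ^ t) * Real.log (coordMgf k x) +
      (1 / 2) ^ t * (Real.log k + κ ^ 2 * x / 8) ≤ κ * Real.sqrt x * D) :
    meanDev (hullClass (l1Ball k) τ t) μ n ≤ 2 * Γ * D * Real.sqrt n := by
  have hΓ := h.pos
  have hn0 : (0 : ℝ) < n := by exact_mod_cast hn
  have hn1 : (1 : ℝ) ≤ n := by exact_mod_cast hn
  have hk0 : (0 : ℝ) < k := by exact_mod_cast hk
  set N : ℝ := ((2 * n + 2 : ℕ) : ℝ) with hN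
  have hN0 : 0 < N := by positivity
  -- These choices turn the argument of `coordMgf` into `x` and give `l c = κ √x / (2 Γ √n)`; the
  -- bound `c ≤ (7n - 1) / (8n)` becomes the hypothesis on `κ`.
  set l := Real.sqrt (x / N) / Γ with hl
  set c := κ * Real.sqrt (N / (4 * n)) with hc
  have hl0 : 0 < l := by positivity
  have hc0 : 0 < c := by positivity
  have hl2 : l ^ 2 * N * Γ ^ 2 = x := by
    rw [hl, div_pow, Real.sq_sqrt (by positivity)]
    field_simp
  have hlc : l * c = κ * Real.sqrt x / (2 * Γ * Real.sqrt n) := by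
    rw [hl, hc, Real.sqrt_div hx.le, Real.sqrt_div hN0.le, Real.sqrt_mul (by norm_num)]
    rw [show Real.sqrt 4 = 2 by rw [show (4 : ℝ) = 2 ^ 2 by norm_num]; simp]
    have := Real.sqrt_pos.2 hN0
    field_simp
  have hlc2 : n * Γ ^ 2 * (l * c) ^ 2 / 2 = κ ^ 2 * x / 8 := by
    rw [hlc, div_pow, mul_pow, mul_pow, mul_pow, Real.sq_sqrt hx.le, Real.sq_sqrt hn0.le]
    field_simp
    norm_num
  have hc' : c ≤ (7 * n - 1) / (8 * n) := by
    refine le_of_sq_le_sq ?_ (div_nonneg (by linarith) (by positivity))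
    rw [hc, mul_pow, Real.sq_sqrt (by positivity), div_pow, hN]
    push_cast
    rw [mul_div_assoc', div_le_div_iff₀ (by positivity) (by positivity)]
    nlinarith
  have key := h.mul_meanDev_hullClass_l1Ball_le hk hτ hm hn hl0 hc0 hc' t
  rw [← hN, hl2, hlc2, Real.log_mul two_ne_zero hk0.ne', ← mul_assoc, hlc] at key
  have h₂ : κ * Real.sqrt x / (2 * Γ * Real.sqrt n) * meanDev (hullClass (l1Ball k) τ t) μ n ≤
      κ * Real.sqrt x * D := by linarith
  have h₃ : 0 < κ * Real.sqrt x := by positivity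
  have h₄ : 0 < 2 * Γ * Real.sqrt n := by positivity
  rw [div_mul_eq_mul_div, div_le_iff₀ h₄, mul_assoc (κ * Real.sqrt x)] at h₂
  have h₅ := le_of_mul_le_mul_left h₂ h₃
  linarith

end l1

/-! ### Concentration of Lipschitz functions of sub-Gaussian samples -/

theorem ofReal_exp_integral_le {Ω : Type*} [MeasurableSpace Ω] {P : Measure Ω}
    [IsProbabilityMeasure P] {f : Ω → ℝ} (hf : Integrable f P) :
    ENNReal.ofReal (Real.exp (∫ ω, f ω ∂P)) ≤ ∫⁻ ω, ENNReal.ofReal (Real.exp (f ω)) ∂P := by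
  by_cases h : ∫⁻ ω, ENNReal.ofReal (Real.exp (f ω)) ∂P = ⊤
  · rw [h]; exact le_top
  have hi : Integrable (fun ω => Real.exp (f ω)) P :=
    ⟨Real.continuous_exp.comp_aestronglyMeasurable hf.aestronglyMeasurable,
      (hasFiniteIntegral_iff_ofReal (.of_forall fun _ => (Real.exp_pos _).le)).2 (lt_top_iff_ne_top.2 h)⟩
  rw [← ofReal_integral_eq_lintegral_ofReal hi (.of_forall fun _ => (Real.exp_pos _).le)]
  refine ENNReal.ofReal_le_ofReal ?_
  exact convexOn_exp.map_integral_le Real.continuous_exp.continuousOn isClosed_univ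
    (.of_forall fun _ => Set.mem_univ _) hf hi

section concentration

variable {k : ℕ} {Γ : ℝ} {u : Euc k} {μ : Measure (Euc k)}

theorem SubG.lintegral_exp_sub_sq_le (h : SubG Γ u μ) {s : ℝ} (hs : 2 * s ^ 2 * Γ ^ 2 < 1) :
    ∫⁻ w, ENNReal.ofReal (Real.exp (s ^ 2 * ‖w.1 - w.2‖ ^ 2 / 2)) ∂(μ.prod μ) ≤
      ENNReal.ofReal ((1 - 2 * s ^ 2 * Γ ^ 2)⁻¹ ^ (k / 2 : ℝ)) := by
  have := h.prob
  have h₁ := lintegral_exp_norm_sq_le (P := μ.prod μ) (S := fun w : Euc k × Euc k => w.1 - w.2)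
    (by fun_prop) (C := 1) (b := 0) (v := 2 * Γ ^ 2) (θ := s) (fun a => by
      have e : ∀ w : Euc k × Euc k, ENNReal.ofReal (Real.exp (inner ℝ a (w.1 - w.2))) =
          ENNReal.ofReal (Real.exp (inner ℝ a w.1)) *
            ENNReal.ofReal (Real.exp (inner ℝ (-a) w.2)) := by
        intro w
        rw [← ENNReal.ofReal_mul (Real.exp_pos _).le, ← Real.exp_add, inner_sub_right,
          inner_neg_left, sub_eq_add_neg]
      rw [lintegral_congr e, lintegral_prod_mul
        (f := fun x => ENNReal.ofReal (Real.exp (inner ℝ a x)))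
        (g := fun x => ENNReal.ofReal (Real.exp (inner ℝ (-a) x))) (by fun_prop) (by fun_prop)]
      refine (mul_le_mul' (h.mgf a) (h.mgf (-a))).trans (le_of_eq ?_)
      rw [← ENNReal.ofReal_mul (Real.exp_pos _).le, ← Real.exp_add, one_mul, inner_neg_left,
        norm_neg, inner_zero_right]
      congr 2
      ring) (by linarith)
  rw [one_mul, finrank_euclideanSpace_fin, ← mul_assoc, mul_comm (s ^ 2) 2] at h₁
  simpa using h₁

/-- With an independent copy `y`, symmetry makes `E exp (l (G x - G y))` the mean of a hyperbolic
cosine, at most `E exp ((l c)² ‖x - y‖² / 2)`, which is finite even for unbounded support. The left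
side factors, and Jensen bounds `E exp (-l G)` below by `exp (-l E G)`. -/
theorem SubG.lintegral_exp_lip_le (h : SubG Γ u μ) {G : Euc k → ℝ} {c : ℝ}
    (hG : ∀ x y, |G x - G y| ≤ c * ‖x - y‖) {l : ℝ} (hs : 2 * (l * c) ^ 2 * Γ ^ 2 < 1) :
    ∫⁻ x, ENNReal.ofReal (Real.exp (l * G x)) ∂μ ≤
      ENNReal.ofReal ((1 - 2 * (l * c) ^ 2 * Γ ^ 2)⁻¹ ^ (k / 2 : ℝ) *
        Real.exp (l * ∫ x, G x ∂μ)) := by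
  have := h.prob
  have hGc : Continuous G := by
    have hS : SumLip (ι := Fin 1) c fun z : Fin 1 → Euc k => G (z 0) := fun z z' => by
      simpa using hG (z 0) (z' 0)
    exact hS.continuous.comp (continuous_pi fun _ : Fin 1 => continuous_id)
  have hGi : Integrable G μ := by
    refine ((integrable_const |G 0|).add (h.integrable.norm.const_mul c)).mono'
      hGc.measurable.aestronglyMeasurable (.of_forall fun x => ?_)
    have h₁ := hG x 0
    have h₂ := abs_sub_abs_le_abs_sub (G x) (G 0)
    rw [sub_zero] at h₁
    rw [Real.norm_eq_abs]
    simp only [Pi.add_apply]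
    linarith
  set B := (1 - 2 * (l * c) ^ 2 * Γ ^ 2)⁻¹ ^ (k / 2 : ℝ) with hB
  have hB0 : 0 ≤ B := Real.rpow_nonneg (inv_nonneg.2 (by linarith)) _
  set I := ∫⁻ w, ENNReal.ofReal (Real.exp (l * (G w.1 - G w.2))) ∂(μ.prod μ) with hI
  have hm : Measurable fun w : Euc k × Euc k => ENNReal.ofReal (Real.exp (l * (G w.1 - G w.2))) := by
    have := hGc.measurable
    fun_prop
  have hswap : ∫⁻ w, ENNReal.ofReal (Real.exp (-(l * (G w.1 - G w.2)))) ∂(μ.prod μ) = I := by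
    rw [hI, ← Measure.measurePreserving_swap.lintegral_comp hm]
    refine lintegral_congr fun w => ?_
    simp only [Prod.fst_swap, Prod.snd_swap]
    ring_nf
  have h₁ : 2 * I ≤ 2 * ENNReal.ofReal B := by
    calc 2 * I = ∫⁻ w, (ENNReal.ofReal (Real.exp (l * (G w.1 - G w.2))) +
          ENNReal.ofReal (Real.exp (-(l * (G w.1 - G w.2))))) ∂(μ.prod μ) := by
          rw [lintegral_add_left hm, hswap, two_mul]
      _ ≤ ∫⁻ w, 2 * ENNReal.ofReal (Real.exp ((l * c) ^ 2 * ‖w.1 - w.2‖ ^ 2 / 2)) ∂(μ.prod μ) := by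
          refine lintegral_mono fun w => ?_
          dsimp only
          have htwo : ∀ y, 2 * ENNReal.ofReal y = ENNReal.ofReal (2 * y) := fun y => by
            rw [ENNReal.ofReal_mul zero_le_two, ENNReal.ofReal_ofNat]
          rw [← ENNReal.ofReal_add (Real.exp_pos _).le (Real.exp_pos _).le, htwo]
          refine ENNReal.ofReal_le_ofReal ?_
          have h₂ := Real.cosh_le_exp_half_sq (l * (G w.1 - G w.2))
          rw [Real.cosh_eq] at h₂
          have h₃ : (l * (G w.1 - G w.2)) ^ 2 / 2 ≤ (l * c) ^ 2 * ‖w.1 - w.2‖ ^ 2 / 2 := by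
            have h₄ := mul_le_mul_of_nonneg_left (hG w.1 w.2) (abs_nonneg l)
            have h₅ := pow_le_pow_left₀ (by positivity) h₄ 2
            rw [mul_pow, sq_abs, sq_abs, mul_pow, mul_pow, sq_abs] at h₅
            linarith
          have h₄ := Real.exp_le_exp.2 h₃
          linarith
      _ ≤ 2 * ENNReal.ofReal B := by
          rw [lintegral_const_mul _ (by fun_prop)]
          exact mul_le_mul_right (h.lintegral_exp_sub_sq_le hs) _
  have h₂ : I ≤ ENNReal.ofReal B :=
    (ENNReal.mul_le_mul_iff_right two_ne_zero ENNReal.ofNat_ne_top).1 h₁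
  have h₃ : I = (∫⁻ x, ENNReal.ofReal (Real.exp (l * G x)) ∂μ) *
      ∫⁻ x, ENNReal.ofReal (Real.exp (-(l * G x))) ∂μ := by
    have := hGc.measurable
    rw [hI, ← lintegral_prod_mul (by fun_prop) (by fun_prop)]
    refine lintegral_congr fun w => ?_
    rw [← ENNReal.ofReal_mul (Real.exp_pos _).le, ← Real.exp_add]
    ring_nf
  have h₄ := ofReal_exp_integral_le (hGi.const_mul l).neg
  simp only [Pi.neg_apply] at h₄
  rw [integral_neg, integral_const_mul] at h₄
  calc ∫⁻ x, ENNReal.ofReal (Real.exp (l * G x)) ∂μ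
      = (∫⁻ x, ENNReal.ofReal (Real.exp (l * G x)) ∂μ) *
        (ENNReal.ofReal (Real.exp (-(l * ∫ x, G x ∂μ))) *
          ENNReal.ofReal (Real.exp (l * ∫ x, G x ∂μ))) := by
        rw [← ENNReal.ofReal_mul (Real.exp_pos _).le, ← Real.exp_add]
        simp
    _ ≤ (∫⁻ x, ENNReal.ofReal (Real.exp (l * G x)) ∂μ) *
        ((∫⁻ x, ENNReal.ofReal (Real.exp (-(l * G x))) ∂μ) *
          ENNReal.ofReal (Real.exp (l * ∫ x, G x ∂μ))) := by gcongr
    _ = I * ENNReal.ofReal (Real.exp (l * ∫ x, G x ∂μ)) := by rw [h₃, mul_assoc]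
    _ ≤ ENNReal.ofReal B * ENNReal.ofReal (Real.exp (l * ∫ x, G x ∂μ)) := by gcongr
    _ = _ := (ENNReal.ofReal_mul hB0).symm

/-- Tensorisation: integrating out the other points keeps the Lipschitz constant in the first one,
so the one-point factor is paid once per point. -/
theorem SubG.lintegral_exp_sumLip_le (h : SubG Γ u μ) {n : ℕ} {g : (Fin n → Euc k) → ℝ} {c : ℝ}
    (hg : SumLip c g) {l : ℝ} (hs : 2 * (l * c) ^ 2 * Γ ^ 2 < 1) :
    ∫⁻ z, ENNReal.ofReal (Real.exp (l * g z)) ∂(Measure.pi fun _ : Fin n => μ) ≤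
      ENNReal.ofReal (((1 - 2 * (l * c) ^ 2 * Γ ^ 2)⁻¹ ^ (k / 2 : ℝ)) ^ n *
        Real.exp (l * ∫ z, g z ∂(Measure.pi fun _ : Fin n => μ))) := by
  have := h.prob
  set B := (1 - 2 * (l * c) ^ 2 * Γ ^ 2)⁻¹ ^ (k / 2 : ℝ) with hB
  have hB0 : 0 ≤ B := Real.rpow_nonneg (inv_nonneg.2 (by linarith)) _
  induction n with
  | zero =>
    have : ∀ z, g z = g 0 := fun z => congrArg g (Subsingleton.elim _ _)
    simp [this]
  | succ n ih =>
    have hmp := (measurePreserving_piFinSuccAbove (fun _ : Fin (n + 1) => μ) 0).symm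
    have hcons : ∀ w : Euc k × (Fin n → Euc k),
        (MeasurableEquiv.piFinSuccAbove (fun _ : Fin (n + 1) => Euc k) 0).symm w =
          Fin.cons w.1 w.2 := fun w => by
      simp [MeasurableEquiv.piFinSuccAbove]
      rfl
    have hgi := hg.integrable h.integrable
    have hgi' : Integrable (fun w : Euc k × (Fin n → Euc k) => g (Fin.cons w.1 w.2))
        (μ.prod (Measure.pi fun _ : Fin n => μ)) := by
      have := hmp.integrable_comp_of_integrable hgi
      refine this.congr (.of_forall fun w => ?_)
      simp only [Function.comp, hcons]
    have hint : ∫ z, g z ∂(Measure.pi fun _ : Fin (n + 1) => μ) =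
        ∫ x, ∫ y, g (Fin.cons x y) ∂(Measure.pi fun _ : Fin n => μ) ∂μ := by
      rw [← hmp.integral_comp (MeasurableEquiv.measurableEmbedding _), ← integral_prod _ hgi']
      simp only [hcons]
    have hslice : ∀ x, SumLip c fun y : Fin n → Euc k => g (Fin.cons x y) := fun x y y' => by
      simpa [Fin.sum_univ_succ] using hg (Fin.cons x y) (Fin.cons x y')
    have hG : ∀ x x', |∫ y, g (Fin.cons x y) ∂(Measure.pi fun _ : Fin n => μ) -
        ∫ y, g (Fin.cons x' y) ∂(Measure.pi fun _ : Fin n => μ)| ≤ c * ‖x - x'‖ := fun x x' => by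
      rw [← integral_sub ((hslice x).integrable h.integrable)
        ((hslice x').integrable h.integrable)]
      refine (Real.norm_eq_abs _).symm.le.trans ((norm_integral_le_of_norm_le
        (integrable_const (c * ‖x - x'‖)) (.of_forall fun y => ?_)).trans (by simp))
      simpa [Fin.sum_univ_succ] using hg (Fin.cons x y) (Fin.cons x' y)
    have hgm : Measurable fun z : Fin (n + 1) → Euc k => ENNReal.ofReal (Real.exp (l * g z)) := by
      have := hg.continuous.measurable
      fun_prop
    rw [← hmp.lintegral_comp hgm, hint]
    simp only [hcons]
    rw [lintegral_prod _ (by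
      have hc : Measurable fun w : Euc k × (Fin n → Euc k) =>
          (Fin.cons w.1 w.2 : Fin (n + 1) → Euc k) := by
        have hf := (MeasurableEquiv.piFinSuccAbove (fun _ : Fin (n + 1) => Euc k) 0).symm.measurable
        rwa [show ⇑(MeasurableEquiv.piFinSuccAbove (fun _ : Fin (n + 1) => Euc k) 0).symm = _ from
          funext hcons] at hf
      exact (hgm.comp hc).aemeasurable)]
    refine (lintegral_mono fun x => ih (hslice x)).trans ?_
    simp_rw [ENNReal.ofReal_mul (pow_nonneg hB0 n)]
    rw [lintegral_const_mul' _ _ ENNReal.ofReal_ne_top]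
    refine (mul_le_mul_right (h.lintegral_exp_lip_le hG hs) _).trans (le_of_eq ?_)
    rw [← hB, ← ENNReal.ofReal_mul (pow_nonneg hB0 n), pow_succ, mul_assoc]

end concentration

/-! ### Deviation of two empirical measures -/

/-- `sup_{f ∈ T} |(E_μ f - E_ν f) - (E_μ̂ f - E_ν̂ f)|` for the empirical measures of two samples. -/
noncomputable def twoDev {E : Type*} [MeasurableSpace E] (T : Set (E → ℝ)) (μ ν : Measure E)
    {n m : ℕ} (w : (Fin n → E) × (Fin m → E)) : ℝ :=
  supAbs T fun f => (∫ x, f x ∂μ - ∫ x, f x ∂ν) - ((∑ i, f (w.1 i)) / n - (∑ j, f (w.2 j)) / m)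

/-- `g` is Lipschitz with constants `a`, `b` in the points of the first and second sample. -/
def SumLip₂ {ι κ E : Type*} [Fintype ι] [Fintype κ] [NormedAddCommGroup E] (a b : ℝ)
    (g : (ι → E) × (κ → E) → ℝ) : Prop :=
  ∀ w w', |g w - g w'| ≤ a * ∑ i, ‖w.1 i - w'.1 i‖ + b * ∑ j, ‖w.2 j - w'.2 j‖

section SumLip₂

variable {ι κ E : Type*} [Fintype ι] [Fintype κ] [NormedAddCommGroup E] {a b : ℝ}
  {g : (ι → E) × (κ → E) → ℝ}

theorem SumLip₂.continuous (hg : SumLip₂ a b g) : Continuous g := by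
  refine continuous_iff_continuousAt.2 fun z => tendsto_iff_dist_tendsto_zero.2 ?_
  have h₀ : Filter.Tendsto (fun w : (ι → E) × (κ → E) =>
      a * ∑ i, ‖w.1 i - z.1 i‖ + b * ∑ j, ‖w.2 j - z.2 j‖) (nhds z) (nhds 0) := by
    have : Continuous fun w : (ι → E) × (κ → E) =>
      a * ∑ i, ‖w.1 i - z.1 i‖ + b * ∑ j, ‖w.2 j - z.2 j‖ := by fun_prop
    simpa using this.tendsto z
  exact squeeze_zero (fun _ => dist_nonneg) (fun w => hg w z) h₀

theorem SumLip₂.right (hg : SumLip₂ a b g) (z : ι → E) : SumLip b fun y => g (z, y) :=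
  fun y y' => by simpa using hg (z, y) (z, y')

theorem SumLip₂.left (hg : SumLip₂ a b g) (y : κ → E) : SumLip a fun z => g (z, y) :=
  fun z z' => by simpa using hg (z, y) (z', y)

variable [MeasurableSpace E] [BorelSpace E] [SecondCountableTopology E] {μ ν : Measure E}
  [IsProbabilityMeasure μ] [IsProbabilityMeasure ν]

theorem SumLip₂.integrable (hg : SumLip₂ a b g) (hμ : Integrable (fun x : E => x) μ)
    (hν : Integrable (fun x : E => x) ν) :
    Integrable g ((Measure.pi fun _ : ι => μ).prod (Measure.pi fun _ : κ => ν)) := by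
  have h₁ : Integrable (fun z : ι → E => |g 0| + a * ∑ i, ‖z i‖) (Measure.pi fun _ : ι => μ) := by
    refine (integrable_const _).add (Integrable.const_mul (integrable_finsetSum _ fun i _ => ?_) _)
    exact (measurePreserving_eval (fun _ : ι => μ) i).integrable_comp_of_integrable hμ.norm
  have h₂ : Integrable (fun z : κ → E => b * ∑ i, ‖z i‖) (Measure.pi fun _ : κ => ν) := by
    refine Integrable.const_mul (integrable_finsetSum _ fun i _ => ?_) _
    exact (measurePreserving_eval (fun _ : κ => ν) i).integrable_comp_of_integrable hν.norm
  refine ((h₁.comp_fst (Measure.pi fun _ : κ => ν)).add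
    (h₂.comp_snd (Measure.pi fun _ : ι => μ))).mono'
    hg.continuous.measurable.aestronglyMeasurable (.of_forall fun w => ?_)
  have h₃ := hg w 0
  have h₄ := abs_sub_abs_le_abs_sub (g w) (g 0)
  simp only [Prod.fst_zero, Prod.snd_zero, Pi.zero_apply, sub_zero] at h₃
  rw [Real.norm_eq_abs]
  simp only [Pi.add_apply]
  linarith

end SumLip₂

section concentration

variable {k : ℕ} {Γ : ℝ} {u u' : Euc k} {μ ν : Measure (Euc k)}

theorem lintegral_exp_sumLip₂_le (hμ : SubG Γ u μ) (hν : SubG Γ u' ν) {n m : ℕ} {a b : ℝ}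
    {g : (Fin n → Euc k) × (Fin m → Euc k) → ℝ} (hg : SumLip₂ a b g) {l : ℝ}
    (hs : 2 * (l * a) ^ 2 * Γ ^ 2 < 1) (hs' : 2 * (l * b) ^ 2 * Γ ^ 2 < 1) :
    ∫⁻ w, ENNReal.ofReal (Real.exp (l * g w)) ∂(sampleLaw μ ν n m) ≤
      ENNReal.ofReal (((1 - 2 * (l * b) ^ 2 * Γ ^ 2)⁻¹ ^ (k / 2 : ℝ)) ^ m *
        (((1 - 2 * (l * a) ^ 2 * Γ ^ 2)⁻¹ ^ (k / 2 : ℝ)) ^ n *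
          Real.exp (l * ∫ w, g w ∂(sampleLaw μ ν n m)))) := by
  have := hμ.prob
  have := hν.prob
  have hi := hg.integrable hμ.integrable hν.integrable
  have hB0 : 0 ≤ (1 - 2 * (l * b) ^ 2 * Γ ^ 2)⁻¹ ^ (k / 2 : ℝ) :=
    Real.rpow_nonneg (inv_nonneg.2 (by linarith)) _
  have hG : SumLip a fun z => ∫ y, g (z, y) ∂(Measure.pi fun _ : Fin m => ν) := fun z z' => by
    rw [← integral_sub ((hg.right z).integrable hν.integrable)
      ((hg.right z').integrable hν.integrable)]
    refine (Real.norm_eq_abs _).symm.le.trans ((norm_integral_le_of_norm_le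
      (integrable_const (a * ∑ i, ‖z i - z' i‖)) (.of_forall fun y => ?_)).trans (by simp))
    exact hg.left y z z'
  have hgm : Measurable fun w => ENNReal.ofReal (Real.exp (l * g w)) := by
    have := hg.continuous.measurable
    fun_prop
  rw [sampleLaw, lintegral_prod _ hgm.aemeasurable, integral_prod _ hi]
  refine (lintegral_mono fun z => hν.lintegral_exp_sumLip_le (hg.right z) hs').trans ?_
  simp_rw [ENNReal.ofReal_mul (pow_nonneg hB0 m)]
  rw [lintegral_const_mul' _ _ ENNReal.ofReal_ne_top]
  exact mul_le_mul_right (hμ.lintegral_exp_sumLip_le hG hs) _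

/-- Since `-log (1 - y) ≤ (1 - y)⁻¹ - 1 ≤ 2 y` on `[0, 1/2]`, the one-point factors can be collected
in an exponent. -/
theorem rpow_inv_pow_le {y : ℝ} (hy : 0 ≤ y) (hy' : y ≤ 1 / 2) (k n : ℕ) :
    ((1 - y)⁻¹ ^ (k / 2 : ℝ)) ^ n ≤ Real.exp (n * k * y) := by
  have h1 : 0 < 1 - y := by linarith
  have h : (1 - y)⁻¹ ≤ Real.exp (2 * y) := by
    rw [← Real.log_le_iff_le_exp (inv_pos.2 h1), Real.log_inv]
    have h₂ := Real.one_sub_inv_le_log_of_pos h1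
    have h₃ : (1 - y)⁻¹ ≤ 1 + 2 * y := by
      rw [inv_le_iff_one_le_mul₀ h1]
      nlinarith
    linarith
  calc ((1 - y)⁻¹ ^ (k / 2 : ℝ)) ^ n ≤ (Real.exp (2 * y) ^ (k / 2 : ℝ)) ^ n := by gcongr
    _ = Real.exp (n * k * y) := by
      rw [← Real.exp_mul, ← Real.exp_nat_mul]
      congr 1
      ring

variable {T : Set (Euc k → ℝ)}

theorem bdd_twoDev (hT : LipClass T) (hμ : Integrable (fun x : Euc k => x) μ)
    (hν : Integrable (fun x : Euc k => x) ν) {n m : ℕ} (w : (Fin n → Euc k) × (Fin m → Euc k)) :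
    ∃ C, ∀ f ∈ T, |(∫ x, f x ∂μ - ∫ x, f x ∂ν) -
      ((∑ i, f (w.1 i)) / n - (∑ j, f (w.2 j)) / m)| ≤ C := by
  obtain ⟨C₁, h₁⟩ := hT.bdd_dev hμ (fun _ : Fin n => 1 / (n : ℝ)) 1 w.1
  obtain ⟨C₂, h₂⟩ := hT.bdd_dev hν (fun _ : Fin m => 1 / (m : ℝ)) 1 w.2
  refine ⟨C₁ + C₂, fun f hf => ?_⟩
  have e : (∫ x, f x ∂μ - ∫ x, f x ∂ν) - ((∑ i, f (w.1 i)) / n - (∑ j, f (w.2 j)) / m) =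
      (∑ j, 1 / (m : ℝ) * f (w.2 j) - 1 * ∫ x, f x ∂ν) -
      (∑ i, 1 / (n : ℝ) * f (w.1 i) - 1 * ∫ x, f x ∂μ) := by
    rw [← Finset.mul_sum, ← Finset.mul_sum]
    ring
  rw [e, add_comm]
  exact (abs_sub _ _).trans (add_le_add (h₂ f hf) (h₁ f hf))

theorem sumLip₂_twoDev (hT : LipClass T) (hμ : Integrable (fun x : Euc k => x) μ)
    (hν : Integrable (fun x : Euc k => x) ν) (n m : ℕ) :
    SumLip₂ (1 / (n : ℝ)) (1 / (m : ℝ))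
      (twoDev T μ ν : (Fin n → Euc k) × (Fin m → Euc k) → ℝ) := by
  intro w w'
  refine abs_supAbs_sub_le (by positivity) (bdd_twoDev hT hμ hν w) (bdd_twoDev hT hμ hν w')
    fun f hf => ?_
  have e : (∫ x, f x ∂μ - ∫ x, f x ∂ν) - ((∑ i, f (w.1 i)) / n - (∑ j, f (w.2 j)) / m) -
      ((∫ x, f x ∂μ - ∫ x, f x ∂ν) - ((∑ i, f (w'.1 i)) / n - (∑ j, f (w'.2 j)) / m)) =
      1 / m * ∑ j, (f (w.2 j) - f (w'.2 j)) - 1 / n * ∑ i, (f (w.1 i) - f (w'.1 i)) := by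
    rw [Finset.sum_sub_distrib, Finset.sum_sub_distrib]
    ring
  rw [e, add_comm]
  refine (abs_sub _ _).trans (add_le_add ?_ ?_) <;>
    · rw [abs_mul, abs_of_nonneg (by positivity)]
      exact mul_le_mul_of_nonneg_left ((Finset.abs_sum_le_sum_abs _ _).trans
        (Finset.sum_le_sum fun i _ => hT.lip f hf _ _)) (by positivity)

theorem integral_twoDev_le (hμ : SubG Γ u μ) (hν : SubG Γ u' ν) (hT : LipClass T) {n m : ℕ}
    (hn : 1 ≤ n) (hm : 1 ≤ m) :
    ∫ w, twoDev T μ ν w ∂(sampleLaw μ ν n m) ≤ meanDev T μ n / n + meanDev T ν m / m := by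
  have := hμ.prob
  have := hν.prob
  have hn0 : (0 : ℝ) < n := by exact_mod_cast hn
  have hm0 : (0 : ℝ) < m := by exact_mod_cast hm
  have i₁ := ((hT.integrable_empDev hμ.integrable n).div_const (n : ℝ)).comp_fst
    (Measure.pi fun _ : Fin m => ν)
  have i₂ := ((hT.integrable_empDev hν.integrable m).div_const (m : ℝ)).comp_snd
    (Measure.pi fun _ : Fin n => μ)
  have h₁ : ∀ w : (Fin n → Euc k) × (Fin m → Euc k),
      twoDev T μ ν w ≤ empDev T μ n w.1 / n + empDev T ν m w.2 / m := by
    intro w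
    have p₁ : 0 ≤ empDev T μ n w.1 := supAbs_nonneg
    have p₂ : 0 ≤ empDev T ν m w.2 := supAbs_nonneg
    refine supAbs_le (by positivity) fun f hf => ?_
    have h₁ := hT.abs_dev_le_empDev hμ.integrable w.1 hf
    have h₂ := hT.abs_dev_le_empDev hν.integrable w.2 hf
    have e : (∫ x, f x ∂μ - ∫ x, f x ∂ν) - ((∑ i, f (w.1 i)) / n - (∑ j, f (w.2 j)) / m) =
        (∑ j, f (w.2 j) - m * ∫ x, f x ∂ν) / m - (∑ i, f (w.1 i) - n * ∫ x, f x ∂μ) / n := by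
      field_simp
      ring
    rw [e, add_comm]
    refine (abs_sub _ _).trans (add_le_add ?_ ?_)
    · rw [abs_div, Nat.abs_cast]; gcongr
    · rw [abs_div, Nat.abs_cast]; gcongr
  refine (integral_mono ((sumLip₂_twoDev hT hμ.integrable hν.integrable n m).integrable
    hμ.integrable hν.integrable) (i₁.add i₂) h₁).trans (le_of_eq ?_)
  rw [integral_add' i₁ i₂]
  rw [integral_fun_fst (fun z => empDev T μ n z / n), integral_fun_snd (fun z => empDev T ν m z / m)]
  simp [integral_div, meanDev]

theorem sampleLaw_twoDev_le (hμ : SubG Γ u μ) (hν : SubG Γ u' ν) (hT : LipClass T) {n m : ℕ}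
    (hn : 1 ≤ n) (hm : 1 ≤ m) {δ D : ℝ} (hδ : 0 < δ) (hδ1 : δ < 1)
    (hsize : 4 * Real.sqrt (Real.log (1 / δ)) ≤
      Real.sqrt (6 * k) * min (n : ℝ) (m : ℝ) * Real.sqrt (1 / m + 1 / n))
    (hDn : meanDev T μ n ≤ 2 * Γ * D * Real.sqrt n)
    (hDm : meanDev T ν m ≤ 2 * Γ * D * Real.sqrt m) :
    ENNReal.ofReal (1 - δ) ≤ sampleLaw μ ν n m {w | twoDev T μ ν w ≤
      2 * Γ * (D + Real.sqrt (2 * k * Real.log (1 / δ))) * (1 / Real.sqrt n + 1 / Real.sqrt m)} := by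
  have := hμ.prob
  have := hν.prob
  have hΓ := hμ.pos
  have hn0 : (0 : ℝ) < n := by exact_mod_cast hn
  have hm0 : (0 : ℝ) < m := by exact_mod_cast hm
  have hprob : IsProbabilityMeasure (sampleLaw μ ν n m) := by
    rw [sampleLaw]; infer_instance
  set ℓ := Real.log (1 / δ) with hℓ
  have hℓ0 : 0 < ℓ := Real.log_pos (by rw [lt_div_iff₀ hδ]; linarith)
  set v : ℝ := 1 / m + 1 / n with hv
  have hv0 : 0 < v := by positivity
  have hk : (0 : ℝ) < k := by
    rcases Nat.eq_zero_or_pos k with rfl | h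
    · have := Real.sqrt_pos.2 hℓ0
      simp at hsize
      linarith
    · exact_mod_cast h
  have hsq : 16 * ℓ ≤ 6 * k * (min (n : ℝ) (m : ℝ)) ^ 2 * v := by
    have h := pow_le_pow_left₀ (by positivity) hsize 2
    rw [mul_pow, mul_pow, mul_pow, Real.sq_sqrt hℓ0.le, Real.sq_sqrt (by positivity),
      Real.sq_sqrt hv0.le] at h
    linarith
  -- This makes the quadratic part `2 k v l² Γ²` of the exponent equal to `ℓ`. The excess `t` over
  -- the mean must then satisfy `l t ≥ 2 ℓ`: one `ℓ` cancels that part, the other yields `δ`.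
  set l := Real.sqrt (ℓ / (2 * k * v)) / Γ with hl
  have hl0 : 0 < l := by positivity
  have hl2 : l ^ 2 * Γ ^ 2 = ℓ / (2 * k * v) := by
    rw [hl, div_pow, Real.sq_sqrt (by positivity)]
    field_simp
  have hmin0 : 0 < min (n : ℝ) (m : ℝ) := lt_min hn0 hm0
  -- The size condition enters here: it bounds this quantity by `6/16 = 3/8`, below the `1/2`
  -- required in `rpow_inv_pow_le`.
  have hsmall : ∀ r : ℝ, min (n : ℝ) (m : ℝ) ≤ r → 2 * (l * (1 / r)) ^ 2 * Γ ^ 2 ≤ 3 / 8 := by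
    intro r hr
    have hr0 : 0 < r := hmin0.trans_le hr
    have h₁ : 2 * (l * (1 / r)) ^ 2 * Γ ^ 2 = ℓ / (k * v * r ^ 2) := by
      calc _ = 2 * (l ^ 2 * Γ ^ 2) / r ^ 2 := by field_simp
        _ = _ := by rw [hl2]; field_simp
    rw [h₁, div_le_iff₀ (by positivity)]
    have h₂ : (min (n : ℝ) (m : ℝ)) ^ 2 ≤ r ^ 2 := by gcongr
    have h₃ : 6 * k * (min (n : ℝ) (m : ℝ)) ^ 2 * v ≤ 6 * k * r ^ 2 * v := by gcongr
    linarith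
  have hyn := hsmall n (min_le_left _ _)
  have hym := hsmall m (min_le_right _ _)
  set M := meanDev T μ n / n + meanDev T ν m / m with hM
  set s := 1 / Real.sqrt n + 1 / Real.sqrt m with hs
  have hs0 : 0 < s := by positivity
  have hMD : M ≤ 2 * Γ * D * s := by
    have e : ∀ (r : ℕ), 1 ≤ r → ∀ y : ℝ, y ≤ 2 * Γ * D * Real.sqrt r →
        y / r ≤ 2 * Γ * D * (1 / Real.sqrt r) := by
      intro r hr y hy
      have hr0 : (0 : ℝ) < r := by exact_mod_cast hr
      rw [div_le_iff₀ hr0]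
      refine hy.trans (le_of_eq ?_)
      have := Real.mul_self_sqrt hr0.le
      have := Real.sqrt_pos.2 hr0
      field_simp
      rw [Real.sq_sqrt hr0.le]
    have h₁ := e n hn _ hDn
    have h₂ := e m hm _ hDm
    rw [hs, mul_add]
    linarith
  set t := 2 * Γ * Real.sqrt (2 * k * ℓ) * s with ht
  have hlt : 2 * ℓ ≤ l * t := by
    have hsv : Real.sqrt v ≤ s := by
      refine Real.sqrt_le_iff.2 ⟨hs0.le, ?_⟩
      rw [hs, add_sq, div_pow, div_pow, Real.sq_sqrt hn0.le, Real.sq_sqrt hm0.le, hv]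
      have : 0 ≤ 2 * (1 / Real.sqrt n) * (1 / Real.sqrt m) := by positivity
      linarith
    have e : l * t = 2 * (Real.sqrt (ℓ / (2 * k * v)) * Real.sqrt (2 * k * ℓ)) * s := by
      rw [hl, ht]; field_simp
    have e₂ : Real.sqrt (ℓ / (2 * k * v)) * Real.sqrt (2 * k * ℓ) = ℓ / Real.sqrt v := by
      rw [← Real.sqrt_mul (by positivity),
        show ℓ / (2 * k * v) * (2 * k * ℓ) = ℓ ^ 2 / v by field_simp,
        Real.sqrt_div (by positivity), Real.sqrt_sq hℓ0.le]
    rw [e, e₂, mul_assoc]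
    refine mul_le_mul_of_nonneg_left ?_ zero_le_two
    rw [div_mul_eq_mul_div, le_div_iff₀ (Real.sqrt_pos.2 hv0)]
    exact mul_le_mul_of_nonneg_left hsv hℓ0.le
  have hexp := lintegral_exp_sumLip₂_le hμ hν
    (sumLip₂_twoDev hT hμ.integrable hν.integrable n m) (l := l) (by linarith) (by linarith)
  have hEM := integral_twoDev_le hμ hν hT hn hm
  have hbound : ∫⁻ w, ENNReal.ofReal (Real.exp (l * twoDev T μ ν w)) ∂(sampleLaw μ ν n m) ≤
      ENNReal.ofReal (Real.exp (ℓ + l * M)) := by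
    refine hexp.trans (ENNReal.ofReal_le_ofReal ?_)
    have hB0 : ∀ y : ℝ, y ≤ 3 / 8 → 0 ≤ ((1 - y)⁻¹ ^ (k / 2 : ℝ)) := fun y hy =>
      Real.rpow_nonneg (inv_nonneg.2 (by linarith)) _
    calc _ ≤ Real.exp (m * k * (2 * (l * (1 / m)) ^ 2 * Γ ^ 2)) *
          (Real.exp (n * k * (2 * (l * (1 / n)) ^ 2 * Γ ^ 2)) * Real.exp (l * M)) := by
          refine mul_le_mul (rpow_inv_pow_le (by positivity) (by linarith) k m)
            (mul_le_mul (rpow_inv_pow_le (by positivity) (by linarith) k n) ?_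
              (Real.exp_pos _).le (Real.exp_pos _).le) ?_ (Real.exp_pos _).le
          · exact Real.exp_le_exp.2 (mul_le_mul_of_nonneg_left hEM hl0.le)
          · exact mul_nonneg (pow_nonneg (hB0 _ hyn) _) (Real.exp_pos _).le
      _ = _ := by
          rw [← Real.exp_add, ← Real.exp_add]
          congr 1
          have e : m * k * (2 * (l * (1 / (m : ℝ))) ^ 2 * Γ ^ 2) +
              n * k * (2 * (l * (1 / (n : ℝ))) ^ 2 * Γ ^ 2) = 2 * k * v * (l ^ 2 * Γ ^ 2) := by
            rw [hv]; field_simp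
          have e' : 2 * k * v * (l ^ 2 * Γ ^ 2) = ℓ := by rw [hl2]; field_simp
          linarith
  have hbad : sampleLaw μ ν n m {w | ¬twoDev T μ ν w ≤ M + t} ≤ ENNReal.ofReal δ := by
    have hgm : Measurable fun w : (Fin n → Euc k) × (Fin m → Euc k) =>
        ENNReal.ofReal (Real.exp (l * twoDev T μ ν w)) := by
      have := (sumLip₂_twoDev hT hμ.integrable hν.integrable n m).continuous.measurable
      fun_prop
    have h₁ := mul_meas_ge_le_lintegral (μ := sampleLaw μ ν n m) hgm
      (ENNReal.ofReal (Real.exp (l * (M + t))))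
    have h₂ : sampleLaw μ ν n m {w | ¬twoDev T μ ν w ≤ M + t} ≤ sampleLaw μ ν n m
        {w | ENNReal.ofReal (Real.exp (l * (M + t))) ≤
          ENNReal.ofReal (Real.exp (l * twoDev T μ ν w))} := by
      refine measure_mono fun w hw => ENNReal.ofReal_le_ofReal (Real.exp_le_exp.2 ?_)
      exact mul_le_mul_of_nonneg_left (not_le.1 hw).le hl0.le
    have h₃ := (mul_le_mul_right h₂ _).trans (h₁.trans hbound)
    have h₄ : ENNReal.ofReal (Real.exp (ℓ + l * M)) ≤
        ENNReal.ofReal (Real.exp (l * (M + t))) * ENNReal.ofReal δ := by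
      rw [← ENNReal.ofReal_mul (Real.exp_pos _).le]
      refine ENNReal.ofReal_le_ofReal ?_
      have e : δ = Real.exp (-ℓ) := by
        rw [hℓ, one_div, Real.log_inv, neg_neg, Real.exp_log hδ]
      rw [e, ← Real.exp_add]
      refine Real.exp_le_exp.2 ?_
      linarith
    exact (ENNReal.mul_le_mul_iff_right (by simpa using Real.exp_pos _) ENNReal.ofReal_ne_top).1
      (h₃.trans h₄)
  have hgood : sampleLaw μ ν n m {w | twoDev T μ ν w ≤ M + t} ≤ sampleLaw μ ν n m {w |
      twoDev T μ ν w ≤ 2 * Γ * (D + Real.sqrt (2 * k * ℓ)) * s} := by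
    refine measure_mono fun w hw => ?_
    have hw' : twoDev T μ ν w ≤ M + t := hw
    have e : 2 * Γ * (D + Real.sqrt (2 * k * ℓ)) * s = 2 * Γ * D * s + t := by rw [ht]; ring
    rw [Set.mem_ofPred_eq, e]
    linarith
  refine le_trans ?_ hgood
  rw [ENNReal.ofReal_sub _ hδ.le, ENNReal.ofReal_one, tsub_le_iff_right]
  calc (1 : ℝ≥0∞) = sampleLaw μ ν n m Set.univ := measure_univ.symm
    _ ≤ sampleLaw μ ν n m ({w | twoDev T μ ν w ≤ M + t} ∪ {w | ¬twoDev T μ ν w ≤ M + t}) :=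
        measure_mono fun w _ => em _
    _ ≤ _ := (measure_union_le _ _).trans (add_le_add le_rfl hbad)

end concentration

/-! ### Networks as elements of scaled hulls -/

/-- The accumulated scale of the first `t` hidden layers. -/
noncomputable def layerScale (M L : ℕ → ℝ) (t : ℕ) : ℝ := ∏ i ∈ Finset.Icc 1 t, (M i * L i)

theorem layerScale_succ (M L : ℕ → ℝ) (t : ℕ) :
    layerScale M L (t + 1) = layerScale M L t * (M (t + 1) * L (t + 1)) :=
  Finset.prod_Icc_succ_top (Nat.le_add_left 1 t) _

open Classical in
/-- The activation of layer `t`, rescaled to a contraction; `d - 1` is the number of hidden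
layers. -/
noncomputable def scaledAct (σ : ℕ → ℝ → ℝ) (M L : ℕ → ℝ) (d t : ℕ) : ℝ → ℝ :=
  -- The identity fills indices outside the network and layers of scale zero, so that every index
  -- carries a monotone contraction; at scale zero the output vanishes, and any contraction
  -- represents it.
  if t ∈ Finset.Icc 1 (d - 1) ∧ 0 < M t * layerScale M L (t - 1) then
    fun y => σ t (M t * layerScale M L (t - 1) * y) / (M t * layerScale M L (t - 1) * L t)
  else id

section scaledAct

variable {σ : ℕ → ℝ → ℝ} {M L : ℕ → ℝ} {d : ℕ}

theorem isContr_scaledAct (hσ : ∀ i ∈ Finset.Icc 1 (d - 1), IsActivation (σ i) (L i))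
    (h0 : ∀ i ∈ Finset.Icc 1 (d - 1), σ i 0 = 0) (t : ℕ) : IsContr (scaledAct σ M L d t) := by
  unfold scaledAct
  split_ifs with h
  · have hL := (hσ t h.1).pos
    refine ⟨fun x y => ?_, by simp [h0 t h.1]⟩
    have h₁ := (hσ t h.1).lipschitz (M t * layerScale M L (t - 1) * x)
      (M t * layerScale M L (t - 1) * y)
    rw [← sub_div, abs_div, abs_of_pos (mul_pos h.2 hL), div_le_iff₀ (mul_pos h.2 hL)]
    rw [← mul_sub, abs_mul, abs_of_pos h.2] at h₁
    linarith
  · exact isContr_id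

theorem monotone_scaledAct (hσ : ∀ i ∈ Finset.Icc 1 (d - 1), IsActivation (σ i) (L i)) (t : ℕ) :
    Monotone (scaledAct σ M L d t) := by
  unfold scaledAct
  split_ifs with h
  · have hL := (hσ t h.1).pos
    intro x y hxy
    have := h.2
    have h₂ := (hσ t h.1).monotone (mul_le_mul_of_nonneg_left hxy h.2.le)
    dsimp only
    gcongr
  · exact monotone_id

theorem scaledAct_apply {t : ℕ} (ht : t + 1 ∈ Finset.Icc 1 (d - 1))
    (hL : 0 < L (t + 1)) (ha : 0 < M (t + 1) * layerScale M L t) (y : ℝ) :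
    σ (t + 1) (M (t + 1) * layerScale M L t * y) =
      layerScale M L (t + 1) * scaledAct σ M L d (t + 1) y := by
  rw [scaledAct, if_pos ⟨ht, by simpa using ha⟩, layerScale_succ, Nat.add_sub_cancel]
  have : layerScale M L t * (M (t + 1) * L (t + 1)) =
    M (t + 1) * layerScale M L t * L (t + 1) := by ring
  rw [this, mul_div_cancel₀ _ (mul_pos ha hL).ne']

theorem layerScale_nonneg (hM : ∀ i ∈ Finset.Icc 1 d, 0 ≤ M i)
    (hσ : ∀ i ∈ Finset.Icc 1 (d - 1), IsActivation (σ i) (L i)) {t : ℕ} (ht : t ≤ d - 1) :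
    0 ≤ layerScale M L t := by
  refine Finset.prod_nonneg fun i hi => ?_
  rw [Finset.mem_Icc] at hi
  exact mul_nonneg (hM i (Finset.mem_Icc.2 ⟨hi.1, by omega⟩))
    (hσ i (Finset.mem_Icc.2 ⟨hi.1, by omega⟩)).pos.le

theorem rowNorm_row_le {p q : ℕ} (A : Matrix (Fin p) (Fin q) ℝ) (r : Fin p) :
    ∑ c, |A r c| ≤ rowNorm A :=
  le_ciSup (f := fun r => ∑ c, |A r c|) (Set.finite_range _).bddAbove r

/-- Networks with bounded row norms lie in a scaled layered hull of the `ℓ¹` ball. -/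
theorem exists_mem_hullClass_l1Ball {N : ℕ → ℕ} (hM : ∀ i ∈ Finset.Icc 1 d, 0 ≤ M i)
    (hσ : ∀ i ∈ Finset.Icc 1 (d - 1), IsActivation (σ i) (L i))
    (h0 : ∀ i ∈ Finset.Icc 1 (d - 1), σ i 0 = 0) (W : Weights N)
    (hW : ∀ i ∈ Finset.Icc 1 (d - 1), rowNorm (W i) ≤ M i) {t : ℕ} (ht : t ≤ d - 1)
    (w : Fin (N (t + 1)) → ℝ) {C : ℝ} (hC : 0 ≤ C) (hw : ∑ j, |w j| ≤ C) :
    ∃ g ∈ hullClass (l1Ball (N 1)) (scaledAct σ M L d) t,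
      ∀ x, ∑ j, w j * hiddenOut N σ W x t j = C * layerScale M L t * g x := by
  have hv : ∃ v : Fin (N (t + 1)) → ℝ, ∑ j, |v j| ≤ 1 ∧ ∀ j, w j = C * v j := by
    rcases hC.eq_or_lt with rfl | hC
    · refine ⟨0, by simp, fun j => ?_⟩
      have h₁ := (Finset.single_le_sum (f := fun j => |w j|) (fun _ _ => abs_nonneg _)
        (Finset.mem_univ j)).trans hw
      simpa using abs_nonpos_iff.1 h₁
    · refine ⟨fun j => w j / C, ?_, fun j => by field_simp⟩
      simp_rw [abs_div, abs_of_pos hC]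
      rw [← Finset.sum_div]
      exact (div_le_one hC).2 hw
  obtain ⟨v, hv, hwv⟩ := hv
  induction t generalizing C with
  | zero =>
    refine ⟨_, ⟨v, hv, rfl⟩, fun x => ?_⟩
    simp only [hwv, hiddenOut, layerScale, mul_assoc]
    simp [Finset.mul_sum]
  | succ t ih =>
    have hmem : t + 1 ∈ Finset.Icc 1 (d - 1) := Finset.mem_Icc.2 ⟨by omega, ht⟩
    have hMt : 0 ≤ M (t + 1) := hM _ (Finset.mem_Icc.2 ⟨by omega, by omega⟩)
    have hrow : ∀ j, ∑ i, |W (t + 1) j i| ≤ M (t + 1) := fun j =>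
      (rowNorm_row_le _ j).trans (hW _ hmem)
    have hrow' : ∀ j, ∃ v : Fin (N (t + 1)) → ℝ, ∑ i, |v i| ≤ 1 ∧
        ∀ i, W (t + 1) j i = M (t + 1) * v i := by
      intro j
      rcases hMt.eq_or_lt with h | h
      · refine ⟨0, by simp, fun i => ?_⟩
        have h₁ := (Finset.single_le_sum (f := fun i => |W (t + 1) j i|) (fun _ _ => abs_nonneg _)
          (Finset.mem_univ i)).trans (hrow j)
        rw [← h] at h₁
        simpa using abs_nonpos_iff.1 h₁
      · refine ⟨fun i => W (t + 1) j i / M (t + 1), ?_, fun i => by field_simp⟩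
        simp_rw [abs_div, abs_of_pos h]
        rw [← Finset.sum_div]
        exact (div_le_one h).2 (hrow j)
    choose v' hv' hWv using hrow'
    have hpre := fun j => ih (by omega) (W (t + 1) j) hMt (hrow j) (v' j) (hv' j) (hWv j)
    choose g hg hgx using hpre
    refine ⟨_, ⟨_, v, g, hv, hg, rfl⟩, fun x => ?_⟩
    rw [Finset.mul_sum]
    refine Finset.sum_congr rfl fun j _ => ?_
    have e : hiddenOut N σ W x (t + 1) j =
        layerScale M L (t + 1) * scaledAct σ M L d (t + 1) (g j x) := by
      have e₁ : hiddenOut N σ W x (t + 1) j = σ (t + 1) (M (t + 1) * layerScale M L t * g j x) := by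
        rw [← hgx j x]
        rfl
      rw [e₁]
      -- A vanishing scale makes the pre-activation 0, and `σ 0 = 0` agrees with the zero factor on
      -- the right.
      rcases (mul_nonneg hMt (layerScale_nonneg hM hσ (by omega : t ≤ d - 1))).eq_or_lt with h | h
      · rw [layerScale_succ, ← h, zero_mul, h0 _ hmem]
        have : layerScale M L t * (M (t + 1) * L (t + 1)) = 0 := by
          rw [← mul_assoc, mul_comm (layerScale M L t), ← h, zero_mul]
        rw [this, zero_mul]
      · exact scaledAct_apply hmem (hσ _ hmem).pos h _
    rw [e, hwv]
    ring

theorem network_mem_hullClass_l1Ball {N : ℕ → ℕ} (hd : 1 ≤ d) (hM : ∀ i ∈ Finset.Icc 1 d, 0 ≤ M i)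
    (hσ : ∀ i ∈ Finset.Icc 1 (d - 1), IsActivation (σ i) (L i))
    (h0 : ∀ i ∈ Finset.Icc 1 (d - 1), σ i 0 = 0) :
    ∀ f ∈ netClassOneInf N σ d M, ∃ g ∈ hullClass (l1Ball (N 1)) (scaledAct σ M L d) (d - 1),
      f = fun x => M d * layerScale M L (d - 1) * g x := by
  rintro _ ⟨W, w, hW, hw, rfl⟩
  obtain ⟨g, hg, h⟩ := exists_mem_hullClass_l1Ball hM hσ h0 W hW le_rfl w
    (hM d (Finset.mem_Icc.2 ⟨hd, le_rfl⟩)) hw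
  exact ⟨g, hg, funext h⟩

theorem exists_unit_smul {p : ℕ} {w : Fin p → ℝ} {C : ℝ} (hC : 0 ≤ C) (hw : l2Norm w ≤ C) :
    ∃ v : Fin p → ℝ, ∑ j, v j ^ 2 ≤ 1 ∧ ∀ j, w j = C * v j := by
  have hw2 : ∑ j, w j ^ 2 ≤ C ^ 2 := (Real.sqrt_le_left hC).1 hw
  rcases hC.eq_or_lt with rfl | hC
  · refine ⟨0, by simp, fun j => ?_⟩
    have h₁ := (Finset.single_le_sum (f := fun j => w j ^ 2) (fun _ _ => sq_nonneg _)
      (Finset.mem_univ j)).trans hw2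
    have h₂ : w j ^ 2 = 0 := le_antisymm (by simpa using h₁) (sq_nonneg _)
    simpa using h₂
  · refine ⟨fun j => w j / C, ?_, fun j => by field_simp⟩
    simp_rw [div_pow]
    rw [← Finset.sum_div]
    exact (div_le_one (by positivity)).2 hw2

/-- Networks with bounded Frobenius norms and homogeneous activations lie in a scaled layered hull
of the Euclidean ball. -/
theorem exists_mem_hullClass_l2Ball {N : ℕ → ℕ} (hM : ∀ i ∈ Finset.Icc 1 d, 0 ≤ M i)
    (hσ : ∀ i ∈ Finset.Icc 1 (d - 1), IsActivation (σ i) (L i))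
    (hhom : ∀ i ∈ Finset.Icc 1 (d - 1), ∀ α : ℝ, 0 < α → ∀ x : ℝ, σ i (α * x) = α * σ i x)
    (h0 : ∀ i ∈ Finset.Icc 1 (d - 1), σ i 0 = 0) (W : Weights N)
    (hW : ∀ i ∈ Finset.Icc 1 (d - 1), frobNorm (W i) ≤ M i) {t : ℕ} (ht : t ≤ d - 1)
    (w : Fin (N (t + 1)) → ℝ) {C : ℝ} (hC : 0 ≤ C) (hw : l2Norm w ≤ C) :
    ∃ g ∈ hullClass (l2Ball (N 1)) (scaledAct σ M L d) t,
      ∀ x, ∑ j, w j * hiddenOut N σ W x t j = C * layerScale M L t * g x := by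
  obtain ⟨v, hv, hwv⟩ := exists_unit_smul hC hw
  induction t generalizing C with
  | zero =>
    refine ⟨_, ⟨WithLp.toLp 2 v, ?_, rfl⟩, fun x => ?_⟩
    · rw [EuclideanSpace.norm_eq]
      exact Real.sqrt_le_one.2 (by simpa using hv)
    · simp only [hwv, hiddenOut, layerScale, mul_assoc]
      simp [← Finset.mul_sum, PiLp.inner_apply, mul_comm]
  | succ t ih =>
    have hmem : t + 1 ∈ Finset.Icc 1 (d - 1) := Finset.mem_Icc.2 ⟨by omega, ht⟩
    have hMt : 0 ≤ M (t + 1) := hM _ (Finset.mem_Icc.2 ⟨by omega, by omega⟩)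
    -- Each row is normalised by its own norm rather than by `M (t + 1)`; the ℓ² norm of the vector
    -- of row norms is the Frobenius norm.
    set r : Fin (N (t + 1 + 1)) → ℝ := fun j => l2Norm (W (t + 1) j) with hr
    have hr0 : ∀ j, 0 ≤ r j := fun j => Real.sqrt_nonneg _
    have hrM : l2Norm r ≤ M (t + 1) := by
      refine le_trans (le_of_eq ?_) (hW _ hmem)
      rw [l2Norm, frobNorm]
      congr 1
      exact Finset.sum_congr rfl fun j _ => Real.sq_sqrt (Finset.sum_nonneg fun _ _ => sq_nonneg _)
    obtain ⟨ρ, hρ, hrρ⟩ := exists_unit_smul hMt hrM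
    have hpre : ∀ j, ∃ g ∈ hullClass (l2Ball (N 1)) (scaledAct σ M L d) t,
        ∀ x, ∑ i, W (t + 1) j i * hiddenOut N σ W x t i = r j * layerScale M L t * g x := by
      intro j
      obtain ⟨v', hv', hWv⟩ := exists_unit_smul (hr0 j) (le_refl (l2Norm (W (t + 1) j)))
      exact ih (by omega) (W (t + 1) j) (hr0 j) le_rfl v' hv' hWv
    choose g hg hgx using hpre
    refine ⟨_, ⟨_, fun j => v j * ρ j, g, ?_, hg, rfl⟩, fun x => ?_⟩
    · have h₁ := Finset.sum_mul_sq_le_sq_mul_sq Finset.univ (fun j => |v j|) (fun j => |ρ j|)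
      simp only [sq_abs, ← abs_mul] at h₁
      have h₂ : (∑ j, v j ^ 2) * ∑ j, ρ j ^ 2 ≤ 1 :=
        mul_le_one₀ hv (Finset.sum_nonneg fun _ _ => sq_nonneg _) hρ
      exact (sq_le_one_iff₀ (Finset.sum_nonneg fun _ _ => abs_nonneg _)).1 (h₁.trans h₂)
    rw [Finset.mul_sum]
    refine Finset.sum_congr rfl fun j _ => ?_
    have e : hiddenOut N σ W x (t + 1) j =
        layerScale M L (t + 1) * (ρ j * scaledAct σ M L d (t + 1) (g j x)) := by
      have e₁ : hiddenOut N σ W x (t + 1) j = σ (t + 1) (r j * layerScale M L t * g j x) := by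
        rw [← hgx j x]
        rfl
      rw [e₁, hrρ]
      rcases (mul_nonneg hMt (layerScale_nonneg hM hσ (by omega : t ≤ d - 1))).eq_or_lt with h | h
      · have h' : M (t + 1) * ρ j * layerScale M L t * g j x = 0 := by
          rw [show M (t + 1) * ρ j * layerScale M L t * g j x =
            M (t + 1) * layerScale M L t * (ρ j * g j x) by ring, ← h, zero_mul]
        have : layerScale M L t * (M (t + 1) * L (t + 1)) = 0 := by
          rw [← mul_assoc, mul_comm (layerScale M L t), ← h, zero_mul]
        rw [h', layerScale_succ, h0 _ hmem, this, zero_mul]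
      · have hMpos : 0 < M (t + 1) := hMt.lt_of_ne fun h' => by simp [← h'] at h
        have hρ0 : 0 ≤ ρ j := by
          have := hr0 j
          rw [hrρ] at this
          exact nonneg_of_mul_nonneg_right this hMpos
        have e₂ := scaledAct_apply (σ := σ) hmem (hσ _ hmem).pos h (g j x)
        -- Homogeneity takes `ρ j` out of the activation when it is positive; a zero row is covered
        -- by `σ 0 = 0`.
        rcases hρ0.eq_or_lt with h' | h'
        · simp [← h', h0 _ hmem]
        · rw [mul_left_comm, ← e₂, ← hhom _ hmem _ h']
          congr 1
          ring
    rw [e, hwv]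
    ring

theorem network_mem_hullClass_l2Ball {N : ℕ → ℕ} (hd : 1 ≤ d) (hM : ∀ i ∈ Finset.Icc 1 d, 0 ≤ M i)
    (hσ : ∀ i ∈ Finset.Icc 1 (d - 1), IsActivation (σ i) (L i))
    (hhom : ∀ i ∈ Finset.Icc 1 (d - 1), ∀ α : ℝ, 0 < α → ∀ x : ℝ, σ i (α * x) = α * σ i x)
    (h0 : ∀ i ∈ Finset.Icc 1 (d - 1), σ i 0 = 0) :
    ∀ f ∈ netClassF N σ d M, ∃ g ∈ hullClass (l2Ball (N 1)) (scaledAct σ M L d) (d - 1),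
      f = fun x => M d * layerScale M L (d - 1) * g x := by
  rintro _ ⟨W, w, hW, hw, rfl⟩
  obtain ⟨g, hg, h⟩ := exists_mem_hullClass_l2Ball hM hσ hhom h0 W hW le_rfl w
    (hM d (Finset.mem_Icc.2 ⟨hd, le_rfl⟩)) hw
  exact ⟨g, hg, funext h⟩

theorem mul_layerScale_eq (hd : 1 ≤ d) (M L : ℕ → ℝ) : M d * layerScale M L (d - 1) =
    (∏ i ∈ Finset.Icc 1 d, M i) * ∏ i ∈ Finset.Icc 1 (d - 1), L i := by
  obtain ⟨t, rfl⟩ : ∃ t, d = t + 1 := ⟨d - 1, by omega⟩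
  rw [Nat.add_sub_cancel, Finset.prod_Icc_succ_top (by omega), layerScale, Finset.prod_mul_distrib]
  ring

end scaledAct

/-! ### Distances between measures -/

theorem netDist_eq_supAbs {k : ℕ} (F : Set (Euc k → ℝ)) (μ ν : Measure (Euc k)) :
    netDist F μ ν = supAbs F fun f => ∫ x, f x ∂μ - ∫ x, f x ∂ν := by
  rw [netDist, supAbs, iSup]
  congr 1
  ext r
  constructor
  · rintro ⟨f, hf, rfl⟩; exact ⟨⟨f, hf⟩, rfl⟩
  · rintro ⟨⟨f, hf⟩, rfl⟩; exact ⟨f, hf, rfl⟩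

theorem integral_empMeasure {k n : ℕ} (x : Fin n → Euc k) (f : Euc k → ℝ) :
    ∫ y, f y ∂(empMeasure x) = (∑ i, f (x i)) / n := by
  rw [empMeasure, integral_smul_measure, integral_finsetSum_measure fun i _ =>
    integrable_dirac (by simp)]
  simp [integral_dirac, div_eq_inv_mul]

/-- Suprema over the same class differ by at most the supremum of the differences. Domination by the
Lipschitz class `T` keeps both finite, so the value 0 that `sSup` takes on unbounded sets never
interferes. -/
theorem abs_netDist_sub_le {k : ℕ} {Γ : ℝ} {u u' : Euc k} {μ ν : Measure (Euc k)}
    (hμ : SubG Γ u μ) (hν : SubG Γ u' ν) {F T : Set (Euc k → ℝ)} (hT : LipClass T) {K : ℝ}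
    (hK : 0 ≤ K) (hF : ∀ f ∈ F, ∃ g ∈ T, f = fun x => K * g x) {n m : ℕ}
    (z : (Fin n → Euc k) × (Fin m → Euc k)) :
    |netDist F μ ν - netDist F (empMeasure z.1) (empMeasure z.2)| ≤ K * twoDev T μ ν z := by
  have hb := bdd_twoDev hT hμ.integrable hν.integrable z
  have hemp : ∀ g ∈ T, ∫ x, K * g x ∂(empMeasure z.1) - ∫ x, K * g x ∂(empMeasure z.2) =
      K * ((∑ i, g (z.1 i)) / n - (∑ j, g (z.2 j)) / m) := fun g hg => by
    rw [integral_const_mul, integral_const_mul, integral_empMeasure,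
      integral_empMeasure, mul_sub]
  have h₁ : ∃ C, ∀ f ∈ F, |∫ x, f x ∂μ - ∫ x, f x ∂ν| ≤ C := by
    refine ⟨K * (∫ x, ‖x‖ ∂μ + ∫ x, ‖x‖ ∂ν), fun f hf => ?_⟩
    obtain ⟨g, hg, rfl⟩ := hF f hf
    rw [integral_const_mul, integral_const_mul, ← mul_sub, abs_mul, abs_of_nonneg hK]
    exact mul_le_mul_of_nonneg_left ((abs_sub _ _).trans (add_le_add
      (hT.abs_integral_le hμ.integrable hg) (hT.abs_integral_le hν.integrable hg))) hK
  have h₂ : ∀ f ∈ F, |(∫ x, f x ∂μ - ∫ x, f x ∂ν) -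
      (∫ x, f x ∂(empMeasure z.1) - ∫ x, f x ∂(empMeasure z.2))| ≤ K * twoDev T μ ν z := by
    intro f hf
    obtain ⟨g, hg, rfl⟩ := hF f hf
    rw [hemp g hg, integral_const_mul, integral_const_mul, ← mul_sub, ← mul_sub, abs_mul,
      abs_of_nonneg hK]
    exact mul_le_mul_of_nonneg_left (le_supAbs (A := fun f : Euc k → ℝ =>
      (∫ x, f x ∂μ - ∫ x, f x ∂ν) - ((∑ i, f (z.1 i)) / n - (∑ j, f (z.2 j)) / m)) hb hg) hK
  rw [netDist_eq_supAbs, netDist_eq_supAbs]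
  refine abs_supAbs_sub_le (mul_nonneg hK supAbs_nonneg) h₁ ?_ h₂
  obtain ⟨C, hC⟩ := h₁
  refine ⟨C + K * twoDev T μ ν z, fun f hf => ?_⟩
  have h₃ := h₂ f hf
  rw [abs_sub_comm] at h₃
  have h₄ := abs_sub_abs_le_abs_sub (∫ x, f x ∂(empMeasure z.1) - ∫ x, f x ∂(empMeasure z.2))
    (∫ x, f x ∂μ - ∫ x, f x ∂ν)
  linarith [hC f hf]

theorem sampleLaw_netDist_le {k : ℕ} {Γ : ℝ} {u u' : Euc k} {μ ν : Measure (Euc k)}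
    (hμ : SubG Γ u μ) (hν : SubG Γ u' ν) {F T : Set (Euc k → ℝ)} (hT : LipClass T) {K : ℝ}
    (hK : 0 ≤ K) (hF : ∀ f ∈ F, ∃ g ∈ T, f = fun x => K * g x) {n m : ℕ}
    (hn : 1 ≤ n) (hm : 1 ≤ m) {δ D : ℝ} (hδ : 0 < δ)
    (hsize : 4 * Real.sqrt (Real.log (1 / δ)) ≤
      Real.sqrt (6 * k) * min (n : ℝ) (m : ℝ) * Real.sqrt (1 / m + 1 / n))
    (hDn : 1 ≤ k → meanDev T μ n ≤ 2 * Γ * D * Real.sqrt n)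
    (hDm : 1 ≤ k → meanDev T ν m ≤ 2 * Γ * D * Real.sqrt m) :
    ENNReal.ofReal (1 - δ) ≤ sampleLaw μ ν n m
      {z | |netDist F μ ν - netDist F (empMeasure z.1) (empMeasure z.2)| ≤
        2 * Γ * K * (D + Real.sqrt (2 * k * Real.log (1 / δ))) *
          (1 / Real.sqrt n + 1 / Real.sqrt m)} := by
  rcases le_or_gt 1 δ with hδ1 | hδ1
  · rw [ENNReal.ofReal_of_nonpos (by linarith)]
    exact zero_le
  have hk : 1 ≤ k := by
    rcases Nat.eq_zero_or_pos k with rfl | h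
    · have : 0 < Real.sqrt (Real.log (1 / δ)) :=
        Real.sqrt_pos.2 (Real.log_pos (by rw [lt_div_iff₀ hδ]; linarith))
      rw [Nat.cast_zero, mul_zero, Real.sqrt_zero, zero_mul, zero_mul] at hsize
      linarith
    · exact h
  refine (sampleLaw_twoDev_le hμ hν hT hn hm hδ hδ1 hsize (hDn hk) (hDm hk)).trans
    (measure_mono fun z hz => ?_)
  have h₁ := abs_netDist_sub_le hμ hν hT hK hF z
  have hz' : twoDev T μ ν z ≤ 2 * Γ * (D + Real.sqrt (2 * k * Real.log (1 / δ))) *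
      (1 / Real.sqrt n + 1 / Real.sqrt m) := hz
  have h₂ := mul_le_mul_of_nonneg_left hz' hK
  rw [Set.mem_ofPred_eq]
  refine h₁.trans (h₂.trans (le_of_eq ?_))
  ring

/-! ### Numerical inequalities -/

/-- Logarithms are measured in units of `log 2`: `L` is that of `k`, `B` bounds that of `coordMgf`,
and `2 ^ Y = exp (x / 2)`. With `q = κ²`, squaring removes the root and leaves an inequality free of
`log 2`. -/
theorem exists_hull_params_of {t k n : ℕ} {q Y B L : ℝ} (hL : Real.log k = L * Real.log 2)
    (hq : 0 < q) (hn : 32 * n * (n + 1) * q ≤ (7 * n - 1 : ℝ) ^ 2) (hY : 0 < Y)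
    (hB : Real.log (coordMgf k (2 * (Y * Real.log 2))) ≤ B * Real.log 2)
    (h : ((t + 2) / 2 + (1 - (1 / 2) ^ t) * B + (1 / 2) ^ t * (L + q * Y / 4)) ^ 2 ≤
      4 * q * Y * (t + 1 + L)) :
    ∃ κ x : ℝ, 0 < κ ∧ 32 * n * (n + 1) * κ ^ 2 ≤ (7 * n - 1) ^ 2 ∧ 0 < x ∧
      (t / 2 + 1) * Real.log 2 + (1 - (1 / 2) ^ t) * Real.log (coordMgf k x) +
        (1 / 2) ^ t * (Real.log k + κ ^ 2 * x / 8) ≤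
      κ * Real.sqrt x * Real.sqrt (2 * (t + 1) * Real.log 2 + 2 * Real.log k) := by
  have hl : 0 < Real.log 2 := Real.log_pos one_lt_two
  have hw : (0 : ℝ) ≤ 1 - (1 / 2) ^ t :=
    sub_nonneg.2 (pow_le_one₀ (by norm_num) (by norm_num))
  refine ⟨Real.sqrt q, 2 * (Y * Real.log 2), Real.sqrt_pos.2 hq, ?_, by positivity, ?_⟩
  · rwa [Real.sq_sqrt hq.le]
  · rw [Real.sq_sqrt hq.le, hL, ← Real.sqrt_mul hq.le, ← Real.sqrt_mul (by positivity)]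
    have hr : q * (2 * (Y * Real.log 2)) * (2 * (t + 1) * Real.log 2 + 2 * (L * Real.log 2)) =
        4 * q * Y * (t + 1 + L) * Real.log 2 ^ 2 := by ring
    rw [hr]
    have hb := mul_le_mul_of_nonneg_left hB hw
    refine le_trans ?_ (Real.le_sqrt_of_sq_le (x := ((t + 2) / 2 + (1 - (1 / 2) ^ t) * B +
      (1 / 2) ^ t * (L + q * Y / 4)) * Real.log 2) ?_)
    · linear_combination hb
    · rw [mul_pow]
      exact mul_le_mul_of_nonneg_right h (sq_nonneg _)

/-- Here `k ≤ 2 ^ Y`, so `(k - 1) 2 ^ Y + 4 ^ Y ≤ 2 * 4 ^ Y`. -/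
theorem log_coordMgf_le_of_le {k : ℕ} {L Y : ℝ} (hk : 1 ≤ k) (hL : Real.log k = L * Real.log 2)
    (h : L ≤ Y) : Real.log (coordMgf k (2 * (Y * Real.log 2))) ≤ (2 * Y + 1) * Real.log 2 := by
  have hl : 0 < Real.log 2 := Real.log_pos one_lt_two
  have hk0 : (0 : ℝ) < k := by exact_mod_cast hk
  have hE : (k : ℝ) ≤ Real.exp (Y * Real.log 2) := by
    rw [← Real.exp_log hk0, hL]
    exact Real.exp_le_exp.2 (mul_le_mul_of_nonneg_right h hl.le)
  rw [Real.log_le_iff_le_exp (coordMgf_pos hk _), coordMgf, add_mul, Real.exp_add, one_mul,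
    Real.exp_log two_pos, mul_div_cancel_left₀ _ two_ne_zero, ← mul_assoc, mul_assoc 2 Y, two_mul,
    Real.exp_add]
  nlinarith [Real.exp_pos (Y * Real.log 2)]

/-- For integral `Y = j` the moment is the integer `(k - 1) 2 ^ j + 4 ^ j`, and comparing integer
powers bounds its binary logarithm by `a / b`. For `k = 2, 3` this is sharper than the general
bound. -/
theorem log_coordMgf_le_of_pow_le {k j a b : ℕ} (hk : 1 ≤ k) (hb : 0 < b)
    (h : ((k - 1) * 2 ^ j + 4 ^ j : ℝ) ^ b ≤ 2 ^ a) :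
    Real.log (coordMgf k (2 * (j * Real.log 2))) ≤ (a / b : ℝ) * Real.log 2 := by
  have hb' : (0 : ℝ) < b := by exact_mod_cast hb
  have he : Real.exp (j * Real.log 2) = 2 ^ j := by
    rw [Real.exp_nat_mul, Real.exp_log two_pos]
  have hc : coordMgf k (2 * (j * Real.log 2)) = (k - 1) * 2 ^ j + 4 ^ j := by
    rw [coordMgf, mul_div_cancel_left₀ _ two_ne_zero, two_mul, Real.exp_add, he, ← mul_pow]
    norm_num
  have hp := coordMgf_pos hk (2 * (j * Real.log 2))
  rw [← hc] at h
  have := Real.log_le_log (by positivity) h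
  rw [Real.log_pow, Real.log_pow] at this
  rw [div_mul_eq_mul_div, le_div_iff₀ hb']
  linarith

theorem nineteen_twelfths_le_log_three : 19 / 12 * Real.log 2 ≤ Real.log 3 := by
  have := Real.log_le_log (x := 2 ^ 19) (y := 3 ^ 12) (by norm_num) (by norm_num)
  rw [Real.log_pow, Real.log_pow] at this
  push_cast at this
  linarith

theorem log_three_le_eight_fifths : Real.log 3 ≤ 8 / 5 * Real.log 2 := by
  have := Real.log_le_log (x := 3 ^ 5) (y := 2 ^ 8) (by norm_num) (by norm_num)
  rw [Real.log_pow, Real.log_pow] at this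
  push_cast at this
  linarith


/-- When `B` also dominates the contribution of the linear class, the combination with weights `1 -
(1/2) ^ t` and `(1/2) ^ t` is at most `B`, and these weights disappear. -/
theorem exists_hull_params_of' {t k n : ℕ} {q Y B L : ℝ} (hL : Real.log k = L * Real.log 2)
    (hL0 : 0 ≤ L) (hq : 0 < q) (hn : 32 * n * (n + 1) * q ≤ (7 * n - 1 : ℝ) ^ 2) (hY : 0 < Y)
    (hB : Real.log (coordMgf k (2 * (Y * Real.log 2))) ≤ B * Real.log 2)
    (hLB : L + q * Y / 4 ≤ B)
    (h : ((t + 2) / 2 + B) ^ 2 ≤ 4 * q * Y * (t + 1 + L)) :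
    ∃ κ x : ℝ, 0 < κ ∧ 32 * n * (n + 1) * κ ^ 2 ≤ (7 * n - 1) ^ 2 ∧ 0 < x ∧
      (t / 2 + 1) * Real.log 2 + (1 - (1 / 2) ^ t) * Real.log (coordMgf k x) +
        (1 / 2) ^ t * (Real.log k + κ ^ 2 * x / 8) ≤
      κ * Real.sqrt x * Real.sqrt (2 * (t + 1) * Real.log 2 + 2 * Real.log k) := by
  refine exists_hull_params_of hL hq hn hY hB (le_trans (pow_le_pow_left₀ ?_ ?_ 2) h)
  · have hw : (0 : ℝ) ≤ 1 - (1 / 2) ^ t :=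
      sub_nonneg.2 (pow_le_one₀ (by norm_num) (by norm_num))
    have hB0 : 0 ≤ B := le_trans (by positivity) hLB
    positivity
  · have := mul_le_mul_of_nonneg_left hLB (by positivity : (0 : ℝ) ≤ (1 / 2) ^ t)
    linarith

theorem exists_hull_params_of_five_le {t k n : ℕ} {L : ℝ} (ht : 5 ≤ t) (hk : 2 ≤ k)
    (hL : Real.log k = L * Real.log 2) (hL0 : 0 ≤ L)
    (hn : 32 * n * (n + 1) * (9 / 8) ≤ (7 * n - 1 : ℝ) ^ 2)
    (hL2 : k = 2 → L = 1) (hL3 : k = 3 → 19 / 12 ≤ L ∧ L ≤ 8 / 5) (hL4 : 4 ≤ k → 2 ≤ L) :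
    ∃ κ x : ℝ, 0 < κ ∧ 32 * n * (n + 1) * κ ^ 2 ≤ (7 * n - 1) ^ 2 ∧ 0 < x ∧
      (t / 2 + 1) * Real.log 2 + (1 - (1 / 2) ^ t) * Real.log (coordMgf k x) +
        (1 / 2) ^ t * (Real.log k + κ ^ 2 * x / 8) ≤
      κ * Real.sqrt x * Real.sqrt (2 * (t + 1) * Real.log 2 + 2 * Real.log k) := by
  have hq0 : (0 : ℝ) < 9 / 8 := by norm_num
  have hk1 : 1 ≤ k := by omega
  have c23 : k = 2 → Real.log (coordMgf k (2 * ((3 : ℕ) * Real.log 2))) ≤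
      ((31 : ℕ) / (5 : ℕ) : ℝ) * Real.log 2 := by
    rintro rfl
    exact log_coordMgf_le_of_pow_le (by norm_num) (by norm_num) (by norm_num)
  have c33 : k = 3 → Real.log (coordMgf k (2 * ((3 : ℕ) * Real.log 2))) ≤
      ((19 : ℕ) / (3 : ℕ) : ℝ) * Real.log 2 := by
    rintro rfl
    exact log_coordMgf_le_of_pow_le (by norm_num) (by norm_num) (by norm_num)
  have ht' : (5 : ℝ) ≤ t := by exact_mod_cast ht
  -- The choice `Y = 9 (t + 1 + L) / 32` makes the right-hand side the square of `9 (t + 1 + L) /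
  -- 8`. It needs `L ≤ Y`, which is this threshold, and `9 L + t + 1 ≥ 24`. Above the threshold `Y =
  -- L` works; below 24 only `k = 2, 3` can occur.
  rcases lt_or_ge (9 * ((t : ℝ) + 1) / 23) L with hLd | hLd
  · refine exists_hull_params_of' hL hL0 hq0 hn (hLd.trans' (by positivity))
      (log_coordMgf_le_of_le hk1 hL le_rfl) (by linarith) ?_
    nlinarith
  rcases lt_or_ge (9 * L + ((t : ℝ) + 1)) 24 with hs | hs
  · rcases (by omega : k = 2 ∨ k = 3 ∨ 4 ≤ k) with h | h | h
    · have := hL2 h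
      subst this
      refine exists_hull_params_of' hL hL0 hq0 hn (by norm_num) (c23 h) (by norm_num) ?_
      norm_num
      nlinarith
    · have := hL3 h
      refine exists_hull_params_of' hL hL0 hq0 hn (by norm_num) (c33 h)
        (by norm_num; linarith) ?_
      norm_num
      nlinarith
    · linarith [hL4 h]
  · refine exists_hull_params_of' hL hL0 hq0 hn (Y := 9 * (t + 1 + L) / 32) (by positivity)
      (log_coordMgf_le_of_le hk1 hL (by linarith)) (by linarith) ?_
    have : ((t + 2) / 2 + (2 * (9 * (t + 1 + L) / 32) + 1)) ^ 2 ≤ (9 / 8 * (t + 1 + L)) ^ 2 :=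
      pow_le_pow_left₀ (by positivity) (by linarith) 2
    linarith

/-- The admissible `q = κ²` grows with `n`: `25/24` at `n = 3`, `9/8` from `n = 4`, `6/5` from `n =
5`. The hypothesis forces `n ≥ 3`, and `n ≥ 5` when `k = 1`. The cases then choose `Y`: often `Y =
L`, with special values for small `k`. -/
theorem exists_hull_params {t k n : ℕ} (ht : 1 ≤ t) (hk : 1 ≤ k)
    (hlarge : 2 * ((t + 1) * Real.log 2 + Real.log k) < n * (Real.log 2 + Real.log k)) :
    ∃ κ x : ℝ, 0 < κ ∧ 32 * n * (n + 1) * κ ^ 2 ≤ (7 * n - 1) ^ 2 ∧ 0 < x ∧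
      (t / 2 + 1) * Real.log 2 + (1 - (1 / 2) ^ t) * Real.log (coordMgf k x) +
        (1 / 2) ^ t * (Real.log k + κ ^ 2 * x / 8) ≤
      κ * Real.sqrt x * Real.sqrt (2 * (t + 1) * Real.log 2 + 2 * Real.log k) := by
  have hl : 0 < Real.log 2 := Real.log_pos one_lt_two
  obtain ⟨L, hL⟩ : ∃ L, Real.log k = L * Real.log 2 :=
    ⟨Real.log k / Real.log 2, (div_mul_cancel₀ _ hl.ne').symm⟩
  have hk' : (1 : ℝ) ≤ k := by exact_mod_cast hk
  have hL0 : 0 ≤ L := by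
    have := Real.log_nonneg hk'
    rw [hL] at this
    exact nonneg_of_mul_nonneg_left this hl
  have hn : 2 * (t + 1 + L) < n * (1 + L) := by
    rw [hL] at hlarge
    refine lt_of_mul_lt_mul_right ?_ hl.le
    linarith
  have ht' : (1 : ℝ) ≤ t := by exact_mod_cast ht
  have hn3 : 3 ≤ n := by
    by_contra hc
    have : (n : ℝ) ≤ 2 := by exact_mod_cast (by omega : n ≤ 2)
    nlinarith
  have hn3' : (3 : ℝ) ≤ n := by exact_mod_cast hn3
  have hq1 : 32 * n * (n + 1) * 1 ≤ (7 * n - 1 : ℝ) ^ 2 := by nlinarith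
  have hC := log_coordMgf_le_of_le hk hL le_rfl
  have hL2 : k = 2 → L = 1 := by
    rintro rfl
    push_cast at hL
    nlinarith
  have hL3 : k = 3 → 19 / 12 ≤ L ∧ L ≤ 8 / 5 := by
    rintro rfl
    push_cast at hL
    have h1 := nineteen_twelfths_le_log_three
    have h2 := log_three_le_eight_fifths
    rw [hL] at h1 h2
    exact ⟨le_of_mul_le_mul_right h1 hl, le_of_mul_le_mul_right h2 hl⟩
  have hL4 : 4 ≤ k → 2 ≤ L := by
    intro h4
    have := Real.log_le_log (x := 2 ^ 2) (y := k) (by norm_num) (by norm_num; exact_mod_cast h4)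
    rw [Real.log_pow, hL] at this
    exact_mod_cast le_of_mul_le_mul_right this hl
  rcases (by omega : k = 1 ∨ 2 ≤ k) with rfl | hk2
  · have : L = 0 := by
      simp at hL
      rcases hL with h | h
      · exact h
      · linarith
    subst this
    have hn5 : (5 : ℝ) ≤ n := by
      have : 2 * (t + 1) < n := by exact_mod_cast (by linarith : 2 * ((t : ℝ) + 1) < n)
      exact_mod_cast (by omega : 5 ≤ n)
    -- For `k = 1` the moment is exactly `exp x`, so `B = 2 Y`. This `Y` makes the right-hand side
    -- the square of `6/5 (t + 1)`.
    have hB : Real.log (coordMgf 1 (2 * ((6 / 5 * (t + 1) / 4) * Real.log 2))) ≤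
        (2 * (6 / 5 * (t + 1) / 4 : ℝ)) * Real.log 2 := by
      rw [coordMgf]
      simp
      linarith
    have hq : 32 * n * (n + 1) * (6 / 5) ≤ (7 * n - 1 : ℝ) ^ 2 := by nlinarith
    rcases (by omega : t = 1 ∨ t = 2 ∨ t = 3 ∨ 4 ≤ t) with rfl | rfl | rfl | ht4
    iterate 3
      refine exists_hull_params_of hL (by norm_num) hq (by positivity) hB ?_
      norm_num
    have ht4' : (4 : ℝ) ≤ t := by exact_mod_cast ht4
    refine exists_hull_params_of' hL hL0 (by norm_num) hq (by positivity) hB (by linarith) ?_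
    nlinarith
  have hL1 : 1 ≤ L := by
    rcases (by omega : k = 2 ∨ k = 3 ∨ 4 ≤ k) with h | h | h
    · exact (hL2 h).ge
    · linarith [hL3 h]
    · linarith [hL4 h]
  have hL3' : 3 ≤ k → 19 / 12 ≤ L := by
    intro h
    rcases (by omega : k = 3 ∨ 4 ≤ k) with h | h
    · exact (hL3 h).1
    · linarith [hL4 h]
  rcases (by omega : n = 3 ∨ 4 ≤ n) with rfl | hn4
  · push_cast at hn
    rcases (by omega : t = 1 ∨ t = 2 ∨ 3 ≤ t) with rfl | rfl | ht3
    · have : 19 / 12 ≤ L := hL3' (by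
        by_contra h
        linarith [hL2 (by omega)])
      refine exists_hull_params_of hL one_pos hq1 (by linarith) hC ?_
      norm_num
      nlinarith
    · refine exists_hull_params_of hL one_pos hq1 (by linarith) hC ?_
      norm_num at hn ⊢
      nlinarith
    · have ht3' : (3 : ℝ) ≤ t := by exact_mod_cast ht3
      refine exists_hull_params_of' (q := 25 / 24) hL hL0 (by norm_num) (by norm_num)
        (by linarith) hC (by linarith) ?_
      nlinarith
  have hn4' : (4 : ℝ) ≤ n := by exact_mod_cast hn4
  have hq9 : 32 * n * (n + 1) * (9 / 8) ≤ (7 * n - 1 : ℝ) ^ 2 := by nlinarith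
  have hq0 : (0 : ℝ) < 9 / 8 := by norm_num
  have c22 : k = 2 → Real.log (coordMgf k (2 * ((2 : ℕ) * Real.log 2))) ≤
      ((13 : ℕ) / (3 : ℕ) : ℝ) * Real.log 2 := by
    rintro rfl
    exact log_coordMgf_le_of_pow_le (by norm_num) (by norm_num) (by norm_num)
  have c33 : k = 3 → Real.log (coordMgf k (2 * ((3 : ℕ) * Real.log 2))) ≤
      ((19 : ℕ) / (3 : ℕ) : ℝ) * Real.log 2 := by
    rintro rfl
    exact log_coordMgf_le_of_pow_le (by norm_num) (by norm_num) (by norm_num)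
  rcases (by omega : t = 1 ∨ t = 2 ∨ t = 3 ∨ t = 4 ∨ 5 ≤ t) with rfl | rfl | rfl | rfl | ht5
  · rcases (by omega : k = 2 ∨ 3 ≤ k) with h | h
    · have := hL2 h
      subst this
      refine exists_hull_params_of hL hq0 hq9 one_pos hC ?_
      norm_num
    · have := hL3' h
      refine exists_hull_params_of hL one_pos hq1 (by linarith) hC ?_
      norm_num
      nlinarith
  · rcases (by omega : k = 2 ∨ 3 ≤ k) with h | h
    · have := hL2 h
      subst this
      refine exists_hull_params_of hL hq0 hq9 (by norm_num) (c22 h) ?_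
      norm_num
    · have := hL3' h
      refine exists_hull_params_of hL hq0 hq9 (by linarith) hC ?_
      norm_num
      nlinarith
  · rcases (by omega : k = 2 ∨ k = 3 ∨ 4 ≤ k) with h | h | h
    · have := hL2 h
      subst this
      refine exists_hull_params_of hL hq0 hq9 (by norm_num) (c22 h) ?_
      norm_num
    · have := hL3 h
      refine exists_hull_params_of hL hq0 hq9 (by norm_num) (c33 h) ?_
      norm_num
      nlinarith
    · have := hL4 h
      refine exists_hull_params_of hL hq0 hq9 (by linarith) hC ?_
      norm_num
      nlinarith
  · rcases (by omega : k = 2 ∨ k = 3 ∨ 4 ≤ k) with h | h | h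
    · have := hL2 h
      subst this
      refine exists_hull_params_of hL hq0 hq9 (by norm_num) (c22 h) ?_
      norm_num
    · have := hL3 h
      refine exists_hull_params_of hL hq0 hq9 (by norm_num) (c33 h) ?_
      norm_num
      nlinarith
    · have := hL4 h
      refine exists_hull_params_of hL hq0 hq9 (by linarith) hC ?_
      norm_num
      nlinarith
  exact exists_hull_params_of_five_le ht5 hk2 hL hL0 hq9 hL2 hL3 hL4

/-! ### The main theorem -/

theorem SubG.meanDev_hullClass_l1Ball_le_sqrt {k : ℕ} {Γ : ℝ} {u : Euc k} {μ : Measure (Euc k)}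
    (h : SubG Γ u μ) (hk : 1 ≤ k) {τ : ℕ → ℝ → ℝ} (hτ : ∀ t, IsContr (τ t))
    (hm : ∀ t, Monotone (τ t)) {n : ℕ} (hn : 1 ≤ n) (t : ℕ) :
    meanDev (hullClass (l1Ball k) τ t) μ n ≤
      2 * Γ * Real.sqrt (2 * (t + 1 : ℕ) * Real.log 2 + 2 * Real.log k) * Real.sqrt n := by
  have hΓ := h.pos
  have hn0 : (0 : ℝ) < n := by exact_mod_cast hn
  have hk1 : (1 : ℝ) ≤ k := by exact_mod_cast hk
  have hlk : 0 ≤ Real.log k := Real.log_nonneg hk1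
  have hl2 : 0 < Real.log 2 := Real.log_pos one_lt_two
  push_cast
  rcases Nat.eq_zero_or_pos t with rfl | ht
  · simpa [hullClass] using h.meanDev_l1Ball_le hk hn
  -- If `n log (2k)` is at most the quantity under the root, the bound without averaging suffices;
  -- otherwise `n` is large enough for the numerical inequality.
  rcases lt_or_ge (2 * ((t + 1) * Real.log 2 + Real.log k)) (n * (Real.log 2 + Real.log k))
    with hlarge | hsmall
  · obtain ⟨κ, x, hκ, hκn, hx, hD⟩ := exists_hull_params ht hk hlarge
    exact h.meanDev_hullClass_l1Ball_le hk hτ hm hn t hκ hκn hx hD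
  · refine (h.meanDev_hullClass_l1Ball_le_mul hk hn hτ t).trans ?_
    have h₁ : Real.sqrt (n * Real.log (2 * k)) ≤
        Real.sqrt (2 * (t + 1) * Real.log 2 + 2 * Real.log k) := by
      refine Real.sqrt_le_sqrt ?_
      rw [Real.log_mul two_ne_zero (by positivity)]
      linarith
    rw [Real.sqrt_mul hn0.le] at h₁
    calc n * (2 * Γ * Real.sqrt (Real.log (2 * k))) =
          2 * Γ * (Real.sqrt n * Real.sqrt (Real.log (2 * k))) * Real.sqrt n := by
          nth_rewrite 1 [← Real.mul_self_sqrt hn0.le]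
          ring
      _ ≤ _ := by gcongr

theorem theorem3 (d h : ℕ) (hd : 1 ≤ d) (N : ℕ → ℕ) (hN : N 1 = h)
    (σ : ℕ → ℝ → ℝ) (L : ℕ → ℝ)
    (hσ : ∀ i ∈ Finset.Icc 1 (d - 1), IsActivation (σ i) (L i))
    (Γ : ℝ) (μ ν : Measure (Euc (N 1)))
    (hμ : IsSubGaussianClass Γ μ) (hν : IsSubGaussianClass Γ ν)
    (n m : ℕ) (hn : 1 ≤ n) (hm : 1 ≤ m) (δ : ℝ) (hδ : 0 < δ)
    (hsize : 4 * Real.sqrt (Real.log (1 / δ)) ≤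
      Real.sqrt (6 * h) * min (n : ℝ) (m : ℝ) * Real.sqrt (1 / m + 1 / n))
    (M : ℕ → ℝ) (hM : ∀ i ∈ Finset.Icc 1 d, 0 ≤ M i) :
    ((∀ i ∈ Finset.Icc 1 (d - 1), ∀ α : ℝ, 0 < α → ∀ x : ℝ, σ i (α * x) = α * σ i x) →
      ENNReal.ofReal (1 - δ) ≤ sampleLaw μ ν n m
        {z | |netDist (netClassF N σ d M) μ ν -
              netDist (netClassF N σ d M) (empMeasure z.1) (empMeasure z.2)| ≤
            2 * Γ * (∏ i ∈ Finset.Icc 1 d, M i) * (∏ i ∈ Finset.Icc 1 (d - 1), L i) *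
              (Real.sqrt (6 * d * Real.log 2 + 5 * h / 4) +
                Real.sqrt (2 * h * Real.log (1 / δ))) *
              (1 / Real.sqrt n + 1 / Real.sqrt m)}) ∧
    ((∀ i ∈ Finset.Icc 1 (d - 1), σ i 0 = 0) →
      ENNReal.ofReal (1 - δ) ≤ sampleLaw μ ν n m
        {z | |netDist (netClassOneInf N σ d M) μ ν -
              netDist (netClassOneInf N σ d M) (empMeasure z.1) (empMeasure z.2)| ≤
            2 * Γ * (∏ i ∈ Finset.Icc 1 d, M i) * (∏ i ∈ Finset.Icc 1 (d - 1), L i) *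
              (Real.sqrt (2 * d * Real.log 2 + 2 * Real.log h) +
                Real.sqrt (2 * h * Real.log (1 / δ))) *
              (1 / Real.sqrt n + 1 / Real.sqrt m)}) := by
  subst hN
  have hμ' := hμ.subG
  have hν' := hν.subG
  have hd' : d - 1 + 1 = d := by omega
  have hK : 0 ≤ M d * layerScale M L (d - 1) :=
    mul_nonneg (hM d (Finset.mem_Icc.2 ⟨hd, le_rfl⟩)) (layerScale_nonneg hM hσ le_rfl)
  have hΓK : 2 * Γ * (∏ i ∈ Finset.Icc 1 d, M i) * (∏ i ∈ Finset.Icc 1 (d - 1), L i) =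
      2 * Γ * (M d * layerScale M L (d - 1)) := by
    rw [mul_layerScale_eq hd, mul_assoc]
  rw [hΓK]
  refine ⟨fun hhom => ?_, fun h0 => ?_⟩
  · have h0 : ∀ i ∈ Finset.Icc 1 (d - 1), σ i 0 = 0 := fun i hi => by
      have := hhom i hi 2 two_pos 0
      rw [mul_zero] at this
      linarith
    have hτ := isContr_scaledAct (M := M) hσ h0
    have key := fun (ρ : Measure (Euc (N 1))) u (hρ : SubG Γ u ρ) (r : ℕ) (hr : 1 ≤ r) =>
      hρ.meanDev_hullClass_l2Ball_le hr hτ (d - 1)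
    rw [hd'] at key
    exact sampleLaw_netDist_le hμ' hν' ((lipClass_l2Ball _).hullClass hτ (d - 1)) hK
      (network_mem_hullClass_l2Ball hd hM hσ hhom h0) hn hm hδ hsize
      (fun _ => key _ _ hμ' n hn) fun _ => key _ _ hν' m hm
  · have hτ := isContr_scaledAct (M := M) hσ h0
    have key := fun (ρ : Measure (Euc (N 1))) u (hρ : SubG Γ u ρ) (r : ℕ) (hr : 1 ≤ r)
      (hk : 1 ≤ N 1) => hρ.meanDev_hullClass_l1Ball_le_sqrt hk hτ (monotone_scaledAct hσ) hr (d - 1)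
    rw [hd'] at key
    exact sampleLaw_netDist_le hμ' hν' ((lipClass_l1Ball _).hullClass hτ (d - 1)) hK
      (network_mem_hullClass_l1Ball hd hM hσ h0) hn hm hδ hsize
      (key _ _ hμ' n hn) (key _ _ hν' m hm)
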